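/- Let $T$ be an automorphism (an invertible, bimeasurable, measure-preserving transformation) of a probability space $(X,\mathcal B,\mu)$. For $k\ge 1$, $T$ is *mixing of multiplicity $k$* if for all measurable $A_0,\dots,A_k$ $$\mu(A_0\cap T^{m_1}A_1\cap T^{m_1+m_2}A_2\cap\dots\cap T^{m_1+\dots+m_k}A_k)\to\mu(A_0)\mu(A_1)\cdots\mu(A_k)\quad\text{as } m_1,\dots,m_k\to+\infty;$$ *mixing* means mixing of multiplicity $1$, and *mixing of infinite multiplicity* (of all multiplicities) means mixing of multiplicity $k$ for every $k\ge1$. For $p\ge 3$, $T$ has *property $S_p$* if every self-joining of order $p$ (a measure on $X^p$ with all one-dimensional marginals equal to $\mu$, invariant under $T\times\dots\times T$) whose projections to all $(p-1)$-dimensional faces of $X^p$ equal $\mu^{p-1}$ is the product measure $\mu^{p}$. The *spectral measure* of a function $f$ in $H=\{f\in L_2(\mu):\int f\,d\mu=0\}$ is the finite Borel measure $\sigma_f$ on the unit circle with $\int z^n\,d\sigma_f=\langle f\circ T^n,f\rangle$ for all $n\in\mathbb Z$; a *maximal spectral measure* of $T$ is a finite Borel measure $\sigma$ on the circle such that $\sigma_f\ll\sigma$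 for all $f\in H$ and $\sigma\ll\sigma_{f}$ for some $f\in H$. Write $\sigma^{*n}$ for the $n$-th convolution power of $\sigma$ on the circle group. **Theorem.** Let $T$ be a mixing automorphism of a probability space and $\sigma$ a maximal spectral measure of $T$. 1. If $\sigma$ has no common component with $\sigma^{*5}$ (that is, $\sigma$ and $\sigma^{*5}$ are mutually singular), then $T$ has property $S_p$ for every $p\ge3$, and $T$ is mixing of all multiplicities. 2. If $\sigma^{*m}$ and $\sigma^{*n}$ are mutually singular for some integers $m,n\ge1$, then $T$ is mixing of infinite multiplicity. -/

import Mathlib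

open MeasureTheory Filter Topology

namespace MultipleMixing

/-- The circle group carries its Borel σ-algebra. -/
noncomputable instance instMeasurableSpaceCircle : MeasurableSpace Circle := borel Circle

instance instBorelSpaceCircle : BorelSpace Circle := ⟨rfl⟩

variable {X : Type*} [MeasurableSpace X]

/-- `T` is mixing of multiplicity `k` (with respect to `μ`): for all measurable `A₀, …, A_k`,
`μ (A₀ ∩ T^{m₁} A₁ ∩ T^{m₁+m₂} A₂ ∩ ⋯ ∩ T^{m₁+⋯+m_k} A_k) → μ A₀ ⋯ μ A_k`
as `m₁, …, m_k → +∞` (independently of each other). -/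
def IsMixingOfMultiplicity (T : X ≃ᵐ X) (μ : Measure X) (k : ℕ) : Prop :=
  ∀ A : Fin (k + 1) → Set X, (∀ i, MeasurableSet (A i)) →
    Tendsto
      (fun m : Fin k → ℕ =>
        μ (⋂ i : Fin (k + 1),
          (⇑T)^[∑ j ∈ Finset.univ.filter (fun j : Fin k => (j : ℕ) < (i : ℕ)), m j] '' A i))
      atTop (𝓝 (∏ i, μ (A i)))

/-- Mixing: multiplicity one. -/
def IsMixing (T : X ≃ᵐ X) (μ : Measure X) : Prop :=
  IsMixingOfMultiplicity T μ 1

/-- Mixing of all multiplicities (of infinite multiplicity). -/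
def IsMixingOfAllMultiplicities (T : X ≃ᵐ X) (μ : Measure X) : Prop :=
  ∀ k : ℕ, 1 ≤ k → IsMixingOfMultiplicity T μ k

/-- A self-joining of order `n`: a measure on `Xⁿ` with all one-dimensional marginals `μ`,
invariant under `T × ⋯ × T`. -/
structure IsSelfJoining (T : X ≃ᵐ X) (μ : Measure X) (n : ℕ) (ν : Measure (Fin n → X)) :
    Prop where
  map_eval : ∀ i : Fin n, ν.map (fun x => x i) = μ
  map_prod : ν.map (fun x i => T (x i)) = ν

/-- Property `S(m, n)`: every self-joining of order `n` whose projections to all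
`m`-dimensional faces of `Xⁿ` are `μᵐ` is the product measure `μⁿ`. -/
def PropertyS (T : X ≃ᵐ X) (μ : Measure X) (m n : ℕ) : Prop :=
  ∀ ν : Measure (Fin n → X), IsSelfJoining T μ n ν →
    (∀ s : Finset (Fin n), s.card = m →
      ν.map (fun (x : Fin n → X) (i : s) => x i) = Measure.pi (fun _ : s => μ)) →
    ν = Measure.pi (fun _ : Fin n => μ)

/-- `ρ` is the spectral measure of `f` for the Koopman operator `f ↦ f ∘ T` on `L²(μ)`:
a finite measure on the circle whose `n`-th Fourier coefficient is `⟨f ∘ Tⁿ, f⟩`, `n ∈ ℤ`. -/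
def IsSpectralMeasure (T : X ≃ᵐ X) (μ : Measure X) (f : X → ℂ) (ρ : Measure Circle) : Prop :=
  IsFiniteMeasure ρ ∧
    ∀ n : ℤ, ∫ z : Circle, (z : ℂ) ^ n ∂ρ =
      ∫ x, f (((T.toEquiv : Equiv.Perm X) ^ n) x) * (starRingEnd ℂ) (f x) ∂μ

/-- `f` represents an element of the space `H` of square-integrable functions orthogonal to the
constants. -/
def IsCentredL2 (μ : Measure X) (f : X → ℂ) : Prop :=
  MemLp f 2 μ ∧ ∫ x, f x ∂μ = 0

/-- `σ` is a spectral measure of `T` (a finite measure of maximal spectral type of the Koopman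
operator on `H`): it dominates the spectral measures of all elements of `H`, and it is dominated
by (hence equivalent to) one of them. -/
structure IsMaximalSpectralMeasure (T : X ≃ᵐ X) (μ : Measure X) (σ : Measure Circle) :
    Prop where
  isFinite : IsFiniteMeasure σ
  dominates : ∀ (f : X → ℂ) (ρ : Measure Circle),
    IsCentredL2 μ f → IsSpectralMeasure T μ f ρ → ρ ≪ σ
  attained : ∃ (f : X → ℂ) (ρ : Measure Circle),
    IsCentredL2 μ f ∧ IsSpectralMeasure T μ f ρ ∧ σ ≪ ρ

/-- The convolution power `σ^{*n}` of a measure on the circle group (`σ^{*0}` is the unit mass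
at the neutral element, `σ^{*(n+1)} = σ^{*n} * σ`). -/
noncomputable def convPow (σ : Measure Circle) : ℕ → Measure Circle
  | 0 => Measure.dirac 1
  | n + 1 => (convPow σ n).mconv σ

end MultipleMixing

open ProbabilityTheory

/-! Both parts follow from one statement: if diagonally invariant joinings of at least three copies
become independent in the limit whenever one coordinate is dropped, then they become fully
independent. Applied to orbit segments this is the induction step from multiplicity k to k + 1;
applied to one fixed joining it is property S_p. By multilinearity it suffices that ∫ ∏ f_i(x_i)
tends to 0 for centred indicators f_i
(`AsymptoticallyFaceIndependent.tendsto_integral_centredIndicator`).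

Consider the functional on trigonometric polynomials of two variables that sends u^a v^b to ∫
f_0(T^a x_0) f_1(T^b x_1) ∏_{i ≥ 2} f_i(x_i). Diagonal invariance and Cauchy-Schwarz allow f_2, f_1
or f_0 to be removed. Face independence then evaluates the remaining second moment: it is the L²
norm for the image of a product of spectral measures under (z_0, z_1), (z_0, (∏ z_i)⁻¹) or ((∏
z_i)⁻¹, z_1), the removed coordinate being 1. If these three measures have no common part, the
constant 1 is a sum of three polynomials, each small in one of the three norms, and the correlation
vanishes in the limit.

A common part is a tie: a nonzero law of pairs (x, y) for which any two of x, y, (xy)⁻¹ are jointly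
absolutely continuous with respect to a product. Two copies glued over y give (x, x') such that x'/x
is, up to absolute continuity, independent of x and also of x' (`exists_gluing`). Translations by
such quotients carry part of the spectral measure into its own measure class. Passing to an ergodic
component for a countable group of translations gives a probability measure η, dominated by
translates of the spectral measure, with tη ≪ η for η-almost every t (`exists_selfTranslating`).
Mixing excludes atoms, and a nonatomic η of this kind cannot be singular to Haar measure: the
translations moving η only slightly in variation contain an arc (`not_mutuallySingular_haar`).

So a tie forces σ to have an absolutely continuous part. Mixing also makes σ charge every
neighbourhood of 1 once some set has measure strictly between 0 and 1. A measure with these two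
properties has no two mutually singular convolution powers (`not_mutuallySingular_convPow`), against
the hypothesis. -/

namespace MultipleMixing

/-! ### Translations that almost preserve a measure. -/

section AlmostInvariance

variable {G : Type*} [CommGroup G] [TopologicalSpace G]
  [MeasurableSpace G]

/-- The translations moving `η` by at most `ε`, tested on continuous functions with values in
`[0, 1]`. -/
def almostInvariant (η : Measure G) (ε : ℝ) : Set G :=
  {t | ∀ φ : C(G, ℝ), (∀ x, 0 ≤ φ x ∧ φ x ≤ 1) → |∫ x, φ (t * x) ∂η - ∫ x, φ x ∂η| ≤ ε}

lemma one_mem_almostInvariant {η : Measure G} {ε : ℝ} (h : 0 ≤ ε) :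
    (1 : G) ∈ almostInvariant η ε := by
  intro φ _; simpa using h

variable [IsTopologicalGroup G]

lemma inv_mem_almostInvariant {η : Measure G} {ε : ℝ} {t : G} (ht : t ∈ almostInvariant η ε) :
    t⁻¹ ∈ almostInvariant η ε := by
  intro φ hφ
  have := ht (φ.comp ⟨fun x => t⁻¹ * x, by fun_prop⟩) (fun x => hφ _)
  simp only [ContinuousMap.comp_apply, ContinuousMap.coe_mk, inv_mul_cancel_left] at this
  rwa [abs_sub_comm]

lemma mul_mem_almostInvariant {η : Measure G} {ε δ : ℝ} {t u : G}
    (ht : t ∈ almostInvariant η ε) (hu : u ∈ almostInvariant η δ) :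
    t * u ∈ almostInvariant η (ε + δ) := by
  intro φ hφ
  have h1 := hu (φ.comp ⟨fun x => t * x, by fun_prop⟩) (fun x => hφ _)
  have h2 := ht φ hφ
  simp only [ContinuousMap.comp_apply, ContinuousMap.coe_mk] at h1
  simp only [mul_assoc]
  calc _ ≤ _ := abs_sub_le _ (∫ x, φ (t * x) ∂η) _
    _ ≤ ε + δ := by linarith

variable [BorelSpace G]

/-- Testing only on continuous functions makes every condition closed in t, by dominated
convergence. Although the condition controls variation, no continuity of t ↦ tη in variation is
needed. -/
lemma isClosed_almostInvariant [FirstCountableTopology G] (η : Measure G) [IsFiniteMeasure η]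
    (ε : ℝ) :
    IsClosed (almostInvariant η ε) := by
  simp only [almostInvariant, Set.ofPred_forall]
  refine isClosed_iInter fun φ => isClosed_iInter fun hφ => isClosed_le ?_ continuous_const
  refine (Continuous.sub ?_ continuous_const).abs
  refine continuous_of_dominated (bound := fun _ => 1) (fun t => ?_) (fun t => ?_)
    (integrable_const _) (ae_of_all _ fun x => by fun_prop)
  · exact (φ.continuous.comp (by fun_prop)).measurable.aestronglyMeasurable
  · exact ae_of_all _ fun x => by
      rw [Real.norm_eq_abs, abs_of_nonneg (hφ _).1]; exact (hφ _).2

/-- Passes from continuous tests to closed sets, whose indicators are limits of [0, 1]-valued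
continuous functions. -/
lemma le_measureReal_preimage_mul [HasOuterApproxClosed G] {η : Measure G} [IsFiniteMeasure η]
    {ε : ℝ} {t : G} (ht : t ∈ almostInvariant η ε) {F : Set G} (hF : IsClosed F) :
    η.real F - ε ≤ η.real ((t * ·) ⁻¹' F) := by
  have key : ∀ u : G, Tendsto (fun n => ∫ x, (hF.apprSeq n (u * x) : ℝ) ∂η) atTop
      (𝓝 (η.real ((u * ·) ⁻¹' F))) := by
    intro u
    have hm : MeasurableSet ((u * ·) ⁻¹' F) := (hF.preimage (by fun_prop)).measurableSet
    rw [← integral_indicator_one hm]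
    refine tendsto_integral_of_dominated_convergence (fun _ => 1) (fun n => ?_)
      (integrable_const _) (fun n => ae_of_all _ fun x => ?_) (ae_of_all _ fun x => ?_)
    · have : Continuous fun x => ((hF.apprSeq n (u * x) : NNReal) : ℝ) :=
        NNReal.continuous_coe.comp ((hF.apprSeq n).continuous.comp (by fun_prop))
      exact this.measurable.aestronglyMeasurable
    · rw [Real.norm_eq_abs, abs_of_nonneg (NNReal.coe_nonneg _)]
      exact_mod_cast HasOuterApproxClosed.apprSeq_apply_le_one hF n _
    · have h := (tendsto_pi_nhds.1 (HasOuterApproxClosed.tendsto_apprSeq hF)) (u * x)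
      have h' := (NNReal.tendsto_coe.2 h)
      convert h' using 2
      by_cases hx : u * x ∈ F <;> simp [Set.indicator, hx]
  have h1 := key t
  have h2 := key 1
  simp only [one_mul, Set.preimage_id'] at h2
  refine le_of_tendsto_of_tendsto (h2.sub_const ε) h1 (Eventually.of_forall fun n => ?_)
  have h3 := ht ⟨fun x => (hF.apprSeq n x : ℝ),
    NNReal.continuous_coe.comp (hF.apprSeq n).continuous⟩ fun x =>
      ⟨NNReal.coe_nonneg _, by exact_mod_cast HasOuterApproxClosed.apprSeq_apply_le_one hF n _⟩
  simp only [ContinuousMap.coe_mk] at h3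
  linarith [(abs_le.1 h3).1]

end AlmostInvariance

/-! ### Densities in L¹ and countable dense families of parameters. -/

section Density

/-- Separability of the target replaces any regularity of f: countably many parameters approximate
all others through their images. -/
lemma exists_countable_dense_image {ι β : Type*} [TopologicalSpace β]
    [TopologicalSpace.PseudoMetrizableSpace β] [SecondCountableTopology β] (f : ι → β)
    (S : Set ι) : ∃ C ⊆ S, C.Countable ∧ f '' S ⊆ closure (f '' C) := by
  obtain ⟨c, hcS, hc, hd⟩ := (TopologicalSpace.IsSeparable.of_separableSpace
    (f '' S)).exists_countable_dense_subset
  obtain ⟨C, hCS, hb⟩ := ((Set.surjOn_image f S).mono subset_rfl hcS).exists_bijOn_subset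
  exact ⟨C, hCS, Set.countable_of_injective_of_countable_image hb.injOn (by rwa [hb.image_eq]), by rwa [hb.image_eq]⟩

variable {Y : Type*} [MeasurableSpace Y]

/-- The density of `ν` with respect to `s`, as an element of `L¹`. -/
noncomputable def densityL1 (ν s : Measure Y) [IsFiniteMeasure ν] : Lp ℝ 1 s :=
  (Measure.integrable_toReal_rnDeriv (μ := ν) (ν := s)).toL1 _

lemma integral_eq_integral_mul_densityL1 {ν s : Measure Y} [IsFiniteMeasure ν] [SigmaFinite s]
    (h : ν ≪ s) (ψ : Y → ℝ) : ∫ x, ψ x ∂ν = ∫ x, ψ x * densityL1 ν s x ∂s := by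
  rw [← integral_rnDeriv_smul h]
  refine integral_congr_ae ?_
  filter_upwards [Integrable.coeFn_toL1 (Measure.integrable_toReal_rnDeriv (μ := ν) (ν := s))]
    with x hx
  rw [densityL1, hx, smul_eq_mul, mul_comm]

lemma abs_integral_mul_sub_le {s : Measure Y} {ψ : Y → ℝ} (hψ : Measurable ψ) {C : ℝ}
    (hC : ∀ x, |ψ x| ≤ C) (f g : Lp ℝ 1 s) :
    |∫ x, ψ x * f x ∂s - ∫ x, ψ x * g x ∂s| ≤ C * ‖f - g‖ := by
  have hi : ∀ f : Lp ℝ 1 s, Integrable (fun x => ψ x * f x) s := fun f =>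
    (L1.integrable_coeFn f).bdd_mul hψ.aestronglyMeasurable (ae_of_all _ hC)
  rw [← integral_sub (hi f) (hi g), L1.norm_eq_integral_norm, ← integral_const_mul,
    ← Real.norm_eq_abs]
  refine norm_integral_le_of_norm_le ((L1.integrable_coeFn _).norm.const_mul C) ?_
  filter_upwards [Lp.coeFn_sub f g] with x hx
  rw [hx, Pi.sub_apply, ← mul_sub, norm_mul]
  exact mul_le_mul_of_nonneg_right (hC x) (norm_nonneg _)

lemma abs_integral_sub_le_norm_densityL1 {ν ν' s : Measure Y} [IsFiniteMeasure ν]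
    [IsFiniteMeasure ν'] [SigmaFinite s] (h : ν ≪ s) (h' : ν' ≪ s) {ψ : Y → ℝ}
    (hψ : Measurable ψ) {C : ℝ} (hC : ∀ x, |ψ x| ≤ C) :
    |∫ x, ψ x ∂ν - ∫ x, ψ x ∂ν'| ≤ C * ‖densityL1 ν s - densityL1 ν' s‖ := by
  rw [integral_eq_integral_mul_densityL1 h, integral_eq_integral_mul_densityL1 h']
  exact abs_integral_mul_sub_le hψ hC _ _

instance factOneNeTop : Fact ((1 : ENNReal) ≠ ⊤) := ⟨ENNReal.one_ne_top⟩

end Density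

/-! ### Measures whose class is preserved by almost all of their own translations. -/

section SelfTranslating

variable {η : Measure Circle} [IsProbabilityMeasure η]

/-- Countably many translates of `almostInvariant η ε` cover almost all of `η`. -/
lemma exists_countable_cover (h : ∀ᵐ t ∂η, η.map (t * ·) ≪ η) {ε : ℝ} (hε : 0 < ε) :
    ∃ C : Set Circle, C.Countable ∧ ∀ᵐ t ∂η, ∃ c ∈ C, t * c⁻¹ ∈ almostInvariant η ε := by
  obtain ⟨C, hCS, hC, hd⟩ := exists_countable_dense_image
    (fun t : Circle => densityL1 (η.map (t * ·)) η) {t | η.map (t * ·) ≪ η}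
  refine ⟨C, hC, h.mono fun t ht => ?_⟩
  obtain ⟨_, ⟨c, hc, rfl⟩, hcε⟩ := Metric.mem_closure_iff.1 (hd ⟨t, ht, rfl⟩) ε hε
  refine ⟨c, hc, fun φ hφ => ?_⟩
  have h1 := abs_integral_sub_le_norm_densityL1 ht (hCS hc) (ψ := fun x => φ (c⁻¹ * x)) (C := 1)
    (φ.continuous.comp (by fun_prop)).measurable (fun x => by
      rw [abs_of_nonneg (hφ _).1]; exact (hφ _).2)
  have hm : ∀ ν : Measure Circle, AEStronglyMeasurable (fun x => φ (c⁻¹ * x)) ν := fun ν =>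
    (φ.continuous.comp (by fun_prop : Continuous fun x => c⁻¹ * x)).aestronglyMeasurable
  rw [integral_map (by fun_prop) (hm _), integral_map (by fun_prop) (hm _)] at h1
  rw [dist_eq_norm] at hcε
  simp only [inv_mul_cancel_left, one_mul] at h1
  have e : ∀ x, t * c⁻¹ * x = c⁻¹ * (t * x) := fun x => by
    rw [mul_comm t, mul_assoc]
  simp only [e]
  linarith

/-- A total boundedness statement. A large part F of η is covered by finitely many translates of the
almost invariant set. If t moves η by at most 1/2, then F meets its translate, so t is a quotient of
two points of F. -/
lemma exists_finite_cover (h : ∀ᵐ t ∂η, η.map (t * ·) ≪ η) {ε : ℝ} (hε : 0 < ε) :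
    ∃ D : Set Circle, D.Finite ∧ ∀ t ∈ almostInvariant η (1 / 2), ∃ d ∈ D,
      t * d⁻¹ ∈ almostInvariant η ε := by
  obtain ⟨C, hC, hcov⟩ := exists_countable_cover h (half_pos hε)
  have hne : C.Nonempty := by
    obtain ⟨t, c, hc, _⟩ := hcov.exists
    exact ⟨c, hc⟩
  obtain ⟨c, rfl⟩ := hC.exists_eq_range hne
  set N := almostInvariant η (ε / 2)
  have hN : IsClosed N := isClosed_almostInvariant _ _
  set F : ℕ → Set Circle := fun M => ⋃ i ∈ Finset.range M, (· * (c i)⁻¹) ⁻¹' N with hF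
  have hFc : ∀ M, IsClosed (F M) := fun M =>
    isClosed_biUnion_finset fun i _ => hN.preimage (continuous_mul_const _)
  have hmono : Monotone F := fun a b hab =>
    Set.biUnion_subset_biUnion_left (by simpa using hab)
  have hlim : Tendsto (fun M => η.real (F M)) atTop (𝓝 1) := by
    have h1 := tendsto_measure_iUnion_atTop (μ := η) hmono
    have h2 : η (⋃ M, F M) = 1 := by
      rw [prob_compl_eq_zero_iff₀ (MeasurableSet.iUnion fun M => (hFc M).measurableSet).nullMeasurableSet |>.symm]
      refine measure_mono_null ?_ hcov
      intro t ht ht'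
      obtain ⟨_, ⟨i, rfl⟩, hi⟩ := ht'
      exact ht (Set.mem_iUnion.2 ⟨i + 1, Set.mem_iUnion₂.2 ⟨i, by simp, hi⟩⟩)
    rw [h2] at h1
    exact (ENNReal.tendsto_toReal ENNReal.one_ne_top).comp h1
  -- With mass above 3/4, F and its preimage under t have total mass above 3/4 + (3/4 - 1/2) = 1, so
  -- they intersect.
  obtain ⟨M, hM⟩ := (hlim.eventually_const_lt (show (3 / 4 : ℝ) < 1 by norm_num)).exists
  refine ⟨Set.image2 (fun i j => c i * (c j)⁻¹) (Finset.range M) (Finset.range M),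
    Set.Finite.image2 _ (Finset.finite_toSet _) (Finset.finite_toSet _), fun t ht => ?_⟩
  have h1 := le_measureReal_preimage_mul ht (hFc M)
  have : (F M ∩ (t * ·) ⁻¹' F M).Nonempty := by
    by_contra hemp
    rw [Set.not_nonempty_iff_eq_empty, ← Set.disjoint_iff_inter_eq_empty] at hemp
    have h2 := measureReal_union (μ := η) hemp
      ((hFc M).preimage (continuous_const_mul t)).measurableSet (measure_ne_top _ _) (measure_ne_top _ _)
    have h3 : η.real (F M ∪ (t * ·) ⁻¹' F M) ≤ 1 := measureReal_le_one
    linarith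
  obtain ⟨x, hx, hx'⟩ := this
  obtain ⟨i, hi, hx⟩ := Set.mem_iUnion₂.1 hx
  obtain ⟨j, hj, hx'⟩ := Set.mem_iUnion₂.1 hx'
  refine ⟨_, ⟨j, hj, i, hi, rfl⟩, ?_⟩
  have h4 := mul_mem_almostInvariant hx' (inv_mem_almostInvariant hx)
  rw [add_halves] at h4
  convert h4 using 1
  simp only [mul_inv_rev, inv_inv, mul_assoc]
  rw [mul_comm (c i) x⁻¹, mul_left_comm (c j)⁻¹, mul_inv_cancel_left, mul_comm (c i)]

/-- Near the identity, the values of the displacement of `η` have a gap. -/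
lemma exists_gap (h : ∀ᵐ t ∂η, η.map (t * ·) ≪ η) :
    ∀ᶠ t in 𝓝 (1 : Circle), t ∈ almostInvariant η (1 / 2) → t ∈ almostInvariant η (1 / 4) := by
  by_contra hcon
  obtain ⟨u, hu, hu'⟩ := exists_seq_forall_of_frequently (not_eventually.1 hcon)
  push Not at hu'
  -- By pigeonhole infinitely many u m share one translate. Then u n (u m)⁻¹ is almost invariant
  -- within 1/8 + 1/8, and it tends to u n because u m tends to 1.
  obtain ⟨D, hD, hcov⟩ := exists_finite_cover h (show (0 : ℝ) < 1 / 8 by norm_num)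
  choose d hd hd' using fun n => hcov (u n) (hu' n).1
  have := hD.to_subtype
  obtain ⟨⟨e, he⟩, hinf⟩ := Finite.exists_infinite_fiber (fun n => (⟨d n, hd n⟩ : D))
  have hinf' : {n | d n = e}.Infinite := by
    rw [Set.infinite_coe_iff] at hinf
    convert hinf using 1
    ext n
    simp
  obtain ⟨n, hn⟩ := hinf'.nonempty
  refine (hu' n).2 ?_
  have hlim : Tendsto (fun m => u n * (u m)⁻¹) atTop (𝓝 (u n)) := by
    simpa using (tendsto_const_nhds (x := u n)).mul hu.inv
  refine (isClosed_almostInvariant η (1 / 4)).mem_of_frequently_of_tendsto ?_ hlim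
  refine (Nat.frequently_atTop_iff_infinite.2 hinf').mono fun m hm => ?_
  have h1 := mul_mem_almostInvariant (hd' n) (inv_mem_almostInvariant (hd' m))
  rw [hn, hm] at h1
  have e4 : (1 / 8 + 1 / 8 : ℝ) = 1 / 4 := by norm_num
  rw [e4] at h1
  convert h1 using 1
  simp

/-- Some translate of the almost invariant set for 1/8 has positive η-mass, hence is infinite as η
has no atoms. It accumulates by compactness, and quotients of nearby points are small. -/
lemma exists_small_translation (h : ∀ᵐ t ∂η, η.map (t * ·) ≪ η) (hna : ∀ x, η {x} = 0)
    {U : Set Circle} (hU : U ∈ 𝓝 (1 : Circle)) :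
    ∃ t ∈ U, t ≠ 1 ∧ t ∈ almostInvariant η (1 / 4) := by
  obtain ⟨C, hC, hcov⟩ := exists_countable_cover h (show (0 : ℝ) < 1 / 8 by norm_num)
  have : ∃ c ∈ C, η ((· * c⁻¹) ⁻¹' almostInvariant η (1 / 8)) ≠ 0 := by
    by_contra! hcon
    have h0 := (measure_biUnion_null_iff hC).2 hcon
    have h1 : ∀ᵐ t ∂η, False := by
      filter_upwards [hcov, measure_eq_zero_iff_ae_notMem.1 h0] with t ⟨c, hc, ht⟩ ht'
      exact ht' (Set.mem_biUnion hc ht)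
    exact IsProbabilityMeasure.ne_zero η (by simpa using h1)
  obtain ⟨c, -, hc⟩ := this
  set V := (· * c⁻¹) ⁻¹' almostInvariant η (1 / 8)
  have hinf : V.Infinite := fun hfin => hc <| by
    rw [← Set.biUnion_of_singleton V]
    exact (measure_biUnion_null_iff hfin.countable).2 fun x _ => hna x
  obtain ⟨x, -, hx⟩ := hinf.exists_accPt_of_subset_isCompact isCompact_univ (Set.subset_univ _)
  have hlim : Tendsto (fun p : Circle × Circle => p.1 * p.2⁻¹) (𝓝 x ×ˢ 𝓝 x) (𝓝 1) := by
    have : Continuous (fun p : Circle × Circle => p.1 * p.2⁻¹) := by fun_prop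
    have h2 := this.tendsto (x, x)
    rwa [nhds_prod_eq, mul_inv_cancel] at h2
  obtain ⟨W, hW, hWU⟩ := mem_prod_same_iff.1 (hlim hU)
  obtain ⟨y, ⟨hyW, hyV⟩, hyx⟩ := accPt_iff_nhds.1 hx W hW
  obtain ⟨z, ⟨hzW, hzV⟩, hzx⟩ := accPt_iff_nhds.1 hx (W \ {y})
    (inter_mem hW (isOpen_compl_singleton.mem_nhds (Ne.symm hyx)))
  refine ⟨z * y⁻¹, hWU (Set.mk_mem_prod hzW.1 hyW), ?_, ?_⟩
  · rw [Ne, mul_inv_eq_one]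
    exact hzW.2
  · have h1 := mul_mem_almostInvariant hzV (inv_mem_almostInvariant hyV)
    have e4 : (1 / 8 + 1 / 8 : ℝ) = 1 / 4 := by norm_num
    rw [e4] at h1
    convert h1 using 1
    simp

lemma continuousAt_arg_circle {z : Circle} (hz : (z : ℂ) ∈ Complex.slitPlane) :
    ContinuousAt (fun z : Circle => Complex.arg z) z :=
  ContinuousAt.comp (f := ((↑) : Circle → ℂ)) (Complex.continuousAt_arg hz)
    continuous_subtype_val.continuousAt

/-- Multiples of one small translation stay almost invariant: each step only gives displacement at
most 1/4 + 1/4, and the gap near the identity brings it back to 1/4. Such multiples are arbitrarily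
dense in a fixed arc, and the almost invariant set is closed. -/
lemma exists_arc_subset_almostInvariant (h : ∀ᵐ t ∂η, η.map (t * ·) ≪ η) (hna : ∀ x, η {x} = 0) :
    ∃ r > 0, ∀ θ, 0 ≤ θ → θ < r → Circle.exp θ ∈ almostInvariant η (1 / 4) := by
  have hg := (Circle.exp.continuous.tendsto' 0 1 (by simp)).eventually (exists_gap h)
  obtain ⟨r, hr, hgap⟩ := Metric.eventually_nhds_iff.1 hg
  refine ⟨r, hr, fun φ hφ hφr => ?_⟩
  refine (isClosed_almostInvariant η (1 / 4)).closure_subset_iff.2 subset_rfl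
    (mem_closure_iff_nhds.2 fun U hU => ?_)
  obtain ⟨δ, hδ, hδU⟩ := Metric.mem_nhds_iff.1 (Circle.exp.continuous.continuousAt hU)
  obtain ⟨t, ht, ht1, htN⟩ : ∃ θ : ℝ, 0 < θ ∧ θ < δ ∧
      Circle.exp θ ∈ almostInvariant η (1 / 4) := by
    have hV : ∀ᶠ z : Circle in 𝓝 1, |Complex.arg (z : ℂ)| < δ := by
      have : Tendsto (fun z : Circle => |Complex.arg z|) (𝓝 1) (𝓝 |Complex.arg (1 : Circle)|) :=
        (continuousAt_arg_circle (by simp)).abs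
      exact this.eventually_lt_const (by simpa using hδ)
    obtain ⟨z, hzV, hz1, hzN⟩ := exists_small_translation h hna hV
    have hz0 : Complex.arg z ≠ 0 := fun h0 => hz1 (by
      rw [← Circle.exp_arg z, h0, Circle.exp_zero])
    refine ⟨|Complex.arg z|, abs_pos.2 hz0, hzV, ?_⟩
    rcases abs_cases (Complex.arg z) with ⟨h1, -⟩ | ⟨h1, -⟩
    · rw [h1, Circle.exp_arg]; exact hzN
    · rw [h1, Circle.exp_neg, Circle.exp_arg]; exact inv_mem_almostInvariant hzN
  have hpow : ∀ k : ℕ, k * t ≤ φ → Circle.exp (k * t) ∈ almostInvariant η (1 / 4) := by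
    intro k
    induction k with
    | zero => intro _; simpa using one_mem_almostInvariant (η := η) (by norm_num : (0 : ℝ) ≤ 1 / 4)
    | succ k ih =>
      intro hk
      push_cast at hk ⊢
      have h1 := mul_mem_almostInvariant (ih (by linarith)) htN
      rw [← Circle.exp_add] at h1
      have e : (k : ℝ) * t + t = (k + 1) * t := by ring
      rw [e] at h1
      refine hgap ?_ (by convert h1 using 2; norm_num)
      rw [Real.dist_eq, sub_zero, abs_of_nonneg (by positivity)]
      linarith
  refine ⟨Circle.exp (⌊φ / t⌋₊ * t), hδU ?_, hpow _ ?_⟩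
  · rw [Metric.mem_ball, Real.dist_eq, abs_lt]
    have h1 := Nat.lt_floor_add_one (φ / t)
    have h2 := Nat.floor_le (div_nonneg hφ ht.le)
    rw [div_lt_iff₀ ht] at h1
    rw [le_div_iff₀ ht] at h2
    constructor <;> nlinarith
  · exact (le_div_iff₀ ht).1 (Nat.floor_le (div_nonneg hφ ht.le))

/-- A nonatomic probability measure on the circle almost all of whose own translations preserve its
null sets is not singular. -/
theorem not_mutuallySingular_haar (h : ∀ᵐ t ∂η, η.map (t * ·) ≪ η) (hna : ∀ x, η {x} = 0) :
    ¬ η ⟂ₘ Measure.haar := by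
  rintro ⟨Z, hZ, hηZ, hlZ⟩
  obtain ⟨r, hr, hN⟩ := exists_arc_subset_almostInvariant h hna
  obtain ⟨K, hKZ, hK, hηK⟩ := hZ.compl.exists_lt_isCompact (μ := η) (r := 1 / 2) (by
    rw [(prob_compl_eq_one_iff hZ).2 hηZ]; norm_num)
  -- Fubini: `K` is Haar-null, so for Haar-almost every t its preimage under t is η-null. For t in
  -- the arc this preimage has η-mass above 1/2 - 1/4.
  have hK0 : ∀ᵐ t ∂(Measure.haar : Measure Circle), η ((t * ·) ⁻¹' K) = 0 := by
    have hm : MeasurableSet {p : Circle × Circle | p.1 * p.2 ∈ K} :=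
      measurable_mul hK.measurableSet
    have h1 := (Measure.measure_prod_null hm).2 (ae_of_all η fun x => show
      Measure.haar ((Prod.mk x) ⁻¹' {p : Circle × Circle | p.1 * p.2 ∈ K}) = 0 by
        have := measure_preimage_mul (Measure.haar : Measure Circle) x K
        exact this.trans (measure_mono_null hKZ hlZ))
    have h2 := (Measure.measurePreserving_swap (μ := (Measure.haar : Measure Circle))
      (ν := η)).measure_preimage hm.nullMeasurableSet
    rw [h1] at h2
    refine (Measure.measure_ae_null_of_prod_null h2).mono fun t ht => ?_
    simpa [mul_comm, Set.preimage] using ht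
  have hpos : Measure.haar (almostInvariant η (1 / 4)) ≠ 0 := by
    set r' := min r 1
    have hr' : 0 < r' := lt_min hr one_pos
    have hr1 : r' ≤ 1 := min_le_right _ _
    have hpi := Real.pi_gt_three
    have harg : Complex.arg (Circle.exp (r' / 2)) = r' / 2 :=
      Circle.arg_exp (by linarith) (by linarith)
    have hc : ContinuousAt (fun z : Circle => Complex.arg z) (Circle.exp (r' / 2)) := by
      refine continuousAt_arg_circle (Complex.mem_slitPlane_iff_arg.2 ⟨?_, Circle.coe_ne_zero _⟩)
      rw [harg]; linarith
    have hev := hc.eventually (Ioo_mem_nhds (a := 0) (b := r') (harg.ge.trans_lt' (by linarith))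
      (harg.le.trans_lt (by linarith)))
    refine (Measure.measure_pos_of_mem_nhds Measure.haar (mem_of_superset hev fun z hz => ?_)).ne'
    rw [← Circle.exp_arg z]
    exact hN _ hz.1.le (hz.2.trans_le (min_le_left _ _))
  refine hpos (measure_mono_null (fun t ht => ?_) hK0)
  intro h0
  have h1 := le_measureReal_preimage_mul ht hK.isClosed
  have h2 : 1 / 2 < η.real K := by
    have := (ENNReal.toReal_lt_toReal (by simp) (measure_ne_top _ _)).2 hηK
    simpa [Measure.real] using this
  rw [measureReal_def _ ((t * ·) ⁻¹' K), h0] at h1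
  norm_num at h1
  linarith

end SelfTranslating

/-! ### Quasi-invariant saturation of a measure under a countable group. -/

section Saturation

variable {G : Type*} [CommGroup G] [MeasurableSpace G]

/-- The sum of the translates of `s` by the elements of `Γ`. -/
noncomputable def saturation (s : Measure G) (Γ : Subgroup G) : Measure G :=
  Measure.sum fun γ : Γ => s.map ((γ : G) * ·)

lemma absolutelyContinuous_saturation (s : Measure G) (Γ : Subgroup G) : s ≪ saturation s Γ := by
  refine Measure.AbsolutelyContinuous.trans ?_ (Measure.absolutelyContinuous_sum_right (1 : Γ)
    Measure.AbsolutelyContinuous.rfl)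
  simp [Measure.AbsolutelyContinuous.rfl, Measure.map_id']

instance sFinite_saturation (s : Measure G) [IsFiniteMeasure s] (Γ : Subgroup G) [Countable Γ] :
    SFinite (saturation s Γ) := by
  unfold saturation; infer_instance

/-- The measurable sets that are `Γ`-invariant up to null sets of the saturation of `s`. -/
def invariantSets (s : Measure G) (Γ : Subgroup G) : Set (Set G) :=
  {B | MeasurableSet B ∧ ∀ γ ∈ Γ, ∀ᵐ x ∂saturation s Γ, γ * x ∈ B ↔ x ∈ B}

lemma compl_mem_invariantSets {s : Measure G} {Γ : Subgroup G} {B : Set G}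
    (hB : B ∈ invariantSets s Γ) : Bᶜ ∈ invariantSets s Γ :=
  ⟨hB.1.compl, fun γ hγ => (hB.2 γ hγ).mono fun _ hx => not_congr hx⟩

lemma iInter_mem_invariantSets {s : Measure G} {Γ : Subgroup G} {B : ℕ → Set G}
    (hB : ∀ i, B i ∈ invariantSets s Γ) : ⋂ i, B i ∈ invariantSets s Γ := by
  refine ⟨MeasurableSet.iInter fun i => (hB i).1, fun γ hγ => ?_⟩
  filter_upwards [ae_all_iff.2 fun i => (hB i).2 γ hγ] with x hx
  simp only [Set.mem_iInter]
  exact forall_congr' hx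

lemma inter_mem_invariantSets {s : Measure G} {Γ : Subgroup G} {A B : Set G}
    (hA : A ∈ invariantSets s Γ) (hB : B ∈ invariantSets s Γ) : A ∩ B ∈ invariantSets s Γ := by
  refine ⟨hA.1.inter hB.1, fun γ hγ => ?_⟩
  filter_upwards [hA.2 γ hγ, hB.2 γ hγ] with x h1 h2 using and_congr h1 h2

variable [MeasurableMul G]

lemma saturation_apply_eq_zero {s : Measure G} {Γ : Subgroup G} [Countable Γ] {N : Set G}
    (hN : MeasurableSet N) :
    saturation s Γ N = 0 ↔ ∀ γ ∈ Γ, s ((γ * ·) ⁻¹' N) = 0 := by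
  rw [saturation, Measure.sum_apply _ hN, ENNReal.tsum_eq_zero]
  simp only [Subtype.forall]
  exact forall₂_congr fun γ _ => by rw [Measure.map_apply (measurable_const_mul γ) hN]

lemma quasiMeasurePreserving_saturation (s : Measure G) (Γ : Subgroup G) [Countable Γ] {γ : G}
    (hγ : γ ∈ Γ) :
    Measure.QuasiMeasurePreserving (γ * ·) (saturation s Γ) (saturation s Γ) := by
  refine ⟨measurable_const_mul γ, Measure.AbsolutelyContinuous.mk fun N hN h0 => ?_⟩
  rw [Measure.map_apply (measurable_const_mul γ) hN]
  rw [saturation_apply_eq_zero hN] at h0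
  rw [saturation_apply_eq_zero (hN.preimage (measurable_const_mul γ))]
  intro δ hδ
  simpa [Set.preimage_preimage, mul_assoc] using h0 (γ * δ) (Γ.mul_mem hγ hδ)

/-- An almost invariant set coincides s-almost everywhere with its translates, so nullity for s
alone decides nullity for every translate of s. -/
lemma saturation_eq_zero_of_invariant {s : Measure G} {Γ : Subgroup G} [Countable Γ] {B : Set G}
    (hB : B ∈ invariantSets s Γ) (h0 : s B = 0) : saturation s Γ B = 0 := by
  rw [saturation_apply_eq_zero hB.1]
  intro γ hγ
  have h1 := absolutelyContinuous_saturation s Γ |>.ae_le (hB.2 γ hγ)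
  refine le_antisymm (le_trans (measure_mono_ae ?_) h0.le) bot_le
  filter_upwards [h1] with x hx hx' using hx.1 hx'

end Saturation

/-! ### From invariance under countably many translations to almost all translations. -/

section Limit

variable {G : Type*} [CommGroup G] [TopologicalSpace G] [IsTopologicalGroup G] [PolishSpace G]
  [MeasurableSpace G] [BorelSpace G]

/-- The indicator of B is not continuous, so the limit is taken in the densities. After transporting
the integral by u, the varying translation enters only through the continuous factor φ(u⁻¹ w), while
the indicator is paired with L¹-convergent densities. -/
lemma ae_mem_iff_of_closure {s : Measure G} [IsFiniteMeasure s] {k : G → Measure G}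
    [∀ t, IsFiniteMeasure (k t)] {S C : Set G}
    (hS : ∀ t ∈ S, k t ≪ s ∧ (k t).map (t * ·) ≪ s) (hCS : C ⊆ S)
    (hd : (fun t => (t, densityL1 (k t) s, densityL1 ((k t).map (t * ·)) s)) '' S ⊆
      closure ((fun t => (t, densityL1 (k t) s, densityL1 ((k t).map (t * ·)) s)) '' C))
    {B : Set G} (hB : MeasurableSet B) (hinv : ∀ c ∈ C, ∀ᵐ x ∂s, c * x ∈ B ↔ x ∈ B)
    {t : G} (ht : t ∈ S) : ∀ᵐ x ∂k t, t * x ∈ B ↔ x ∈ B := by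
  obtain ⟨v, hv, hlim⟩ := mem_closure_iff_seq_limit.1 (hd ⟨t, ht, rfl⟩)
  choose c hc hcv using hv
  obtain rfl : (fun n => _) = v := funext hcv
  have hl1 : Tendsto c atTop (𝓝 t) := (continuous_fst.tendsto _).comp hlim
  have hl2 : Tendsto (fun n => densityL1 (k (c n)) s) atTop (𝓝 (densityL1 (k t) s)) :=
    ((continuous_fst.comp continuous_snd).tendsto _).comp hlim
  have hl3 : Tendsto (fun n => densityL1 ((k (c n)).map (c n * ·)) s) atTop
      (𝓝 (densityL1 ((k t).map (t * ·)) s)) :=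
    ((continuous_snd.comp continuous_snd).tendsto _).comp hlim
  have hpre : ∀ u : G, MeasurableSet ((u * ·) ⁻¹' B) := fun u => hB.preimage (by fun_prop)
  have key : ∀ φ : BoundedContinuousFunction G ℝ,
      ∫ x, ((t * ·) ⁻¹' B).indicator φ x ∂k t = ∫ x, B.indicator φ x ∂k t := by
    intro φ
    have hψ : ∀ u : G, Measurable (B.indicator fun w => φ (u⁻¹ * w)) := fun u =>
      (φ.continuous.comp (by fun_prop : Continuous fun w => u⁻¹ * w)).measurable.indicator hB
    have hψ1 : ∀ u w, |B.indicator (fun w => φ (u⁻¹ * w)) w| ≤ ‖φ‖ := by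
      intro u w
      by_cases hw : w ∈ B
      · simpa [hw] using φ.norm_coe_le_norm (u⁻¹ * w)
      · simp [hw]
    have hφB : Measurable (B.indicator φ) := φ.continuous.measurable.indicator hB
    have hφB1 : ∀ w, |B.indicator φ w| ≤ ‖φ‖ := by
      intro w
      by_cases hw : w ∈ B
      · simpa [hw] using φ.norm_coe_le_norm w
      · simp [hw]
    have htr : ∀ u ∈ S, ∫ x, ((u * ·) ⁻¹' B).indicator φ x ∂k u =
        ∫ w, B.indicator (fun w => φ (u⁻¹ * w)) w * densityL1 ((k u).map (u * ·)) s w ∂s := by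
      intro u hu
      rw [← integral_eq_integral_mul_densityL1 (hS u hu).2, integral_map (by fun_prop)
        (hψ u).aestronglyMeasurable]
      refine integral_congr_ae (ae_of_all _ fun x => ?_)
      by_cases h : u * x ∈ B
      · simp [Set.indicator_of_mem h, Set.indicator_of_mem (show x ∈ (u * ·) ⁻¹' B from h)]
      · simp [Set.indicator_of_notMem h, Set.indicator_of_notMem (show x ∉ (u * ·) ⁻¹' B from h)]
    rw [htr t ht, integral_eq_integral_mul_densityL1 (hS t ht).1]
    have hR : Tendsto (fun n => ∫ x, B.indicator φ x * densityL1 (k (c n)) s x ∂s) atTop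
        (𝓝 (∫ x, B.indicator φ x * densityL1 (k t) s x ∂s)) := by
      rw [tendsto_iff_norm_sub_tendsto_zero] at hl2 ⊢
      refine squeeze_zero (fun _ => norm_nonneg _)
        (fun n => abs_integral_mul_sub_le hφB hφB1 _ _) ?_
      simpa using hl2.const_mul ‖φ‖
    have hL : Tendsto (fun n => ∫ x, B.indicator φ x * densityL1 (k (c n)) s x ∂s) atTop
        (𝓝 (∫ w, B.indicator (fun w => φ (t⁻¹ * w)) w *
          densityL1 ((k t).map (t * ·)) s w ∂s)) := by
      -- First only the test function varies, against a fixed density. In `h2` the density is then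
      -- replaced, uniformly in the bounded test functions.
      have h1 : Tendsto (fun n => ∫ w, B.indicator (fun w => φ ((c n)⁻¹ * w)) w *
          densityL1 ((k t).map (t * ·)) s w ∂s) atTop
          (𝓝 (∫ w, B.indicator (fun w => φ (t⁻¹ * w)) w *
            densityL1 ((k t).map (t * ·)) s w ∂s)) := by
        refine tendsto_integral_of_dominated_convergence
          (fun w => ‖φ‖ * ‖densityL1 ((k t).map (t * ·)) s w‖)
          (fun n => (hψ _).aestronglyMeasurable.mul (Lp.aestronglyMeasurable _))
          ((L1.integrable_coeFn _).norm.const_mul _)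
          (fun n => ae_of_all _ fun w => ?_) (ae_of_all _ fun w => ?_)
        · rw [norm_mul]
          exact mul_le_mul_of_nonneg_right (hψ1 _ _) (norm_nonneg _)
        · refine Tendsto.mul_const _ ?_
          by_cases hw : w ∈ B
          · simp only [hw, Set.indicator_of_mem]
            exact (φ.continuous.tendsto _).comp (hl1.inv.mul_const w)
          · simp [hw]
      have h2 : Tendsto (fun n => ∫ w, B.indicator (fun w => φ ((c n)⁻¹ * w)) w *
            densityL1 ((k (c n)).map (c n * ·)) s w ∂s -
          ∫ w, B.indicator (fun w => φ ((c n)⁻¹ * w)) w *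
            densityL1 ((k t).map (t * ·)) s w ∂s) atTop (𝓝 0) := by
        rw [tendsto_iff_norm_sub_tendsto_zero] at hl3
        refine squeeze_zero_norm (fun n => abs_integral_mul_sub_le (hψ _) (hψ1 _) _ _) ?_
        simpa using hl3.const_mul ‖φ‖
      have h3 := h2.add h1
      simp only [sub_add_cancel, zero_add] at h3
      refine h3.congr fun n => ?_
      rw [← htr _ (hCS (hc n)), ← integral_eq_integral_mul_densityL1 (hS _ (hCS (hc n))).1]
      refine integral_congr_ae ?_
      filter_upwards [(hS _ (hCS (hc n))).1.ae_le (hinv _ (hc n))] with x hx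
      by_cases h : x ∈ B
      · rw [Set.indicator_of_mem h,
          Set.indicator_of_mem (show x ∈ (c n * ·) ⁻¹' B from hx.2 h)]
      · rw [Set.indicator_of_notMem h,
          Set.indicator_of_notMem (show x ∉ (c n * ·) ⁻¹' B from fun h' => h (hx.1 h'))]
    exact tendsto_nhds_unique hL hR
  have heq : (k t).restrict ((t * ·) ⁻¹' B) = (k t).restrict B := by
    refine ext_of_forall_integral_eq_of_IsFiniteMeasure fun φ => ?_
    rw [← integral_indicator (hpre t), ← integral_indicator hB]
    exact key φ
  have h1 : ∀ᵐ x ∂k t, t * x ∈ B → x ∈ B := by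
    have := ae_restrict_mem (μ := k t) hB
    rw [← heq, ae_restrict_iff' (hpre t)] at this
    exact this
  have h2 : ∀ᵐ x ∂k t, x ∈ B → t * x ∈ B := by
    have := ae_restrict_mem (μ := k t) (hpre t)
    rw [heq, ae_restrict_iff' hB] at this
    exact this
  filter_upwards [h1, h2] with x hx hx' using ⟨hx, hx'⟩

end Limit

/-! ### Ergodic components. -/

section Atom

variable {G : Type*} [CommGroup G] [MeasurableSpace G]

/-- κ lives on the equivalence relation defined by a countable dense family of invariant sets. The
part of this relation lying over s-null classes is null for s ⊗ s, hence for κ, so κ charges the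
square of some class of positive s-mass. Density of the family makes that class an atom. -/
lemma exists_atom [MeasurableSpace.CountablyGenerated G] {s : Measure G} [IsFiniteMeasure s]
    {Γ : Subgroup G} {κ : Measure (G × G)} (hκ0 : κ ≠ 0) (hκ : κ ≪ s.prod s)
    (hinv : ∀ B ∈ invariantSets s Γ, ∀ᵐ p ∂κ, p.1 ∈ B ↔ p.2 ∈ B) :
    ∃ A ∈ invariantSets s Γ, κ (A ×ˢ A) ≠ 0 ∧
      ∀ B ∈ invariantSets s Γ, s (A ∩ B) = 0 ∨ s (A \ B) = 0 := by
  obtain ⟨C, hCS, hC, hd⟩ := exists_countable_dense_image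
    (fun B : Set G => densityL1 (s.restrict B) s) (invariantSets s Γ)
  have hCne : C.Nonempty := by
    have h1 : (Set.univ : Set G) ∈ invariantSets s Γ := ⟨MeasurableSet.univ, by simp⟩
    have h2 := hd ⟨_, h1, rfl⟩
    exact Set.image_nonempty.1 (closure_nonempty_iff.1 ⟨_, h2⟩)
  obtain ⟨B, rfl⟩ := hC.exists_eq_range hCne
  have hB : ∀ i, B i ∈ invariantSets s Γ := fun i => hCS ⟨i, rfl⟩
  set cls : (ℕ → Prop) → Set G := fun ω => {x | ∀ i, x ∈ B i ↔ ω i} with hcls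
  have hclsinv : ∀ ω, cls ω ∈ invariantSets s Γ := by
    intro ω
    classical
    have : cls ω = ⋂ i, if ω i then B i else (B i)ᶜ := by
      ext x
      simp only [hcls, Set.mem_ofPred_eq, Set.mem_iInter]
      refine forall_congr' fun i => ?_
      by_cases h : ω i <;> simp [h]
    rw [this]
    refine iInter_mem_invariantSets fun i => ?_
    split_ifs
    · exact hB i
    · exact compl_mem_invariantSets (hB i)
  have hE : MeasurableSet {p : G × G | ∀ i, p.1 ∈ B i ↔ p.2 ∈ B i} := by
    simp only [Set.ofPred_forall]
    refine MeasurableSet.iInter fun i => ?_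
    exact (measurable_fst (hB i).1).iff (measurable_snd (hB i).1)
  set E := {p : G × G | ∀ i, p.1 ∈ B i ↔ p.2 ∈ B i} with hEdef
  have hsec : ∀ x, Prod.mk x ⁻¹' E = cls fun i => x ∈ B i := by
    intro x
    ext y
    simp only [hEdef, hcls, Set.mem_preimage, Set.mem_ofPred_eq]
    exact forall_congr' fun i => Iff.comm
  obtain ⟨ω, hω, hκω⟩ : ∃ ω, 0 < s (cls ω) ∧ κ (cls ω ×ˢ cls ω) ≠ 0 := by
    by_contra! hcon
    have hcount : {ω | 0 < s (cls ω)}.Countable :=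
      Measure.countable_meas_pos_of_disjoint_iUnion (fun ω => (hclsinv ω).1) fun ω ω' hne =>
        Set.disjoint_left.2 fun x hx hx' => hne (funext fun i =>
          propext ((hx i).symm.trans (hx' i)))
    have h1 : ∀ᵐ p ∂κ, ∀ ω ∈ {ω | 0 < s (cls ω)}, p ∉ cls ω ×ˢ cls ω :=
      (ae_ball_iff hcount).2 fun ω hω => measure_eq_zero_iff_ae_notMem.1 (hcon ω hω)
    have h2 : ∀ᵐ p ∂κ, p ∈ E := ae_all_iff.2 fun i => hinv _ (hB i)
    have hm : MeasurableSet (E ∩ {p | s (Prod.mk p.1 ⁻¹' E) = 0}) :=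
      hE.inter (((measurable_measure_prodMk_left hE).comp measurable_fst)
        (measurableSet_singleton 0))
    have h3 : ∀ᵐ p ∂κ, p ∉ E ∩ {p | s (Prod.mk p.1 ⁻¹' E) = 0} := by
      refine measure_eq_zero_iff_ae_notMem.1 (hκ ((Measure.measure_prod_null hm).2
        (ae_of_all _ fun x => ?_)))
      by_cases hx : s (Prod.mk x ⁻¹' E) = 0
      · exact measure_mono_null (fun y hy => hy.1) hx
      · exact (congrArg s (Set.eq_empty_of_forall_notMem fun y hy => hx hy.2)).trans measure_empty
    have h4 : ∀ᵐ p ∂κ, False := by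
      filter_upwards [h1, h2, h3] with p hp1 hp2 hp3
      have hp4 : s (cls fun i => p.1 ∈ B i) ≠ 0 := fun h0 =>
        hp3 ⟨hp2, by rw [Set.mem_ofPred_eq, hsec]; exact h0⟩
      exact hp1 _ (pos_iff_ne_zero.2 hp4) ⟨fun i => Iff.rfl, fun i => (hp2 i).symm⟩
    exact hκ0 (by simpa using h4)
  refine ⟨cls ω, hclsinv ω, hκω, fun D hD => ?_⟩
  by_contra! hcon
  obtain ⟨hD1, hD2⟩ := hcon
  have hA := (hclsinv ω).1
  have hr1 : 0 < s.real (cls ω ∩ D) := ENNReal.toReal_pos hD1 (measure_ne_top _ _)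
  have hr2 : 0 < s.real (cls ω \ D) := ENNReal.toReal_pos hD2 (measure_ne_top _ _)
  -- `B i` is closer to `D` than the mass of either piece into which `D` would cut the class, but `B
  -- i` contains or misses the class entirely.
  obtain ⟨_, ⟨_, ⟨i, rfl⟩, rfl⟩, hi⟩ := Metric.mem_closure_iff.1 (hd ⟨D, hD, rfl⟩) _
    (lt_min hr1 hr2)
  rw [dist_eq_norm] at hi
  have hac : ∀ F : Set G, s.restrict F ≪ s := fun F => Measure.absolutelyContinuous_of_le
    Measure.restrict_le_self
  have key : ∀ F, MeasurableSet F → |s.real (F ∩ D) - s.real (F ∩ B i)| ≤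
      ‖densityL1 (s.restrict D) s - densityL1 (s.restrict (B i)) s‖ := by
    intro F hF
    have := abs_integral_sub_le_norm_densityL1 (hac D) (hac (B i))
      (ψ := F.indicator 1) (measurable_one.indicator hF) (C := 1) (fun x => by
        by_cases hx : x ∈ F <;> simp [hx])
    rw [integral_indicator_one hF, integral_indicator_one hF, measureReal_restrict_apply hF,
      measureReal_restrict_apply hF, one_mul] at this
    exact this
  by_cases hωi : ω i
  · have h1 := key _ (hA.diff hD.1)
    have h2 : (cls ω \ D) ∩ D = ∅ := Set.sdiff_inter_self
    have h3 : (cls ω \ D) ∩ B i = cls ω \ D :=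
      Set.inter_eq_left.2 fun x hx => (hx.1 i).2 hωi
    rw [h2, h3, measureReal_empty, zero_sub, abs_neg, abs_of_pos hr2] at h1
    exact absurd (hi.trans_le (min_le_right _ _)) (not_lt.2 h1)
  · have h1 := key _ (hA.inter hD.1)
    have h2 : (cls ω ∩ D) ∩ D = cls ω ∩ D := by rw [Set.inter_assoc, Set.inter_self]
    have h3 : (cls ω ∩ D) ∩ B i = ∅ :=
      Set.eq_empty_of_forall_notMem fun x hx => hωi ((hx.1.1 i).1 hx.2)
    rw [h2, h3, measureReal_empty, sub_zero, abs_of_pos hr1] at h1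
    exact absurd (hi.trans_le (min_le_left _ _)) (not_lt.2 h1)

variable [MeasurableMul G]

/-- By commutativity, preimages under t of Γ-invariant sets are Γ-invariant, hence e-null or
e-conull. Apply this to the saturation of an e-null set carrying the singular part of te. Conullity
is impossible because t sends the nonzero m ≪ e to a measure ≪ e; nullity says that te has no
singular part. -/
lemma map_mul_absolutelyContinuous_of_ergodic {Γ : Subgroup G} [Countable Γ] {e : Measure G}
    [IsFiniteMeasure e] (hq : ∀ γ ∈ Γ, Measure.QuasiMeasurePreserving (γ * ·) e e)
    (herg : ∀ B, MeasurableSet B → (∀ γ ∈ Γ, (γ * ·) ⁻¹' B = B) → e B = 0 ∨ e Bᶜ = 0) {t : G}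
    {m : Measure G} (hm0 : m ≠ 0) (hm : m ≪ e) (hmt : m.map (t * ·) ≪ e) :
    e.map (t * ·) ≪ e := by
  have hmeas : ∀ u : G, Measurable (u * ·) := fun u => measurable_const_mul u
  obtain ⟨Z, hZ, hsZ, heZ⟩ := Measure.mutuallySingular_singularPart (e.map (t * ·)) e
  set Z' : Set G := ⋃ γ : Γ, ((γ : G) * ·) ⁻¹' Zᶜ with hZ'
  have hZ'm : MeasurableSet Z' := MeasurableSet.iUnion fun γ => hmeas _ hZ.compl
  have heZ' : e Z' = 0 := measure_iUnion_null fun γ => (hq γ γ.2).preimage_null heZ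
  have hsub : Zᶜ ⊆ Z' := fun x hx => Set.mem_iUnion.2 ⟨1, by simpa using hx⟩
  have hZ'inv : ∀ γ ∈ Γ, ∀ x, γ * x ∈ Z' ↔ x ∈ Z' := by
    have h1 : ∀ γ ∈ Γ, ∀ x, γ * x ∈ Z' → x ∈ Z' := by
      intro γ hγ x hx
      obtain ⟨δ, hδ⟩ := Set.mem_iUnion.1 hx
      refine Set.mem_iUnion.2 ⟨δ * ⟨γ, hγ⟩, ?_⟩
      simpa [mul_assoc] using hδ
    refine fun γ hγ x => ⟨h1 γ hγ x, fun hx => h1 γ⁻¹ (Γ.inv_mem hγ) _ ?_⟩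
    simpa using hx
  rcases herg ((t * ·) ⁻¹' Z') (hmeas t hZ'm) (fun γ hγ => by
    ext x
    simp only [Set.mem_preimage]
    rw [mul_left_comm]
    exact hZ'inv γ hγ _) with h0 | h0
  · refine Measure.AbsolutelyContinuous.mk fun N hN hN0 => ?_
    have h1 : e.map (t * ·) Zᶜ = 0 := by
      rw [Measure.map_apply (hmeas t) hZ.compl]
      exact measure_mono_null (Set.preimage_mono hsub) h0
    have h2 : e.map (t * ·) (N ∩ Z) = 0 := by
      rw [← Measure.singularPart_add_rnDeriv (e.map (t * ·)) e]
      rw [Measure.add_apply, measure_mono_null Set.inter_subset_right hsZ,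
        measure_mono_null Set.inter_subset_left (withDensity_absolutelyContinuous _ _ hN0),
        add_zero]
    refine measure_mono_null (fun x hx => ?_) (measure_union_null h2 h1)
    by_cases hxZ : x ∈ Z
    · exact Or.inl ⟨hx, hxZ⟩
    · exact Or.inr hxZ
  · exfalso
    have h1 : m ((t * ·) ⁻¹' Z')ᶜ = 0 := hm h0
    have h2 : m ((t * ·) ⁻¹' Z') = 0 := by
      have := hmt heZ'
      rwa [Measure.map_apply (hmeas t) hZ'm] at this
    refine hm0 (Measure.measure_univ_eq_zero.1 ?_)
    rw [← Set.union_compl_self ((t * ·) ⁻¹' Z')]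
    exact measure_union_null h2 h1

end Atom

/-! ### Construction of a self-translating measure. -/

section Reduction

lemma countable_closure {G : Type*} [Group G] {C : Set G} (hC : C.Countable) : Countable (Subgroup.closure C) := by
  have := hC.to_subtype
  have h1 : Countable (FreeGroup C) := Quot.mk_surjective.countable
  have h2 := FreeGroup.range_lift_eq_closure (f := ((↑) : C → G))
  rw [Subtype.range_coe] at h2
  rw [← h2]
  exact (MonoidHom.rangeRestrict_surjective _).countable

variable {G : Type*} [CommGroup G] [TopologicalSpace G] [IsTopologicalGroup G] [PolishSpace G]
  [MeasurableSpace G] [BorelSpace G]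

/-- Triples made of t, the density of k t and the density of its translate lie in a separable space.
The group generated by a countable dense set of parameters therefore detects invariance for almost
all t. -/
lemma exists_countable_subgroup {s θ : Measure G} [IsFiniteMeasure s]
    {k : G → Measure G} [∀ t, IsFiniteMeasure (k t)]
    (h1 : ∀ᵐ t ∂θ, k t ≪ s) (h2 : ∀ᵐ t ∂θ, (k t).map (t * ·) ≪ s) :
    ∃ Γ : Subgroup G, Countable Γ ∧ ∀ B ∈ invariantSets s Γ, ∀ᵐ t ∂θ, ∀ᵐ x ∂k t,
      t * x ∈ B ↔ x ∈ B := by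
  obtain ⟨C, hCS, hC, hd⟩ := exists_countable_dense_image
    (fun t => (t, densityL1 (k t) s, densityL1 ((k t).map (t * ·)) s))
    {t | k t ≪ s ∧ (k t).map (t * ·) ≪ s}
  refine ⟨Subgroup.closure C, countable_closure hC, fun B hB => ?_⟩
  filter_upwards [h1, h2] with t ht1 ht2
  refine ae_mem_iff_of_closure (fun t ht => ht) hCS hd hB.1 (fun c hc => ?_) ⟨ht1, ht2⟩
  exact (absolutelyContinuous_saturation s _).ae_le (hB.2 c (Subgroup.subset_closure hc))

end Reduction

section Reduction

variable {G : Type*} [CommGroup G] [TopologicalSpace G] [IsTopologicalGroup G] [PolishSpace G]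
  [MeasurableSpace G] [BorelSpace G]

/-- If the joint law of `x'/x` with `x`, and with `x'`, is absolutely continuous with respect to
products, for `(x, x')` distributed according to some `κ ≪ s ⊗ s`, then there is a probability
measure almost all of whose own translations preserve its null sets, and which is absolutely
continuous with respect to a sum of translates of `s`. -/
theorem exists_selfTranslating {s θ₁ θ₂ : Measure G} [IsFiniteMeasure s] [IsFiniteMeasure θ₁]
    [IsFiniteMeasure θ₂] {κ : Measure (G × G)} [IsFiniteMeasure κ] (hκ0 : κ ≠ 0)
    (hκ : κ ≪ s.prod s) (h₁ : κ.map (fun p => (p.2 / p.1, p.1)) ≪ θ₁.prod s)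
    (h₂ : κ.map (fun p => (p.2 / p.1, p.2)) ≪ θ₂.prod s) :
    ∃ η : Measure G, IsProbabilityMeasure η ∧ (∀ᵐ t ∂η, η.map (t * ·) ≪ η) ∧
      ∃ C : Set G, C.Countable ∧
        ∀ N, MeasurableSet N → (∀ g ∈ C, s ((g * ·) ⁻¹' N) = 0) → η N = 0 := by
  have : Nonempty G := ⟨1⟩
  have hmeas : ∀ u : G, Measurable (u * ·) := fun u => measurable_const_mul u
  set K := κ.map (fun p => (p.2 / p.1, p.1)) with hK
  have hKm : Measurable fun p : G × G => (p.2 / p.1, p.1) := by fun_prop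
  -- `k t` is the law of x given that x'/x = t, so its translate by t is the corresponding law of
  -- x'. The two hypotheses on κ make both absolutely continuous with respect to s for almost every
  -- t.
  set k := K.condKernel with hk
  have hdis : K.fst ⊗ₘ k = K := K.disintegrate K.condKernel
  have hk1 : ∀ᵐ t ∂K.fst, k t ≪ s := by
    rw [← Measure.compProd_const, ← hdis] at h₁
    exact h₁.kernel_of_compProd
  set k' : Kernel G G := (Kernel.id ×ₖ k).map (fun p => p.1 * p.2) with hk'
  have hk'app : ∀ t, k' t = (k t).map (t * ·) := by
    intro t
    rw [hk', Kernel.map_apply _ (by fun_prop), Kernel.prod_apply, Kernel.id_apply,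
      Measure.dirac_prod, Measure.map_map (by fun_prop) (by fun_prop)]
    rfl
  have hk'M : IsMarkovKernel k' := Kernel.IsMarkovKernel.map _ (by fun_prop)
  have hk2 : ∀ᵐ t ∂K.fst, (k t).map (t * ·) ≪ s := by
    have e : K.fst ⊗ₘ k' = κ.map (fun p => (p.2 / p.1, p.2)) := by
      have e1 : K.fst ⊗ₘ k' = K.map (fun p => (p.1, p.1 * p.2)) := by
        ext N hN
        have e2 : K.map (fun p => (p.1, p.1 * p.2)) =
          (K.fst ⊗ₘ k).map (fun p => (p.1, p.1 * p.2)) := by rw [hdis]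
        rw [e2, Measure.compProd_apply hN, Measure.map_apply (by fun_prop) hN,
          Measure.compProd_apply (hN.preimage (by fun_prop))]
        refine lintegral_congr fun t => ?_
        rw [hk'app, Measure.map_apply (hmeas t) (measurable_prodMk_left hN)]
        rfl
      rw [e1, hK, Measure.map_map (by fun_prop) hKm]
      congr 1
      ext p <;> simp
    rw [← e, ← Measure.compProd_const] at h₂
    exact h₂.kernel_of_compProd.mono fun t ht => by rwa [hk'app, Kernel.const_apply] at ht
  obtain ⟨Γ, hΓ, hΓinv⟩ := exists_countable_subgroup hk1 hk2
  -- transfer of almost sure statements from `K.fst ⊗ₘ k` to `κ`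
  have htrans : ∀ {p : G → G → Prop}, (∀ᵐ t ∂K.fst, ∀ᵐ x ∂k t, p x (t * x)) →
      MeasurableSet {q : G × G | p q.1 q.2} → ∀ᵐ q ∂κ, p q.1 q.2 := by
    intro p hp hpm
    have hm : MeasurableSet {q : G × G | p q.2 (q.1 * q.2)} :=
      hpm.preimage (f := fun q : G × G => (q.2, q.1 * q.2)) (by fun_prop)
    have h1 : ∀ᵐ q ∂K, p q.2 (q.1 * q.2) := by
      rw [← hdis]
      exact Measure.ae_compProd_of_ae_ae hm hp
    rw [hK, ae_map_iff hKm.aemeasurable hm] at h1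
    simpa using h1
  obtain ⟨A, hA, hκA, hatom⟩ := exists_atom hκ0 hκ fun B hB =>
    htrans (p := fun x y => x ∈ B ↔ y ∈ B) ((hΓinv B hB).mono fun t ht => ht.mono fun x hx => hx.symm)
      ((measurable_fst hB.1).iff (measurable_snd hB.1))
  -- The saturation need not be finite; only its null sets matter, so it is replaced by an
  -- equivalent finite measure.
  set e := ((saturation s Γ).restrict A).toFinite with he
  have he0 : ∀ N, e N = 0 ↔ (saturation s Γ).restrict A N = 0 := fun N =>
    ⟨fun h => absolutelyContinuous_toFinite _ h, fun h => toFinite_absolutelyContinuous _ h⟩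
  have he1 : ∀ {N}, MeasurableSet N → (e N = 0 ↔ saturation s Γ (N ∩ A) = 0) := fun hN => by
    rw [he0, Measure.restrict_apply hN]
  have hq : ∀ γ ∈ Γ, Measure.QuasiMeasurePreserving (γ * ·) e e := by
    refine fun γ hγ => ⟨hmeas γ, Measure.AbsolutelyContinuous.mk fun N hN hN0 => ?_⟩
    rw [he1 hN] at hN0
    rw [Measure.map_apply (hmeas γ) hN, he1 (hmeas γ hN)]
    refine le_antisymm (le_trans (measure_mono_ae ?_)
      ((quasiMeasurePreserving_saturation s Γ hγ).preimage_null hN0).le) bot_le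
    filter_upwards [hA.2 γ hγ] with x hx hx'
    exact ⟨hx'.1, hx.2 hx'.2⟩
  have herg : ∀ B, MeasurableSet B → (∀ γ ∈ Γ, (γ * ·) ⁻¹' B = B) → e B = 0 ∨ e Bᶜ = 0 := by
    intro B hB hBinv
    have hBi : B ∈ invariantSets s Γ := ⟨hB, fun γ hγ => ae_of_all _ fun x => by
      conv_rhs => rw [← hBinv γ hγ]
      rfl⟩
    rw [he1 hB, he1 hB.compl]
    refine (hatom B hBi).imp (fun h => ?_) (fun h => ?_)
    · rw [Set.inter_comm]
      exact saturation_eq_zero_of_invariant (inter_mem_invariantSets hA hBi) h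
    · rw [Set.inter_comm, ← Set.sdiff_eq]
      exact saturation_eq_zero_of_invariant (by
        rw [Set.sdiff_eq]
        exact inter_mem_invariantSets hA (compl_mem_invariantSets hBi)) h
  have hsA : s.restrict A ≪ e := by
    intro N hN
    rw [he0] at hN
    exact (absolutelyContinuous_saturation s Γ).restrict A hN
  -- the translations of `A` into itself preserve the null sets of `e`
  have hDm : MeasurableSet {t | k t (A ∩ (t * ·) ⁻¹' A) ≠ 0} := by
    have h1 : MeasurableSet {q : G × G | q.2 ∈ A ∧ q.1 * q.2 ∈ A} :=
      (measurable_snd hA.1).inter (measurable_mul hA.1)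
    exact (Kernel.measurable_kernel_prodMk_left (κ := k) h1)
      (measurableSet_singleton (0 : ENNReal)).compl
  -- The part of `k t` lying in `A` and moved into `A` by t is the nonzero m required by the
  -- ergodicity lemma.
  have hH : ∀ᵐ t ∂K.fst, k t (A ∩ (t * ·) ⁻¹' A) ≠ 0 → e.map (t * ·) ≪ e := by
    filter_upwards [hk1, hk2] with t ht1 ht2 hm0
    refine map_mul_absolutelyContinuous_of_ergodic hq herg
      (m := (k t).restrict (A ∩ (t * ·) ⁻¹' A)) (by rwa [Ne, Measure.restrict_eq_zero]) ?_ ?_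
    · exact (Measure.absolutelyContinuous_of_le
        (Measure.restrict_mono Set.inter_subset_left le_rfl)).trans ((ht1.restrict A).trans hsA)
    · refine Measure.AbsolutelyContinuous.trans ?_ ((ht2.restrict A).trans hsA)
      rw [Measure.restrict_map (hmeas t) hA.1]
      exact (Measure.absolutelyContinuous_of_le
        (Measure.restrict_mono Set.inter_subset_right le_rfl)).map (hmeas t)
  obtain ⟨V, hVm, hVH, hV⟩ : ∃ V, MeasurableSet V ∧ (∀ t ∈ V, e.map (t * ·) ≪ e) ∧
      ∀ᵐ q ∂κ, q.1 ∈ A → q.2 ∈ A → q.2 / q.1 ∈ V := by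
    obtain ⟨N, hN, hNm, hN0⟩ := exists_measurable_superset_of_null (ae_iff.1 hH)
    refine ⟨{t | k t (A ∩ (t * ·) ⁻¹' A) ≠ 0} \ N, hDm.diff hNm, fun t ht => ?_, ?_⟩
    · by_contra h
      exact ht.2 (hN fun h' => h (h' ht.1))
    · refine htrans (p := fun x y => x ∈ A → y ∈ A →
        y / x ∈ {t | k t (A ∩ (t * ·) ⁻¹' A) ≠ 0} \ N) ?_ ?_
      · filter_upwards [measure_eq_zero_iff_ae_notMem.1 hN0] with t ht
        by_cases hm0 : k t (A ∩ (t * ·) ⁻¹' A) = 0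
        · filter_upwards [measure_eq_zero_iff_ae_notMem.1 hm0] with x hx h1 h2
          exact absurd ⟨h1, h2⟩ hx
        · refine ae_of_all _ fun x _ _ => ?_
          rw [mul_div_cancel_right]
          exact ⟨hm0, ht⟩
      · exact (measurable_fst hA.1).imp ((measurable_snd hA.1).imp
          ((hDm.diff hNm).preimage (by fun_prop : Measurable fun q : G × G => q.2 / q.1)))
  -- a base point
  set c := κ.condKernel with hc
  have hcdis : κ.fst ⊗ₘ c = κ := κ.disintegrate κ.condKernel
  obtain ⟨x₀, hx₀s, hx₀V, hx₀A, hcA⟩ : ∃ x₀, c x₀ ≪ s ∧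
      (∀ᵐ y ∂c x₀, x₀ ∈ A → y ∈ A → y / x₀ ∈ V) ∧ x₀ ∈ A ∧ c x₀ A ≠ 0 := by
    by_contra! hcon
    have h1 : ∀ᵐ x ∂κ.fst, c x ≪ s := by
      rw [← Measure.compProd_const, ← hcdis] at hκ
      exact hκ.kernel_of_compProd
    rw [← hcdis] at hV
    refine hκA ?_
    rw [← hcdis, Measure.compProd_apply_prod hA.1 hA.1, lintegral_eq_zero_iff
      (c.measurable_coe hA.1)]
    refine (ae_restrict_iff' hA.1).2 ?_
    filter_upwards [h1, Measure.ae_ae_of_ae_compProd hV] with x hx1 hx2 hxA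
    exact hcon x hx1 hx2 hxA
  -- Disintegrating κ over its first coordinate fixes x₀ so that y / x₀ preserves the null sets of e
  -- for a set `A₂` of y of positive mass. As Γ also preserves these null sets and acts ergodically,
  -- the property extends to the conull saturation `W`.
  set A₂ := A ∩ {y | y / x₀ ∈ V} with hA₂
  have hA₂m : MeasurableSet A₂ :=
    hA.1.inter (hVm.preimage (by fun_prop : Measurable fun y : G => y / x₀))
  have heA₂ : e A₂ ≠ 0 := by
    intro h0
    have h1 : s A₂ = 0 := by
      have := hsA h0
      rwa [Measure.restrict_apply hA₂m, Set.inter_eq_left.2 Set.inter_subset_left] at this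
    refine hcA (le_antisymm (le_trans (measure_mono_ae ?_) (hx₀s h1).le) bot_le)
    filter_upwards [hx₀V] with y hy hyA using ⟨hyA, hy hx₀A hyA⟩
  set W : Set G := ⋃ γ : Γ, ((γ : G) * ·) ⁻¹' A₂ with hW
  have hWm : MeasurableSet W := MeasurableSet.iUnion fun γ => hmeas _ hA₂m
  have hWinv : ∀ γ ∈ Γ, ∀ x, γ * x ∈ W → x ∈ W := by
    intro γ hγ x hx
    obtain ⟨δ, hδ⟩ := Set.mem_iUnion.1 hx
    refine Set.mem_iUnion.2 ⟨δ * ⟨γ, hγ⟩, ?_⟩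
    simpa [mul_assoc] using hδ
  have hWc : e Wᶜ = 0 := by
    refine (herg W hWm fun γ hγ => Set.ext fun x => ⟨hWinv γ hγ x, fun hx =>
      hWinv γ⁻¹ (Γ.inv_mem hγ) _ (by simpa using hx)⟩).resolve_left fun h0 => heA₂ ?_
    exact measure_mono_null (fun x hx => Set.mem_iUnion.2 ⟨1, by simpa using hx⟩) h0
  have hWH : ∀ x ∈ W, e.map ((x₀⁻¹ * x) * ·) ≪ e := by
    intro x hx
    obtain ⟨γ, hγ⟩ := Set.mem_iUnion.1 hx
    have h1 := ((hVH _ hγ.2).map (hmeas (γ : G)⁻¹)).trans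
      (hq _ (Γ.inv_mem γ.2)).absolutelyContinuous
    rw [Measure.map_map (hmeas _) (hmeas _)] at h1
    convert h1 using 2
    ext y
    simp [div_eq_mul_inv, mul_assoc, mul_comm, mul_left_comm]
  have hprob : IsProbabilityMeasure e := by
    have : NeZero ((saturation s Γ).restrict A) := ⟨fun h => heA₂ ((he0 _).2 (by rw [h]; rfl))⟩
    infer_instance
  -- Moving the base point to 1 turns the quotients x₀⁻¹ x into points of the support of the new
  -- measure.
  refine ⟨e.map (x₀⁻¹ * ·), Measure.isProbabilityMeasure_map (hmeas _).aemeasurable, ?_,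
    (x₀⁻¹ * ·) '' Γ, (Set.to_countable (Γ : Set G)).image _, ?_⟩
  · have h1 : ∀ᵐ t ∂e.map (x₀⁻¹ * ·), x₀ * t ∈ W := by
      rw [ae_map_iff (hmeas _).aemeasurable (hmeas _ hWm)]
      simpa using measure_eq_zero_iff_ae_notMem.1 hWc
    filter_upwards [h1] with t ht
    have h2 := (hWH _ ht).map (hmeas x₀⁻¹)
    rw [inv_mul_cancel_left, Measure.map_map (hmeas _) (hmeas _)] at h2
    rw [Measure.map_map (hmeas _) (hmeas _)]
    convert h2 using 2
    ext y
    simp [mul_left_comm]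
  · intro N hN hN0
    rw [Measure.map_apply (hmeas _) hN, he1 (hmeas _ hN)]
    refine measure_mono_null Set.inter_subset_left ?_
    rw [saturation_apply_eq_zero (hmeas _ hN)]
    intro γ hγ
    simpa [Set.preimage_preimage, mul_assoc] using hN0 (x₀⁻¹ * γ) ⟨γ, hγ, rfl⟩

end Reduction

/-! ### Relative product of two copies of a tie. -/

section Gluing

variable {G : Type*} [CommGroup G] [TopologicalSpace G] [IsTopologicalGroup G] [PolishSpace G]
  [MeasurableSpace G] [BorelSpace G]

/-- Gluing two copies of `ρ` over its second coordinate. -/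
theorem exists_gluing {σ₁ σ₂ σ₃ : Measure G} [IsFiniteMeasure σ₁] [IsFiniteMeasure σ₂]
    [IsFiniteMeasure σ₃] {ρ : Measure (G × G)} [IsFiniteMeasure ρ] (hρ0 : ρ ≠ 0)
    (h₁₂ : ρ ≪ σ₁.prod σ₂) (h₁₃ : ρ.map (fun p => (p.1, (p.1 * p.2)⁻¹)) ≪ σ₁.prod σ₃)
    (h₂₃ : ρ.map (fun p => (p.2, (p.1 * p.2)⁻¹)) ≪ σ₂.prod σ₃) :
    ∃ (κ : Measure (G × G)) (θ₁ θ₂ : Measure G), IsFiniteMeasure κ ∧ IsFiniteMeasure θ₁ ∧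
      IsFiniteMeasure θ₂ ∧ κ ≠ 0 ∧ κ ≪ σ₁.prod σ₁ ∧
      κ.map (fun p => (p.2 / p.1, p.1)) ≪ θ₁.prod σ₁ ∧
      κ.map (fun p => (p.2 / p.1, p.2)) ≪ θ₂.prod σ₁ := by
  have : Nonempty G := ⟨1⟩
  set r := ρ.map Prod.swap with hr
  set k := r.condKernel with hk
  have hdis : r.fst ⊗ₘ k = r := r.disintegrate r.condKernel
  have hk1 : ∀ᵐ y ∂r.fst, k y ≪ σ₁ := by
    have h1 : r ≪ σ₂.prod σ₁ := by
      rw [← Measure.prod_swap]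
      exact h₁₂.map measurable_swap
    rw [← Measure.compProd_const, ← hdis] at h1
    exact h1.kernel_of_compProd
  have hfm : Measurable fun p : G × G => (p.1 * p.2)⁻¹ := by fun_prop
  set l : Kernel G G := (Kernel.id ×ₖ k).map (fun p => (p.1 * p.2)⁻¹) with hl
  have hlapp : ∀ y, l y = (k y).map fun x => (y * x)⁻¹ := by
    intro y
    rw [hl, Kernel.map_apply _ hfm, Kernel.prod_apply, Kernel.id_apply,
      Measure.dirac_prod, Measure.map_map hfm (by fun_prop)]
    rfl
  have hlM : IsMarkovKernel l := Kernel.IsMarkovKernel.map _ hfm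
  have hl3 : ∀ᵐ y ∂r.fst, l y ≪ σ₃ := by
    have e1 : r.fst ⊗ₘ l = r.map (fun p => (p.1, (p.1 * p.2)⁻¹)) := by
      ext N hN
      have e2 : r.map (fun p => (p.1, (p.1 * p.2)⁻¹)) =
        (r.fst ⊗ₘ k).map (fun p => (p.1, (p.1 * p.2)⁻¹)) := by rw [hdis]
      rw [e2, Measure.compProd_apply hN, Measure.map_apply (by fun_prop) hN,
        Measure.compProd_apply (hN.preimage (by fun_prop))]
      refine lintegral_congr fun t => ?_
      rw [hlapp, Measure.map_apply (by fun_prop) (measurable_prodMk_left hN)]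
      rfl
    have e3 : r.fst ⊗ₘ l = ρ.map (fun p => (p.2, (p.1 * p.2)⁻¹)) := by
      rw [e1, hr, Measure.map_map (by fun_prop) measurable_swap]
      congr 1
      ext p <;> simp [mul_comm]
    rw [← e3, ← Measure.compProd_const] at h₂₃
    exact h₂₃.kernel_of_compProd
  -- Put z = (yx)⁻¹ and z' = (yx')⁻¹. The law of (x, z) is ≪ σ₁ ⊗ σ₃, and z' given (x, z) follows `l
  -- y` ≪ σ₃. So a function of (z, z') is, jointly with x, dominated by a product; it is used for
  -- the quotient x'/x = z/z'.
  have key : ∀ (h : G → G → G), Measurable (fun q : G × G => h q.1 q.2) → ∀ N : Set (G × G),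
      MeasurableSet N → (((σ₃.prod σ₃).map fun q => h q.1 q.2).prod σ₁) N = 0 →
      ∀ᵐ y ∂r.fst, ∀ᵐ x ∂k y, ∀ᵐ x' ∂k y, (h (y * x)⁻¹ (y * x')⁻¹, x) ∉ N := by
    intro h hh N hN hN0
    have hm : MeasurableSet {p : (G × G) × G | (h p.1.2 p.2, p.1.1) ∉ N} := by
      refine (hN.preimage (f := fun p : (G × G) × G => (h p.1.2 p.2, p.1.1)) ?_).compl
      exact (hh.comp (by fun_prop : Measurable fun p : (G × G) × G => (p.1.2, p.2))).prodMk
        (by fun_prop)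
    have h1 : ∀ᵐ p ∂σ₁.prod σ₃, ∀ᵐ z' ∂σ₃, (h p.2 z', p.1) ∉ N := by
      refine Measure.ae_ae_of_ae_prod (p := fun p : (G × G) × G => (h p.1.2 p.2, p.1.1) ∉ N) ?_
      have h2 : ∀ᵐ x ∂σ₁, ∀ᵐ w ∂(σ₃.prod σ₃).map (fun q => h q.1 q.2), (w, x) ∉ N := by
        have h3 : ((σ₁.prod ((σ₃.prod σ₃).map fun q => h q.1 q.2))) (Prod.swap ⁻¹' N) = 0 := by
          rw [← Measure.map_apply measurable_swap hN, Measure.prod_swap, hN0]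
        exact Measure.ae_ae_of_ae_prod (measure_eq_zero_iff_ae_notMem.1 h3)
      have h4 : ∀ᵐ p ∂σ₁.prod (σ₃.prod σ₃), (h p.2.1 p.2.2, p.1) ∉ N := by
        have hm' : MeasurableSet {p : G × (G × G) | (h p.2.1 p.2.2, p.1) ∉ N} :=
          (hN.preimage (f := fun p : G × (G × G) => (h p.2.1 p.2.2, p.1))
            ((hh.comp measurable_snd).prodMk measurable_fst)).compl
        refine (Measure.ae_prod_iff_ae_ae hm').2 (h2.mono fun x hx => ?_)
        exact ae_of_ae_map hh.aemeasurable hx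
      rw [← Measure.prodAssoc_prod, ae_map_iff (by fun_prop) ?_] at h4
      · exact h4
      · exact (hN.preimage (f := fun p : G × (G × G) => (h p.2.1 p.2.2, p.1))
            ((hh.comp measurable_snd).prodMk measurable_fst)).compl
    have h2 : ∀ᵐ p ∂r, ∀ᵐ z' ∂σ₃, (h (p.1 * p.2)⁻¹ z', p.2) ∉ N := by
      have h3 := h₁₃.ae_le h1
      have h4 := ae_of_ae_map (by fun_prop) h3
      have h5 : r.map Prod.swap = ρ := by
        rw [hr, Measure.map_map measurable_swap measurable_swap]
        simp
      rw [← h5] at h4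
      refine (ae_of_ae_map measurable_swap.aemeasurable h4).mono fun p hp => ?_
      simpa [mul_comm] using hp
    rw [← hdis] at h2
    filter_upwards [Measure.ae_ae_of_ae_compProd h2, hl3] with y hy hly
    refine hy.mono fun x hx => ?_
    have h3 := hly.ae_le hx
    rw [hlapp] at h3
    exact ae_of_ae_map (p := fun z' => (h (y * x)⁻¹ z', x) ∉ N) (by fun_prop) h3
  -- x and x' are chosen conditionally independently given y.
  set τ := r.fst ⊗ₘ (k ×ₖ k) with hτ
  have hτsnd : ∀ {p : G × G → Prop}, MeasurableSet {q | p q} →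
      (∀ᵐ y ∂r.fst, ∀ᵐ q ∂(k y).prod (k y), p q) → ∀ᵐ q ∂τ.snd, p q := by
    intro p hp h
    rw [Measure.snd, ae_map_iff measurable_snd.aemeasurable hp, hτ]
    refine Measure.ae_compProd_of_ae_ae (measurable_snd hp) (h.mono fun y hy => ?_)
    rwa [Kernel.prod_apply]
  have hsub : Measurable fun q : G × G => q.1 / q.2 := by fun_prop
  refine ⟨τ.snd, (σ₃.prod σ₃).map (fun q => q.1 / q.2), (σ₃.prod σ₃).map (fun q => q.2 / q.1),
    inferInstance, inferInstance, inferInstance, ?_, ?_, ?_, ?_⟩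
  · intro h0
    have h1 : τ.snd Set.univ = 0 := by rw [h0]; rfl
    rw [Measure.snd_univ, hτ, Measure.compProd_apply_univ, Measure.fst_univ, hr,
      Measure.map_apply measurable_swap MeasurableSet.univ, Set.preimage_univ] at h1
    exact hρ0 (Measure.measure_univ_eq_zero.1 h1)
  · refine Measure.AbsolutelyContinuous.mk fun N hN hN0 => ?_
    refine measure_eq_zero_iff_ae_notMem.2 (hτsnd hN.compl (hk1.mono fun y hy => ?_))
    exact measure_eq_zero_iff_ae_notMem.1 ((hy.prod hy) hN0)
  · refine Measure.AbsolutelyContinuous.mk fun N hN hN0 => ?_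
    have hf : Measurable fun p : G × G => (p.2 / p.1, p.1) := by fun_prop
    rw [Measure.map_apply hf hN]
    refine measure_eq_zero_iff_ae_notMem.2 (hτsnd (hf hN).compl ?_)
    refine (key (fun a b => a / b) (by fun_prop) N hN hN0).mono fun y hy => ?_
    refine (Measure.ae_prod_iff_ae_ae (hf hN).compl).2 (hy.mono fun x hx => hx.mono fun x' hx' => ?_)
    simp only [inv_div_inv, mul_div_mul_left_eq_div] at hx'
    exact hx'
  · refine Measure.AbsolutelyContinuous.mk fun N hN hN0 => ?_
    have hf : Measurable fun p : G × G => (p.2 / p.1, p.2) := by fun_prop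
    rw [Measure.map_apply hf hN]
    refine measure_eq_zero_iff_ae_notMem.2 (hτsnd (hf hN).compl ?_)
    refine (key (fun a b => b / a) (by fun_prop) N hN hN0).mono fun y hy => ?_
    rw [← Measure.prod_swap, ae_map_iff measurable_swap.aemeasurable (hf hN).compl]
    refine (Measure.ae_prod_iff_ae_ae (measurable_swap (hf hN).compl)).2
      (hy.mono fun x hx => hx.mono fun x' hx' => ?_)
    simp only [inv_div_inv, mul_div_mul_left_eq_div] at hx'
    exact hx'

end Gluing

/-- A nonzero measure on the pairs `(x, y)` for which any two of `x`, `y`, `(x y)⁻¹` are jointly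
absolutely continuous with respect to a product measure forces a nonatomic factor of these products
to be nonsingular. -/
theorem not_mutuallySingular_haar_of_tie {σ₁ σ₂ σ₃ : Measure Circle} [IsFiniteMeasure σ₁]
    [IsFiniteMeasure σ₂] [IsFiniteMeasure σ₃] (hna : ∀ x, σ₁ {x} = 0)
    {ρ : Measure (Circle × Circle)} [IsFiniteMeasure ρ] (hρ0 : ρ ≠ 0)
    (h₁₂ : ρ ≪ σ₁.prod σ₂) (h₁₃ : ρ.map (fun p => (p.1, (p.1 * p.2)⁻¹)) ≪ σ₁.prod σ₃)
    (h₂₃ : ρ.map (fun p => (p.2, (p.1 * p.2)⁻¹)) ≪ σ₂.prod σ₃) : ¬ σ₁ ⟂ₘ Measure.haar := by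
  obtain ⟨κ, θ₁, θ₂, _, _, _, hκ0, hκ, h1, h2⟩ := exists_gluing hρ0 h₁₂ h₁₃ h₂₃
  obtain ⟨η, _, hη, C, hC, hN⟩ := exists_selfTranslating hκ0 hκ h1 h2
  rintro ⟨Z, hZ, hσZ, hZc⟩
  -- Nonatomicity and singularity both pass from σ₁ to η, since η is dominated by countably many
  -- translates of σ₁.
  have hna' : ∀ x, η {x} = 0 := fun x => hN _ (measurableSet_singleton x) fun g _ => by
    have : (g * ·) ⁻¹' ({x} : Set Circle) = {g⁻¹ * x} := by
      ext y; simp [eq_inv_mul_iff_mul_eq]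
    rw [this]; exact hna _
  refine not_mutuallySingular_haar hη hna'
    ⟨⋂ g ∈ C, (g⁻¹ * ·) ⁻¹' Z, MeasurableSet.biInter hC fun g _ => measurable_const_mul _ hZ, ?_, ?_⟩
  · refine hN _ (MeasurableSet.biInter hC fun g _ => measurable_const_mul _ hZ) fun g hg => ?_
    refine measure_mono_null (fun x hx => ?_) hσZ
    simpa using Set.mem_iInter₂.1 hx g hg
  · simp only [Set.compl_iInter]
    refine (measure_biUnion_null_iff hC).2 fun g _ => ?_
    rw [← Set.preimage_compl, measure_preimage_mul]
    exact hZc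


/-! ### Overlap of convolution powers. -/

section ConvolutionPowers

instance isFiniteMeasure_convPow (σ : Measure Circle) [IsFiniteMeasure σ] (n : ℕ) :
    IsFiniteMeasure (convPow σ n) := by
  induction n with
  | zero => unfold convPow; infer_instance
  | succ n ih => unfold convPow; infer_instance

lemma convPow_add (σ : Measure Circle) [IsFiniteMeasure σ] (m n : ℕ) :
    convPow σ (m + n) = (convPow σ m).mconv (convPow σ n) := by
  induction n with
  | zero => simp [convPow]
  | succ n ih => rw [← add_assoc, convPow, ih, convPow, Measure.mconv_assoc]

lemma mconv_absolutelyContinuous_mconv {μ μ' ν ν' : Measure Circle} [SFinite ν] [SFinite ν']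
    (hμ : μ ≪ μ') (hν : ν ≪ ν') : μ.mconv ν ≪ μ'.mconv ν' :=
  (hμ.prod hν).map (measurable_fst.mul measurable_snd)

lemma convPow_absolutelyContinuous {α σ : Measure Circle} [IsFiniteMeasure α] [IsFiniteMeasure σ]
    (h : α ≪ σ) (n : ℕ) : convPow α n ≪ convPow σ n := by
  induction n with
  | zero => exact Measure.AbsolutelyContinuous.rfl
  | succ n ih => exact mconv_absolutelyContinuous_mconv ih h

lemma convPow_univ (σ : Measure Circle) [IsFiniteMeasure σ] (n : ℕ) :
    convPow σ n Set.univ = σ Set.univ ^ n := by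
  induction n with
  | zero => simp [convPow]
  | succ n ih =>
    rw [convPow, Measure.mconv, Measure.map_apply (by fun_prop)
      MeasurableSet.univ, Set.preimage_univ, ← Set.univ_prod_univ, Measure.prod_prod, ih, pow_succ]

lemma convPow_ne_zero_of_mem_nhds {σ : Measure Circle} [IsFiniteMeasure σ]
    (h : ∀ U ∈ 𝓝 (1 : Circle), σ U ≠ 0) (n : ℕ) : ∀ U ∈ 𝓝 (1 : Circle), convPow σ n U ≠ 0 := by
  induction n with
  | zero =>
    intro U hU
    simp [convPow, Measure.dirac_apply_of_mem (mem_of_mem_nhds hU)]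
  | succ n ih =>
    intro U hU
    have hc : Tendsto (fun p : Circle × Circle => p.1 * p.2) (𝓝 1 ×ˢ 𝓝 1) (𝓝 1) := by
      have := (continuous_mul (M := Circle)).tendsto (1, 1)
      rwa [nhds_prod_eq, one_mul] at this
    obtain ⟨V, hV, hVU⟩ := mem_prod_same_iff.1 (hc hU)
    have h1 : convPow σ n V * σ V ≤ convPow σ (n + 1) U := by
      rw [← Measure.prod_prod, convPow, Measure.mconv]
      exact (measure_mono hVU).trans (Measure.le_map_apply (by fun_prop) _)
    intro h0
    rw [h0, nonpos_iff_eq_zero, mul_eq_zero] at h1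
    exact h1.elim (ih V hV) (h V hV)

open scoped Pointwise in
/-- Convolution powers of a nonsingular measure charging all neighbourhoods of the neutral element
are not mutually singular. -/
theorem not_mutuallySingular_convPow {σ : Measure Circle} [IsFiniteMeasure σ]
    (hσ : ¬ σ ⟂ₘ Measure.haar) (hU : ∀ U ∈ 𝓝 (1 : Circle), σ U ≠ 0) {m n : ℕ} (hm : 1 ≤ m)
    (hn : 1 ≤ n) : ¬ convPow σ m ⟂ₘ convPow σ n := by
  wlog hmn : m ≤ n generalizing m n
  · exact fun h => this hn hm (le_of_not_ge hmn) h.symm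
  obtain ⟨j, rfl⟩ := Nat.exists_eq_add_of_le hmn
  rintro ⟨Z, hZ, hZ0, hZc⟩
  -- The powers of the absolutely continuous part of σ are absolutely continuous, and such a measure
  -- overlaps its translates by t near 1. Since σ^{*j} charges these t, the powers m and m + j
  -- overlap.
  set α := (Measure.haar : Measure Circle).withDensity (σ.rnDeriv Measure.haar) with hα
  have hασ : α ≤ σ := Measure.withDensity_rnDeriv_le _ _
  have hαfin : IsFiniteMeasure α := isFiniteMeasure_of_le σ hασ
  have hα0 : α ≠ 0 := fun h => hσ (Measure.withDensity_rnDeriv_eq_zero σ _ |>.1 h)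
  set ζ := convPow α m with hζ
  have hζσ : ζ ≪ convPow σ m :=
    convPow_absolutelyContinuous (Measure.absolutelyContinuous_of_le hασ) m
  have hζhaar : ζ ≪ Measure.haar := by
    obtain ⟨i, rfl⟩ := Nat.exists_eq_add_of_le' hm
    exact Measure.mconv_absolutelyContinuous (withDensity_absolutelyContinuous _ _)
  have hζ0 : ζ Set.univ ≠ 0 := by
    rw [hζ, convPow_univ]
    exact pow_ne_zero _ fun h => hα0 (Measure.measure_univ_eq_zero.1 h)
  have hζZ : ζ Z = 0 := hζσ hZ0
  -- translations `t` for which the translate of `ζ` by `t` lives on `Z`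
  have hae : ∀ᵐ t ∂convPow σ j, ζ ((t * ·) ⁻¹' Zᶜ) = 0 := by
    have h1 : (convPow σ j).mconv ζ ≪ convPow σ (m + j) := by
      rw [add_comm, convPow_add]
      exact mconv_absolutelyContinuous_mconv Measure.AbsolutelyContinuous.rfl hζσ
    have h2 := h1 hZc
    rw [Measure.mconv, Measure.map_apply (by fun_prop) hZ.compl] at h2
    exact Measure.measure_ae_null_of_prod_null h2
  have hζd : ζ = Measure.haar.withDensity (ζ.rnDeriv Measure.haar) :=
    (Measure.withDensity_rnDeriv_eq _ _ hζhaar).symm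
  have hrn := Measure.measurable_rnDeriv ζ (Measure.haar : Measure Circle)
  have hnull : ∀ B, ζ B = 0 ↔ Measure.haar ({x | ζ.rnDeriv Measure.haar x ≠ 0} ∩ B) = 0 := by
    intro B
    rw [← withDensity_apply_eq_zero hrn, ← hζd]
  have hEm : MeasurableSet ({x : Circle | ζ.rnDeriv Measure.haar x ≠ 0} ∩ Zᶜ) :=
    (hrn (measurableSet_singleton 0).compl).inter hZ.compl
  have hE0 : Measure.haar ({x : Circle | ζ.rnDeriv Measure.haar x ≠ 0} ∩ Zᶜ) ≠ 0 := by
    rw [Ne, ← hnull]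
    intro h
    exact hζ0 (by rw [← measure_add_measure_compl hZ, hζZ, h, add_zero])
  obtain ⟨K, hKE, hK, hK0⟩ := hEm.exists_lt_isCompact (pos_iff_ne_zero.2 hE0)
  -- For t near 1 the set tK \ K has smaller Haar measure than K, so tK meets K in positive measure.
  -- Singularity makes that intersection null for σ^{*j}-almost every t.
  have hsmall := (tendsto_measure_smul_sdiff_isCompact_isClosed (μ := (Measure.haar : Measure Circle))
    hK hK.isClosed).eventually (gt_mem_nhds hK0)
  refine convPow_ne_zero_of_mem_nhds hU j _ hsmall ?_
  refine measure_mono_null (t := {t | ¬ ζ ((t * ·) ⁻¹' Zᶜ) = 0}) (fun t ht hζt => ?_) hae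
  have hinter : Measure.haar (t • K ∩ K) = 0 := by
    have h1 : t • K ∩ K = t • (K ∩ (t * ·) ⁻¹' K) := by
      rw [Set.smul_set_inter]
      congr 1
      ext x
      simp [Set.mem_smul_set_iff_inv_smul_mem]
    rw [h1, measure_smul]
    refine measure_mono_null ?_ ((hnull _).1 hζt)
    exact fun x hx => ⟨(hKE hx.1).1, (hKE hx.2).2⟩
  have h2 := measure_inter_add_sdiff (μ := (Measure.haar : Measure Circle)) (t • K) hK.measurableSet
  rw [hinter, zero_add, measure_smul] at h2
  exact ht.ne h2

end ConvolutionPowers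

/-! ### Existence of spectral measures of unitary operators. -/

section SpectralMeasures

/-- The character `z ↦ z ^ n` of the circle. -/
noncomputable def circleChar (n : ℤ) : C(Circle, ℂ) :=
  ⟨fun z => (z : ℂ) ^ n, by
    have : (fun z : Circle => (z : ℂ) ^ n) = fun z => ((z ^ n : Circle) : ℂ) := by
      funext z; simp
    rw [this]
    exact continuous_subtype_val.comp (continuous_zpow n)⟩

@[simp] lemma circleChar_apply (n : ℤ) (z : Circle) : circleChar n z = (z : ℂ) ^ n := rfl

open CompactlySupported in
/-- A positive functional on the continuous functions of the circle is integration. -/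
lemma exists_measure_of_positive (Λ : C(Circle, ℂ) →ₗ[ℂ] ℂ)
    (hΛ : ∀ g : C(Circle, ℂ), ∃ r : ℝ, 0 ≤ r ∧ Λ (g * star g) = r) :
    ∃ ρ : Measure Circle, IsFiniteMeasure ρ ∧ ∀ g : C(Circle, ℂ), ∫ z, g z ∂ρ = Λ g := by
  let c : C(Circle, ℝ) → C(Circle, ℂ) := fun g => ⟨fun z => (g z : ℂ), by fun_prop⟩
  have hpos : ∀ g : C(Circle, ℝ), 0 ≤ g → ∃ r : ℝ, 0 ≤ r ∧ Λ (c g) = r := by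
    intro g hg
    -- The hypothesis gives positivity on squares g g*; the square root turns it into positivity on
    -- nonnegative functions, as Riesz representation requires.
    have h1 : c g = (c ⟨fun z => √(g z), by fun_prop⟩) *
        star (c ⟨fun z => √(g z), by fun_prop⟩) := by
      ext z
      have : g z = √(g z) * √(g z) := (Real.mul_self_sqrt (hg z)).symm
      simp only [c, ContinuousMap.coe_mk, ContinuousMap.mul_apply, ContinuousMap.star_apply,
        Complex.star_def, Complex.conj_ofReal]
      exact_mod_cast this
    rw [h1]
    exact hΛ _
  have hreal : ∀ g : C(Circle, ℝ), (Λ (c g)).im = 0 := by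
    intro g
    have h1 : c g = c (g ⊔ 0) - c (-g ⊔ 0) := by
      ext z
      simp only [c, ContinuousMap.coe_mk, ContinuousMap.sub_apply, ContinuousMap.sup_apply,
        ContinuousMap.zero_apply, ContinuousMap.neg_apply]
      rw [← Complex.ofReal_sub]
      congr 1
      rcases le_total (g z) 0 with h | h
      · rw [sup_eq_right.2 h, sup_eq_left.2 (neg_nonneg.2 h)]; ring
      · rw [sup_eq_left.2 h, sup_eq_right.2 (neg_nonpos.2 h)]; ring
    obtain ⟨a, -, ha⟩ := hpos (g ⊔ 0) le_sup_right
    obtain ⟨b, -, hb⟩ := hpos (-g ⊔ 0) le_sup_right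
    rw [h1, map_sub, ha, hb]
    simp
  let L : C_c(Circle, ℝ) →ₗ[ℝ] ℝ :=
    { toFun := fun g => (Λ (c g.toContinuousMap)).re
      map_add' := by
        intro g h
        rw [← Complex.add_re, ← map_add]
        congr 2
        ext z
        simp [c]
      map_smul' := by
        intro a g
        have : c (a • g).toContinuousMap = (a : ℂ) • c g.toContinuousMap := by
          ext z
          simp [c]
        rw [this, map_smul]
        simp }
  let P : C_c(Circle, ℝ) →ₚ[ℝ] ℝ := PositiveLinearMap.mk₀ L (by
    intro g hg
    obtain ⟨r, hr, h⟩ := hpos g.toContinuousMap (fun z => hg z)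
    change 0 ≤ (Λ (c g.toContinuousMap)).re
    rw [h]
    simpa using hr)
  obtain ⟨ρ, hρ⟩ : ∃ ρ, ρ = RealRMK.rieszMeasure P := ⟨_, rfl⟩
  have hfin : IsFiniteMeasureOnCompacts ρ := hρ ▸ inferInstance
  have hfin' : IsFiniteMeasure ρ := ⟨isCompact_univ.measure_lt_top⟩
  refine ⟨ρ, hfin', ?_⟩
  have hR : ∀ g : C(Circle, ℝ), ((∫ z, g z ∂ρ : ℝ) : ℂ) = Λ (c g) := by
    intro g
    have h1 := RealRMK.integral_rieszMeasure P
      ⟨g, HasCompactSupport.of_compactSpace _⟩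
    rw [← hρ] at h1
    have h2 : ∫ z, g z ∂ρ = (Λ (c g)).re := h1
    apply Complex.ext
    · rw [h2]; simp
    · rw [hreal]; simp
  intro g
  let gr : C(Circle, ℝ) := ⟨fun z => (g z).re, by fun_prop⟩
  let gi : C(Circle, ℝ) := ⟨fun z => (g z).im, by fun_prop⟩
  have hg : g = c gr + Complex.I • c gi := by
    ext z
    simp only [c, gr, gi, ContinuousMap.add_apply, ContinuousMap.smul_apply, ContinuousMap.coe_mk,
      smul_eq_mul]
    rw [mul_comm, Complex.re_add_im]
  have hint : Integrable (fun z => g z) ρ :=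
    g.continuous.integrable_of_hasCompactSupport (HasCompactSupport.of_compactSpace _)
  rw [hg, map_add, map_smul, ← hR, ← hR, ← hg, ← integral_re_add_im hint]
  simp only [gr, gi, ContinuousMap.coe_mk, smul_eq_mul]
  rw [mul_comm]
  rfl

/-- The spectral measure of a vector for a unitary operator. -/
theorem exists_measure_of_unitary {H : Type*} [NormedAddCommGroup H] [InnerProductSpace ℂ H]
    [CompleteSpace H] (V : H ≃ₗᵢ[ℂ] H) (v : H) :
    ∃ ρ : Measure Circle, IsFiniteMeasure ρ ∧
      ∀ n : ℤ, ∫ z : Circle, (z : ℂ) ^ n ∂ρ = inner ℂ v ((V ^ n : H ≃ₗᵢ[ℂ] H) v) := by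
  set u : H →L[ℂ] H := (V : H →L[ℂ] H) with hu
  have hstar : star u = (V.symm : H →L[ℂ] H) := by
    rw [ContinuousLinearMap.star_eq_adjoint]
    exact LinearIsometryEquiv.adjoint_eq_symm V
  have hunit : u ∈ unitary (H →L[ℂ] H) := by
    rw [Unitary.mem_iff, hstar]
    constructor <;> ext x <;> simp [hu]
  have hn : IsStarNormal u := ⟨by
    rw [Unitary.mem_iff] at hunit
    rw [Commute, SemiconjBy, hunit.1, hunit.2]⟩
  let j : C(spectrum ℂ u, Circle) := ⟨fun z => ⟨z.1, by
    have := spectrum.subset_circle_of_unitary hunit z.2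
    simpa [Submonoid.unitSphere] using this⟩, by fun_prop⟩
  -- The continuous functional calculus of u, pulled back from its spectrum to the whole circle; it
  -- sends characters to powers of V.
  let Φ : C(Circle, ℂ) →⋆ₐ[ℂ] (H →L[ℂ] H) := (cfcHom hn).comp (j.compStarAlgHom' ℂ ℂ)
  have hΦ1 : Φ (circleChar 1) = u := by
    have : j.compStarAlgHom' ℂ ℂ (circleChar 1) = (ContinuousMap.id ℂ).restrict (spectrum ℂ u) := by
      ext z
      change (z : ℂ) ^ (1 : ℤ) = z
      simp
    change cfcHom hn (j.compStarAlgHom' ℂ ℂ (circleChar 1)) = u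
    rw [this, cfcHom_id]
  have hΦ : ∀ n : ℤ, ∀ x, Φ (circleChar n) x = (V ^ n : H ≃ₗᵢ[ℂ] H) x := by
    intro n
    induction n with
    | zero =>
      intro x
      have : circleChar 0 = 1 := by ext z; simp
      rw [this, map_one]; simp
    | succ n ih =>
      intro x
      have : circleChar (n + 1) = circleChar 1 * circleChar n := by
        ext z
        simp [zpow_add₀, mul_comm]
      rw [this, map_mul, hΦ1, add_comm, zpow_add, zpow_one]
      change u (Φ (circleChar n) x) = V ((V ^ (n : ℤ) : H ≃ₗᵢ[ℂ] H) x)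
      rw [ih]; rfl
    | pred n ih =>
      intro x
      have : circleChar (-(n : ℤ) - 1) = star (circleChar 1) * circleChar (-(n : ℤ)) := by
        ext z
        simp [zpow_sub₀, mul_comm, ← Circle.coe_inv_eq_conj, div_eq_mul_inv]
      rw [this, map_mul, map_star, hΦ1, sub_eq_add_neg, add_comm, zpow_add, hstar]
      change V.symm (Φ (circleChar (-(n : ℤ))) x) = V.symm ((V ^ (-(n : ℤ)) : H ≃ₗᵢ[ℂ] H) x)
      rw [ih]
  let Λ : C(Circle, ℂ) →ₗ[ℂ] ℂ :=
    { toFun := fun g => inner ℂ v (Φ g v)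
      map_add' := by intro g h; simp
      map_smul' := by intro a g; simp }
  obtain ⟨ρ, hρ, h⟩ := exists_measure_of_positive Λ (by
    intro g
    refine ⟨‖Φ (star g) v‖ ^ 2, by positivity, ?_⟩
    change inner ℂ v (Φ (g * star g) v) = _
    rw [map_mul, map_star, mul_apply_eq_comp, ContinuousLinearMap.star_eq_adjoint,
      ← ContinuousLinearMap.adjoint_inner_left, inner_self_eq_norm_sq_to_K]
    simp)
  refine ⟨ρ, hρ, fun n => ?_⟩
  have := h (circleChar n)
  simp only [circleChar_apply] at this
  rw [this]
  change inner ℂ v (Φ (circleChar n) v) = _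
  rw [hΦ]

end SpectralMeasures

/-! ### The Koopman operator, and what mixing says about σ. -/

section Koopman

variable {X : Type*} [MeasurableSpace X] {μ : Measure X} {T : X ≃ᵐ X}

lemma measurePreserving_zpow (hT : MeasurePreserving T μ μ) (n : ℤ) :
    MeasurePreserving (((T.toEquiv : Equiv.Perm X) ^ n : Equiv.Perm X)) μ μ := by
  induction n with
  | zero => exact MeasurePreserving.id μ
  | succ n ih =>
    rw [zpow_add, zpow_one, Equiv.Perm.coe_mul]
    exact ih.comp hT
  | pred n ih =>
    rw [sub_eq_add_neg, zpow_add, zpow_neg_one, Equiv.Perm.coe_mul]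
    exact ih.comp (hT.symm T)

lemma zpow_add_apply (n m : ℤ) (x : X) :
    ((T.toEquiv : Equiv.Perm X) ^ (n + m) : Equiv.Perm X) x =
      ((T.toEquiv : Equiv.Perm X) ^ n : Equiv.Perm X)
        (((T.toEquiv : Equiv.Perm X) ^ m : Equiv.Perm X) x) := by
  rw [zpow_add]; rfl

lemma measurable_zpow (T : X ≃ᵐ X) (n : ℤ) :
    Measurable ((T.toEquiv : Equiv.Perm X) ^ n : Equiv.Perm X) :=
  (measurePreserving_zpow (μ := 0) ⟨T.measurable, by simp⟩ n).measurable

/-- The powers of `T` as measurable equivalences. -/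
def zpowEquiv (T : X ≃ᵐ X) (n : ℤ) : X ≃ᵐ X where
  toEquiv := (T.toEquiv : Equiv.Perm X) ^ n
  measurable_toFun := measurable_zpow T n
  measurable_invFun := by
    have := measurable_zpow T (-n)
    rwa [zpow_neg] at this

/-- The Koopman operator on `L²`, as a unitary operator. -/
noncomputable def koopman (hT : MeasurePreserving T μ μ) : Lp ℂ 2 μ ≃ₗᵢ[ℂ] Lp ℂ 2 μ :=
  { Lp.compMeasurePreservingₗᵢ ℂ T hT with
    invFun := Lp.compMeasurePreserving T.symm (hT.symm T)
    left_inv := by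
      intro g
      change Lp.compMeasurePreserving T.symm (hT.symm T) (Lp.compMeasurePreserving T hT g) = g
      rw [← Lp.compMeasurePreserving_comp_apply]
      convert Lp.compMeasurePreserving_id_apply g
      ext x; simp
    right_inv := by
      intro g
      change Lp.compMeasurePreserving T hT (Lp.compMeasurePreserving T.symm (hT.symm T) g) = g
      rw [← Lp.compMeasurePreserving_comp_apply]
      convert Lp.compMeasurePreserving_id_apply g
      ext x; simp }

lemma koopman_toLp (hT : MeasurePreserving T μ μ) {f : X → ℂ} (hf : MemLp f 2 μ) :
    koopman hT (hf.toLp f) = (hf.comp_measurePreserving hT).toLp (f ∘ T) :=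
  Lp.toLp_compMeasurePreserving hf hT

lemma koopman_symm_toLp (hT : MeasurePreserving T μ μ) {f : X → ℂ} (hf : MemLp f 2 μ) :
    (koopman hT).symm (hf.toLp f) =
      (hf.comp_measurePreserving (hT.symm T)).toLp (f ∘ T.symm) :=
  Lp.toLp_compMeasurePreserving hf (hT.symm T)

lemma koopman_zpow_toLp (hT : MeasurePreserving T μ μ) {f : X → ℂ} (hf : MemLp f 2 μ) (n : ℤ) :
    (koopman hT ^ n : Lp ℂ 2 μ ≃ₗᵢ[ℂ] Lp ℂ 2 μ) (hf.toLp f) =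
      (hf.comp_measurePreserving (measurePreserving_zpow hT n)).toLp
        (f ∘ ((T.toEquiv : Equiv.Perm X) ^ n : Equiv.Perm X)) := by
  induction n with
  | zero => rfl
  | succ n ih =>
    rw [add_comm, zpow_add, zpow_one]
    change koopman hT ((koopman hT ^ (n : ℤ) : Lp ℂ 2 μ ≃ₗᵢ[ℂ] Lp ℂ 2 μ) _) = _
    rw [ih, koopman_toLp]
    congr 1
    ext x
    simp only [Function.comp_apply]
    rw [add_comm, zpow_add_apply]
    rfl
  | pred n ih =>
    rw [sub_eq_add_neg, add_comm, zpow_add, zpow_neg_one]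
    change (koopman hT).symm ((koopman hT ^ (-(n : ℤ)) : Lp ℂ 2 μ ≃ₗᵢ[ℂ] Lp ℂ 2 μ) _) = _
    rw [ih, koopman_symm_toLp]
    congr 1
    ext x
    simp only [Function.comp_apply]
    rw [add_comm, zpow_add_apply]
    rfl

theorem exists_isSpectralMeasure (hT : MeasurePreserving T μ μ) {f : X → ℂ} (hf : MemLp f 2 μ) :
    ∃ ρ, IsSpectralMeasure T μ f ρ := by
  obtain ⟨ρ, hρ, h⟩ := exists_measure_of_unitary (koopman hT) (hf.toLp f)
  refine ⟨ρ, hρ, fun n => ?_⟩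
  rw [h, koopman_zpow_toLp hT hf, L2.inner_def]
  refine integral_congr_ae ?_
  filter_upwards [hf.coeFn_toLp,
    (hf.comp_measurePreserving (measurePreserving_zpow hT n)).coeFn_toLp] with x h1 h2
  rw [h1, h2]
  simp

lemma IsSpectralMeasure.integral_char_mul_conj (hT : MeasurePreserving T μ μ) {f : X → ℂ}
    {ρ : Measure Circle} (h : IsSpectralMeasure T μ f ρ) (n m : ℤ) :
    ∫ z : Circle, (z : ℂ) ^ n * (starRingEnd ℂ) ((z : ℂ) ^ m) ∂ρ =
      ∫ x, f (((T.toEquiv : Equiv.Perm X) ^ n) x) *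
        (starRingEnd ℂ) (f (((T.toEquiv : Equiv.Perm X) ^ m) x)) ∂μ := by
  have h1 : ∀ z : Circle, (z : ℂ) ^ n * (starRingEnd ℂ) ((z : ℂ) ^ m) = (z : ℂ) ^ (n - m) := by
    intro z
    rw [map_zpow₀, ← Circle.coe_inv_eq_conj, zpow_sub₀ (Circle.coe_ne_zero z), Circle.coe_inv,
      inv_zpow, div_eq_mul_inv]
  simp_rw [h1]
  rw [h.2, ← (measurePreserving_zpow hT m).integral_comp (zpowEquiv T m).measurableEmbedding]
  simp_rw [← zpow_add_apply, sub_add_cancel]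

/-- The centred indicator `1_A - μ A`. -/
noncomputable def centredIndicator (μ : Measure X) (A : Set X) (x : X) : ℂ :=
  A.indicator 1 x - (μ.real A : ℂ)

lemma measurable_centredIndicator {A : Set X} (hA : MeasurableSet A) :
    Measurable (centredIndicator μ A) :=
  (measurable_one.indicator hA).sub_const _

lemma norm_centredIndicator_le [IsProbabilityMeasure μ] (A : Set X) (x : X) :
    ‖centredIndicator μ A x‖ ≤ 1 := by
  have h0 : 0 ≤ μ.real A := measureReal_nonneg
  have h1 : μ.real A ≤ 1 := measureReal_le_one
  by_cases hx : x ∈ A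
  · have : centredIndicator μ A x = ((1 - μ.real A : ℝ) : ℂ) := by simp [centredIndicator, hx]
    rw [this, Complex.norm_real, Real.norm_eq_abs, abs_le]
    constructor <;> linarith
  · have : centredIndicator μ A x = ((- μ.real A : ℝ) : ℂ) := by simp [centredIndicator, hx]
    rw [this, Complex.norm_real, Real.norm_eq_abs, abs_le]
    constructor <;> linarith

lemma memLp_centredIndicator [IsProbabilityMeasure μ] {A : Set X} (hA : MeasurableSet A) :
    MemLp (centredIndicator μ A) 2 μ :=
  MemLp.of_bound (measurable_centredIndicator hA).aestronglyMeasurable 1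
    (Eventually.of_forall (norm_centredIndicator_le A))

lemma integral_indicator_one_complex {A : Set X} (hA : MeasurableSet A) :
    ∫ x, A.indicator (1 : X → ℂ) x ∂μ = μ.real A := by
  rw [integral_indicator hA]
  simp

lemma integrable_indicator_one_complex [IsProbabilityMeasure μ] {A : Set X}
    (hA : MeasurableSet A) : Integrable (A.indicator (1 : X → ℂ)) μ :=
  (integrable_const (1 : ℂ)).indicator hA

lemma isCentredL2_centredIndicator [IsProbabilityMeasure μ] {A : Set X} (hA : MeasurableSet A) :
    IsCentredL2 μ (centredIndicator μ A) := by
  refine ⟨memLp_centredIndicator hA, ?_⟩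
  unfold centredIndicator
  rw [integral_sub (integrable_indicator_one_complex hA) (integrable_const _),
    integral_indicator_one_complex hA]
  simp

/-- Correlations of a centred indicator. -/
lemma integral_centredIndicator_mul_conj [IsProbabilityMeasure μ] (hT : MeasurePreserving T μ μ)
    {A : Set X} (hA : MeasurableSet A) (n m : ℤ) :
    ∫ x, centredIndicator μ A (((T.toEquiv : Equiv.Perm X) ^ n : Equiv.Perm X) x) *
        (starRingEnd ℂ) (centredIndicator μ A
          (((T.toEquiv : Equiv.Perm X) ^ m : Equiv.Perm X) x)) ∂μ =
      ((μ.real ((((T.toEquiv : Equiv.Perm X) ^ n : Equiv.Perm X) ⁻¹' A) ∩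
        (((T.toEquiv : Equiv.Perm X) ^ m : Equiv.Perm X) ⁻¹' A)) - μ.real A ^ 2 : ℝ) : ℂ) := by
  set S := ((T.toEquiv : Equiv.Perm X) ^ n : Equiv.Perm X)
  set R := ((T.toEquiv : Equiv.Perm X) ^ m : Equiv.Perm X)
  have hS : MeasurePreserving S μ μ := measurePreserving_zpow hT n
  have hR : MeasurePreserving R μ μ := measurePreserving_zpow hT m
  have hSA : MeasurableSet (S ⁻¹' A) := hS.measurable hA
  have hRA : MeasurableSet (R ⁻¹' A) := hR.measurable hA
  set a : ℂ := (μ.real A : ℂ) with ha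
  have h1 : ∀ x, centredIndicator μ A (S x) * (starRingEnd ℂ) (centredIndicator μ A (R x)) =
      (S ⁻¹' A ∩ R ⁻¹' A).indicator 1 x - a * (S ⁻¹' A).indicator 1 x -
        a * (R ⁻¹' A).indicator 1 x + a * a := by
    intro x
    by_cases hx : S x ∈ A <;> by_cases hy : R x ∈ A <;> simp [centredIndicator, hx, hy, ← ha] <;>
      simp [ha] <;> ring
  simp_rw [h1]
  have i1 := integrable_indicator_one_complex (μ := μ) (hSA.inter hRA)
  have i2 := (integrable_indicator_one_complex (μ := μ) hSA).const_mul a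
  have i3 := (integrable_indicator_one_complex (μ := μ) hRA).const_mul a
  have i12 : Integrable (fun x => (S ⁻¹' A ∩ R ⁻¹' A).indicator (1 : X → ℂ) x -
      a * (S ⁻¹' A).indicator (1 : X → ℂ) x) μ := i1.sub i2
  have i123 : Integrable (fun x => (S ⁻¹' A ∩ R ⁻¹' A).indicator (1 : X → ℂ) x -
      a * (S ⁻¹' A).indicator (1 : X → ℂ) x - a * (R ⁻¹' A).indicator (1 : X → ℂ) x) μ :=
    i12.sub i3
  rw [integral_add i123 (integrable_const _), integral_sub i12 i3,
    integral_sub i1 i2, integral_const_mul, integral_const_mul,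
    integral_indicator_one_complex (hSA.inter hRA), integral_indicator_one_complex hSA,
    integral_indicator_one_complex hRA]
  have e1 : μ.real (S ⁻¹' A) = μ.real A := hS.measureReal_preimage hA.nullMeasurableSet
  have e2 : μ.real (R ⁻¹' A) = μ.real A := hR.measureReal_preimage hA.nullMeasurableSet
  rw [e1, e2]
  simp [← ha]
  ring

lemma iterate_image_eq (T : X ≃ᵐ X) (n : ℕ) (A : Set X) :
    (⇑T)^[n] '' A = ((T.toEquiv : Equiv.Perm X) ^ (-(n : ℤ)) : Equiv.Perm X) ⁻¹' A := by
  have : (⇑T)^[n] = ((T.toEquiv : Equiv.Perm X) ^ n : Equiv.Perm X) :=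
    Equiv.Perm.iterate_eq_pow T.toEquiv n
  rw [this, Equiv.image_eq_preimage_symm, zpow_neg, zpow_natCast]
  rfl

lemma IsMixing.tendsto_real_inter [IsProbabilityMeasure μ] (hT : MeasurePreserving T μ μ)
    (hmix : IsMixing T μ) {A B : Set X} (hA : MeasurableSet A) (hB : MeasurableSet B) :
    Tendsto (fun n : ℕ => μ.real (((T.toEquiv : Equiv.Perm X) ^ (n : ℤ) : Equiv.Perm X) ⁻¹' A ∩ B))
      atTop (𝓝 (μ.real A * μ.real B)) := by
  have h1 := hmix ![A, B] (by intro i; fin_cases i <;> assumption)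
  have h2 : Tendsto (fun (n : ℕ) (_ : Fin 1) => n) atTop atTop :=
    tendsto_atTop_atTop.2 fun b => ⟨b 0, fun a ha i => by rwa [Subsingleton.elim i 0]⟩
  have h3 := h1.comp h2
  rw [Fin.prod_univ_two] at h3
  have h4 := (ENNReal.tendsto_toReal (by finiteness)).comp h3
  simp only [Matrix.cons_val_zero, Matrix.cons_val_one, ENNReal.toReal_mul] at h4
  refine h4.congr fun n => ?_
  have hp := measurePreserving_zpow hT (n : ℤ)
  have h5 : (⋂ i : Fin 2, (⇑T)^[∑ j ∈ Finset.univ.filter (fun j : Fin 1 => (j : ℕ) < (i : ℕ)), n] ''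
      (![A, B] : Fin 2 → Set X) i) = A ∩ (⇑T)^[n] '' B := by
    ext x
    simp only [Set.mem_iInter, Fin.forall_fin_two]
    simp
  have h6 : ((T.toEquiv : Equiv.Perm X) ^ (n : ℤ) : Equiv.Perm X) ⁻¹' A ∩ B =
      ((T.toEquiv : Equiv.Perm X) ^ (n : ℤ) : Equiv.Perm X) ⁻¹' (A ∩ (⇑T)^[n] '' B) := by
    rw [iterate_image_eq, Set.preimage_inter]
    congr 1
    ext x
    simp only [Set.mem_preimage]
    rw [← zpow_add_apply, neg_add_cancel]
    rfl
  simp only [Function.comp_apply]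
  rw [h5, h6]
  refine (hp.measureReal_preimage ?_).symm
  refine (hA.inter ?_).nullMeasurableSet
  rw [iterate_image_eq]
  exact measurable_zpow T _ hB

/-- A geometric sum on the circle. -/
lemma norm_geom_sum_mul_le (u : Circle) (N : ℕ) :
    ‖∑ n ∈ Finset.range N, (u : ℂ) ^ n‖ * ‖(u : ℂ) - 1‖ ≤ 2 := by
  rw [← norm_mul, geom_sum_mul]
  calc ‖(u : ℂ) ^ N - 1‖ ≤ ‖(u : ℂ) ^ N‖ + ‖(1 : ℂ)‖ := norm_sub_le _ _
    _ = 2 := by rw [norm_pow, Circle.norm_coe]; norm_num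

/-- A finite measure on the circle whose Fourier coefficients tend to zero has no atoms. -/
lemma measure_singleton_eq_zero_of_tendsto {ρ : Measure Circle} [IsFiniteMeasure ρ]
    (h : Tendsto (fun n : ℕ => ∫ z : Circle, (z : ℂ) ^ n ∂ρ) atTop (𝓝 0)) (w : Circle) :
    ρ {w} = 0 := by
  -- Wiener's argument: these averages are bounded by 1 and converge pointwise to the indicator of
  -- w, while their integrals are Cesàro means of Fourier coefficients with unimodular twists.
  let F : ℕ → Circle → ℂ := fun N z =>
    (N : ℝ)⁻¹ • ∑ n ∈ Finset.range N, (((w⁻¹ * z : Circle) : ℂ)) ^ n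
  have hpow : ∀ n, Continuous fun z : Circle => (((w⁻¹ * z : Circle) : ℂ)) ^ n := by
    intro n; fun_prop
  have hF : ∀ N, Continuous (F N) := by
    intro N
    exact (continuous_finsetSum _ fun n _ => hpow n).const_smul ((N : ℝ)⁻¹)
  have hle : ∀ N z, ‖F N z‖ ≤ 1 := by
    intro N z
    rw [norm_smul, norm_inv, Real.norm_natCast]
    rcases N.eq_zero_or_pos with rfl | hN
    · simp
    rw [inv_mul_le_iff₀ (by exact_mod_cast hN), mul_one]
    refine (norm_sum_le _ _).trans ?_
    simp_rw [norm_pow, Circle.norm_coe]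
    simp
  have hlim : ∀ z, Tendsto (fun N => F N z) atTop (𝓝 (({w} : Set Circle).indicator 1 z)) := by
    intro z
    by_cases hz : z = w
    · subst hz
      refine tendsto_const_nhds.congr' ?_
      filter_upwards [eventually_gt_atTop 0] with N hN
      have : (N : ℂ) ≠ 0 := by exact_mod_cast hN.ne'
      simp [F, this]
    · have hu : ((w⁻¹ * z : Circle) : ℂ) - 1 ≠ 0 := by
        rw [sub_ne_zero, Ne, Circle.coe_eq_one]
        intro h
        exact hz (by rw [inv_mul_eq_one] at h; exact h.symm)
      rw [Set.indicator_of_notMem (by simpa using hz)]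
      have h0 : Tendsto (fun N : ℕ => (N : ℝ)⁻¹ * (2 / ‖((w⁻¹ * z : Circle) : ℂ) - 1‖)) atTop
          (𝓝 0) := by
        simpa using (tendsto_inv_atTop_nhds_zero_nat (𝕜 := ℝ)).mul_const
          (2 / ‖((w⁻¹ * z : Circle) : ℂ) - 1‖)
      refine squeeze_zero_norm (fun N => ?_) h0
      rw [norm_smul, norm_inv, Real.norm_natCast]
      gcongr
      rw [le_div_iff₀ (norm_pos_iff.2 hu)]
      exact norm_geom_sum_mul_le _ N
  have h1 := tendsto_integral_of_dominated_convergence (μ := ρ) (fun _ => (1 : ℝ))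
    (fun N => (hF N).aestronglyMeasurable) (integrable_const _)
    (fun N => Eventually.of_forall (hle N)) (Eventually.of_forall hlim)
  have h2 : ∀ N, ∫ z, F N z ∂ρ = (N : ℝ)⁻¹ • ∑ n ∈ Finset.range N,
      (((w⁻¹ : Circle) : ℂ)) ^ n * ∫ z : Circle, (z : ℂ) ^ n ∂ρ := by
    intro N
    simp only [F]
    rw [integral_smul, integral_finsetSum]
    · simp_rw [Circle.coe_mul, mul_pow, integral_const_mul]
    · exact fun n _ => (hpow n).integrable_of_hasCompactSupport (HasCompactSupport.of_compactSpace _)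
  have h3 : Tendsto (fun n => (((w⁻¹ : Circle) : ℂ)) ^ n * ∫ z : Circle, (z : ℂ) ^ n ∂ρ) atTop
      (𝓝 0) := by
    rw [tendsto_zero_iff_norm_tendsto_zero] at h ⊢
    refine h.congr fun n => ?_
    rw [norm_mul, norm_pow, Circle.norm_coe, one_pow, one_mul]
  have h4 := h3.cesaro_smul
  simp_rw [h2] at h1
  have h5 := tendsto_nhds_unique h1 h4
  rw [integral_indicator (measurableSet_singleton w)] at h5
  simp only [Pi.one_apply, integral_const, MeasurableSet.univ, measureReal_restrict_apply,
    Set.univ_inter, Complex.real_smul, mul_one, Complex.ofReal_eq_zero] at h5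
  exact (measureReal_eq_zero_iff).1 h5

lemma IsMixing.measure_singleton_eq_zero [IsProbabilityMeasure μ] (hT : MeasurePreserving T μ μ)
    (hmix : IsMixing T μ) {A : Set X} (hA : MeasurableSet A) {ρ : Measure Circle}
    (hρ : IsSpectralMeasure T μ (centredIndicator μ A) ρ) (w : Circle) : ρ {w} = 0 := by
  have := hρ.1
  refine measure_singleton_eq_zero_of_tendsto ?_ w
  have h1 : ∀ n : ℕ, ∫ z : Circle, (z : ℂ) ^ n ∂ρ =
      ((μ.real (((T.toEquiv : Equiv.Perm X) ^ (n : ℤ) : Equiv.Perm X) ⁻¹' A ∩ A)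
        - μ.real A ^ 2 : ℝ) : ℂ) := by
    intro n
    have h2 := hρ.2 n
    have h3 := integral_centredIndicator_mul_conj hT hA n 0
    simp only [zpow_natCast, zpow_zero] at h2 h3 ⊢
    rw [h2]
    exact h3
  simp_rw [h1]
  have h4 := (hmix.tendsto_real_inter hT hA hA).sub_const (μ.real A ^ 2)
  rw [← sq, sub_self] at h4
  exact_mod_cast (Complex.continuous_ofReal.tendsto 0).comp h4

/-- A mixing transformation of a nontrivial space has sets of small positive measure. -/
lemma IsMixing.exists_measure_small [IsProbabilityMeasure μ] (hT : MeasurePreserving T μ μ)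
    (hmix : IsMixing T μ) {A : Set X} (hA : MeasurableSet A) (h0 : 0 < μ.real A)
    (h1 : μ.real A < 1) {ε : ℝ} (hε : 0 < ε) :
    ∃ B, MeasurableSet B ∧ 0 < μ.real B ∧ μ.real B < ε := by
  set a := μ.real A with ha
  have key : ∀ k : ℕ, ∃ B, MeasurableSet B ∧ 0 < μ.real B ∧ μ.real B ≤ a ∧
      μ.real B ≤ ((1 + a) / 2) ^ k := by
    intro k
    induction k with
    | zero => exact ⟨A, hA, h0, le_rfl, by simp [ha]⟩
    | succ k ih =>
      obtain ⟨B, hB, hB0, hBa, hBk⟩ := ih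
      set b := μ.real B with hb
      have hlim := hmix.tendsto_real_inter hT hB hB
      -- Intersecting B with a late translate of itself gives measure near b², and b ≤ a < (1 +
      -- a)/2, so each step shrinks the measure by a fixed factor.
      have hup : b * b < b * ((1 + a) / 2) := by
        apply mul_lt_mul_of_pos_left _ hB0
        linarith
      obtain ⟨n, hn1, hn2⟩ := ((hlim.eventually (lt_mem_nhds (mul_pos hB0 hB0))).and
        (hlim.eventually (gt_mem_nhds hup))).exists
      refine ⟨_, (measurable_zpow T n hB).inter hB, hn1,
        (measureReal_mono Set.inter_subset_right).trans hBa, hn2.le.trans ?_⟩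
      rw [pow_succ]
      gcongr
  have hr : Tendsto (fun k : ℕ => ((1 + a) / 2) ^ k) atTop (𝓝 0) :=
    tendsto_pow_atTop_nhds_zero_of_lt_one (by linarith) (by linarith)
  obtain ⟨k, hk⟩ := (hr.eventually (gt_mem_nhds hε)).exists
  obtain ⟨B, hB, hB0, -, hBk⟩ := key k
  exact ⟨B, hB, hB0, hBk.trans_lt hk⟩

/-- The second moment of Birkhoff sums of a centred indicator is at least that of independent
sums. -/
lemma le_integral_norm_geom_sum_sq [IsProbabilityMeasure μ] (hT : MeasurePreserving T μ μ)
    {A : Set X} (hA : MeasurableSet A) {ρ : Measure Circle}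
    (hρ : IsSpectralMeasure T μ (centredIndicator μ A) ρ) (N : ℕ) :
    N * μ.real A - N ^ 2 * μ.real A ^ 2 ≤
      ∫ z : Circle, ‖∑ n ∈ Finset.range N, (z : ℂ) ^ n‖ ^ 2 ∂ρ := by
  have := hρ.1
  have hint : ∀ n m : ℕ, Integrable
      (fun z : Circle => (z : ℂ) ^ (n : ℤ) * (starRingEnd ℂ) ((z : ℂ) ^ (m : ℤ))) ρ := by
    intro n m
    refine Continuous.integrable_of_hasCompactSupport ?_ (HasCompactSupport.of_compactSpace _)
    simp only [zpow_natCast]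
    exact (by fun_prop : Continuous fun z : Circle => (z : ℂ) ^ n).mul
      (Complex.continuous_conj.comp (by fun_prop))
  have hexp : ((∫ z : Circle, ‖∑ n ∈ Finset.range N, (z : ℂ) ^ n‖ ^ 2 ∂ρ : ℝ) : ℂ) =
      ∑ n ∈ Finset.range N, ∑ m ∈ Finset.range N,
        ((μ.real ((((T.toEquiv : Equiv.Perm X) ^ (n : ℤ) : Equiv.Perm X) ⁻¹' A) ∩
        (((T.toEquiv : Equiv.Perm X) ^ (m : ℤ) : Equiv.Perm X) ⁻¹' A)) - μ.real A ^ 2 : ℝ) : ℂ) := by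
    rw [← integral_complex_ofReal]
    have h1 : ∀ z : Circle, ((‖∑ n ∈ Finset.range N, (z : ℂ) ^ n‖ ^ 2 : ℝ) : ℂ) =
        ∑ n ∈ Finset.range N, ∑ m ∈ Finset.range N,
          (z : ℂ) ^ (n : ℤ) * (starRingEnd ℂ) ((z : ℂ) ^ (m : ℤ)) := by
      intro z
      rw [Complex.ofReal_pow, ← Complex.mul_conj', map_sum, Finset.sum_mul_sum]
      simp only [zpow_natCast]
    simp_rw [h1]
    rw [integral_finsetSum _ fun n _ => integrable_finsetSum _ fun m _ => hint n m]
    refine Finset.sum_congr rfl fun n _ => ?_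
    rw [integral_finsetSum _ fun m _ => hint n m]
    refine Finset.sum_congr rfl fun m _ => ?_
    rw [hρ.integral_char_mul_conj hT, integral_centredIndicator_mul_conj hT hA]
  have hexp' : ∫ z : Circle, ‖∑ n ∈ Finset.range N, (z : ℂ) ^ n‖ ^ 2 ∂ρ =
      ∑ n ∈ Finset.range N, ∑ m ∈ Finset.range N,
        (μ.real ((((T.toEquiv : Equiv.Perm X) ^ (n : ℤ) : Equiv.Perm X) ⁻¹' A) ∩
        (((T.toEquiv : Equiv.Perm X) ^ (m : ℤ) : Equiv.Perm X) ⁻¹' A)) - μ.real A ^ 2) := by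
    exact_mod_cast hexp
  rw [hexp']
  -- Of the intersections only the diagonal one is kept; the others are nonnegative.
  have hrow : ∀ n ∈ Finset.range N, μ.real A - N * μ.real A ^ 2 ≤ ∑ m ∈ Finset.range N,
      (μ.real ((((T.toEquiv : Equiv.Perm X) ^ (n : ℤ) : Equiv.Perm X) ⁻¹' A) ∩
        (((T.toEquiv : Equiv.Perm X) ^ (m : ℤ) : Equiv.Perm X) ⁻¹' A)) - μ.real A ^ 2) := by
    intro n hn
    rw [Finset.sum_sub_distrib, Finset.sum_const, Finset.card_range, nsmul_eq_mul]
    gcongr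
    refine le_trans (le_of_eq ?_) (Finset.single_le_sum
      (f := fun m : ℕ => μ.real ((((T.toEquiv : Equiv.Perm X) ^ (n : ℤ) : Equiv.Perm X) ⁻¹' A) ∩
        (((T.toEquiv : Equiv.Perm X) ^ (m : ℤ) : Equiv.Perm X) ⁻¹' A)))
      (fun _ _ => measureReal_nonneg) hn)
    simp only [Set.inter_self]
    exact ((measurePreserving_zpow hT n).measureReal_preimage hA.nullMeasurableSet).symm
  calc N * μ.real A - N ^ 2 * μ.real A ^ 2
      = ∑ n ∈ Finset.range N, (μ.real A - N * μ.real A ^ 2) := by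
        rw [Finset.sum_const, Finset.card_range, nsmul_eq_mul]; ring
    _ ≤ _ := Finset.sum_le_sum hrow

/-- The total mass of the spectral measure of a centred indicator. -/
lemma IsSpectralMeasure.real_univ [IsProbabilityMeasure μ] (hT : MeasurePreserving T μ μ)
    {A : Set X} (hA : MeasurableSet A) {ρ : Measure Circle}
    (hρ : IsSpectralMeasure T μ (centredIndicator μ A) ρ) :
    ρ.real Set.univ = μ.real A - μ.real A ^ 2 := by
  have h2 := hρ.2 0
  have h3 := integral_centredIndicator_mul_conj hT hA 0 0
  simp only [zpow_zero, integral_const, Complex.real_smul, mul_one, Equiv.Perm.coe_one,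
    id_eq] at h2 h3
  rw [h3, Set.preimage_id, Set.inter_self] at h2
  exact_mod_cast h2

/-- The maximal spectral measure of a mixing transformation of a nontrivial space charges every
neighbourhood of the neutral element. -/
theorem IsMaximalSpectralMeasure.ne_zero_of_mem_nhds [IsProbabilityMeasure μ]
    (hT : MeasurePreserving T μ μ) (hmix : IsMixing T μ) {σ : Measure Circle}
    (hσ : IsMaximalSpectralMeasure T μ σ) {A : Set X} (hA : MeasurableSet A) (h0 : 0 < μ.real A)
    (h1 : μ.real A < 1) : ∀ U ∈ 𝓝 (1 : Circle), σ U ≠ 0 := by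
  intro U hU hσU
  obtain ⟨c, hc, hcU⟩ := Metric.mem_nhds_iff.1 hU
  -- If U were null, the geometric sum would be at most 2/c almost everywhere, and the second moment
  -- at most (4/c²) μ(B). Since N μ(B) < 1/2, it is at least N μ(B)/2. Hence N ≤ 8/c².
  obtain ⟨N, hN⟩ := exists_nat_gt (8 / c ^ 2)
  have hN0 : (0 : ℝ) < N := lt_of_le_of_lt (by positivity) hN
  obtain ⟨B, hB, hB0, hBN⟩ := hmix.exists_measure_small hT hA h0 h1
    (show (0 : ℝ) < 1 / (2 * N) by positivity)
  obtain ⟨ρ, hρ⟩ := exists_isSpectralMeasure hT (memLp_centredIndicator (μ := μ) hB)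
  have := hρ.1
  have hρσ := hσ.dominates _ ρ (isCentredL2_centredIndicator hB) hρ
  have hbound : ∀ᵐ z : Circle ∂ρ, ‖∑ n ∈ Finset.range N, (z : ℂ) ^ n‖ ^ 2 ≤ 4 / c ^ 2 := by
    have hz : ∀ᵐ z ∂ρ, z ∉ U := by
      rw [ae_iff]
      simpa using hρσ hσU
    filter_upwards [hz] with z hz
    have hcz : c ≤ ‖(z : ℂ) - 1‖ := by
      by_contra! h
      refine hz (hcU ?_)
      change dist (z : ℂ) 1 < c
      rwa [Complex.dist_eq]
    have h2 : ‖∑ n ∈ Finset.range N, (z : ℂ) ^ n‖ ≤ 2 / c := by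
      rw [le_div_iff₀ hc]
      exact (mul_le_mul_of_nonneg_left hcz (norm_nonneg _)).trans (norm_geom_sum_mul_le z N)
    calc ‖∑ n ∈ Finset.range N, (z : ℂ) ^ n‖ ^ 2 ≤ (2 / c) ^ 2 := by gcongr
      _ = 4 / c ^ 2 := by rw [div_pow]; norm_num
  have htot : ρ.real Set.univ ≤ μ.real B := by
    rw [hρ.real_univ hT hB]
    nlinarith [sq_nonneg (μ.real B)]
  have hupper : ∫ z : Circle, ‖∑ n ∈ Finset.range N, (z : ℂ) ^ n‖ ^ 2 ∂ρ ≤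
      4 / c ^ 2 * μ.real B := by
    calc ∫ z : Circle, ‖∑ n ∈ Finset.range N, (z : ℂ) ^ n‖ ^ 2 ∂ρ ≤ ∫ _z : Circle, 4 / c ^ 2 ∂ρ := by
          refine integral_mono_ae ?_ (integrable_const _) hbound
          exact Continuous.integrable_of_hasCompactSupport (by fun_prop)
            (HasCompactSupport.of_compactSpace _)
      _ = 4 / c ^ 2 * ρ.real Set.univ := by simp [mul_comm]
      _ ≤ _ := by gcongr
  have hlow := (le_integral_norm_geom_sum_sq hT hB hρ N).trans hupper
  have h5 : (N : ℝ) * μ.real B < 1 / 2 := by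
    rw [lt_div_iff₀ (by positivity)] at hBN
    linarith
  have h6 : (N : ℝ) - N * (N * μ.real B) ≤ 4 / c ^ 2 := by
    refine le_of_mul_le_mul_right ?_ hB0
    linarith
  have h7 : 8 / c ^ 2 = 2 * (4 / c ^ 2) := by ring
  have h8 : N * (N * μ.real B) ≤ (N : ℝ) * (1 / 2) := by gcongr
  linarith

end Koopman

/-! ### Second moments along asymptotically face independent measures. -/

section FaceIndependence

variable {X : Type*} [MeasurableSpace X] {ι J : Type*} [Fintype ι]

/-- Along `𝓕`, the measures `ν j` make all families of coordinates avoiding one index asymptotically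
independent with law `μ`. -/
def AsymptoticallyFaceIndependent (μ : Measure X) (ν : J → Measure (ι → X)) (𝓕 : Filter J) :
    Prop :=
  ∀ (i₀ : ι) (A : ι → Set X), (∀ i, MeasurableSet (A i)) → A i₀ = Set.univ →
    Tendsto (fun j => (ν j).real (Set.univ.pi A)) 𝓕 (𝓝 (∏ i, μ.real (A i)))

variable {μ : Measure X} {ν : J → Measure (ι → X)} {𝓕 : Filter J}

lemma SimpleFunc.eq_sum_indicator (s : SimpleFunc X ℂ) (x : X) :
    s x = ∑ c ∈ s.range, c * (s ⁻¹' {c}).indicator 1 x := by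
  rw [Finset.sum_eq_single (s x)]
  · simp
  · intro c _ hc
    rw [Set.indicator_of_notMem, mul_zero]
    simpa using fun h => hc h.symm
  · intro h
    simp at h

/-- The integral of a product of simple functions of the coordinates. -/
lemma integral_prod_simpleFunc_eq_sum {ν : Measure (ι → X)} [IsFiniteMeasure ν] [DecidableEq ι]
    (s : ι → SimpleFunc X ℂ) :
    ∫ x, ∏ i, s i (x i) ∂ν = ∑ c ∈ Fintype.piFinset fun i => (s i).range,
      (∏ i, c i) * ν.real (Set.univ.pi fun i => s i ⁻¹' {c i}) := by
  have hms : ∀ c : ι → ℂ, MeasurableSet (Set.univ.pi fun i => s i ⁻¹' {c i}) := fun c =>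
    MeasurableSet.univ_pi fun i => (s i).measurableSet_preimage _
  have h1 : ∀ x : ι → X, ∏ i, s i (x i) = ∑ c ∈ Fintype.piFinset fun i => (s i).range,
      (∏ i, c i) * (Set.univ.pi fun i => s i ⁻¹' {c i}).indicator 1 x := by
    intro x
    calc ∏ i, s i (x i) = ∏ i, ∑ c ∈ (s i).range, c * (s i ⁻¹' {c}).indicator 1 (x i) :=
          Finset.prod_congr rfl fun i _ => SimpleFunc.eq_sum_indicator (s i) (x i)
      _ = _ := by
          rw [Finset.prod_univ_sum]
          refine Finset.sum_congr rfl fun c _ => ?_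
          rw [Finset.prod_mul_distrib]
          congr 1
          by_cases hx : x ∈ Set.univ.pi fun i => s i ⁻¹' {c i}
          · rw [Set.indicator_of_mem hx]
            refine Finset.prod_eq_one fun i _ => ?_
            rw [Set.indicator_of_mem (hx i (Set.mem_univ i))]
            rfl
          · rw [Set.indicator_of_notMem hx]
            simp only [Set.mem_univ_pi, not_forall] at hx
            obtain ⟨i, hi⟩ := hx
            exact Finset.prod_eq_zero (Finset.mem_univ i) (Set.indicator_of_notMem hi _)
  simp_rw [h1]
  have hint : ∀ c : ι → ℂ, Integrable
      ((Set.univ.pi fun i => s i ⁻¹' {c i}).indicator (1 : (ι → X) → ℂ)) ν := fun c =>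
    (integrable_const (1 : ℂ)).indicator (hms c)
  rw [integral_finsetSum _ fun c _ => (hint c).const_mul _]
  refine Finset.sum_congr rfl fun c _ => ?_
  rw [integral_const_mul, integral_indicator_one_complex (hms c)]

lemma AsymptoticallyFaceIndependent.tendsto_integral_prod [IsFiniteMeasure μ]
    [∀ j, IsFiniteMeasure (ν j)]
    (h : AsymptoticallyFaceIndependent μ ν 𝓕) {f : ι → X → ℂ} (hm : ∀ i, Measurable (f i))
    (hf : ∀ i, (Set.range (f i)).Finite) (i₀ : ι) (h₀ : f i₀ = 1) :
    Tendsto (fun j => ∫ x, ∏ i, f i (x i) ∂ν j) 𝓕 (𝓝 (∏ i, ∫ x, f i x ∂μ)) := by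
  classical
  let s : ι → SimpleFunc X ℂ := fun i =>
    ⟨f i, fun c => hm i (measurableSet_singleton c), hf i⟩
  have hs : ∀ i, f i = s i := fun i => rfl
  simp_rw [hs, integral_prod_simpleFunc_eq_sum]
  have h1 : ∏ i, ∫ x, s i x ∂μ = ∑ c ∈ Fintype.piFinset fun i => (s i).range,
      (∏ i, c i) * ((∏ i, μ.real (s i ⁻¹' {c i}) : ℝ) : ℂ) := by
    calc ∏ i, ∫ x, s i x ∂μ = ∏ i, ∑ c ∈ (s i).range, c * ((μ.real (s i ⁻¹' {c}) : ℝ) : ℂ) := by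
          refine Finset.prod_congr rfl fun i _ => ?_
          rw [← SimpleFunc.integral_eq_integral _ (SimpleFunc.integrable_of_isFiniteMeasure (s i)),
            SimpleFunc.integral_eq]
          refine Finset.sum_congr rfl fun c _ => ?_
          rw [Complex.real_smul, mul_comm]
      _ = _ := by
          rw [Finset.prod_univ_sum]
          refine Finset.sum_congr rfl fun c _ => ?_
          rw [Finset.prod_mul_distrib, Complex.ofReal_prod]
  rw [h1]
  refine tendsto_finsetSum _ fun c hc => Tendsto.const_mul _ ?_
  refine (Complex.continuous_ofReal.tendsto _).comp ?_
  -- The function at i₀ is constantly 1, so its only nonempty level set is the whole space and face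
  -- independence applies.
  refine h i₀ _ (fun i => (s i).measurableSet_preimage _) ?_
  have hc0 : c i₀ ∈ (s i₀).range := Fintype.mem_piFinset.1 hc i₀
  obtain ⟨x, hx⟩ := SimpleFunc.mem_range.1 hc0
  rw [← hs, h₀] at hx
  ext y
  simp only [Set.mem_preimage, ← hs, h₀, Set.mem_singleton_iff, Set.mem_univ, iff_true, ← hx]
  rfl

variable {T : X ≃ᵐ X}

/-- `z ↦ ∑ φ_n ∏ z_i ^ E n i`. -/
noncomputable def trigPoly {N : Type*} (E : N → ι → ℤ) (φ : N →₀ ℂ) (z : ι → Circle) : ℂ :=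
  φ.sum fun n a => a * ∏ i, (z i : ℂ) ^ E n i

/-- `x ↦ ∑ φ_n ∏ f_i (T ^ E n i x_i)`. -/
noncomputable def translateSum {N : Type*} (T : X ≃ᵐ X) (f : ι → X → ℂ) (E : N → ι → ℤ)
    (φ : N →₀ ℂ) (x : ι → X) : ℂ :=
  φ.sum fun n a => a * ∏ i, f i (((T.toEquiv : Equiv.Perm X) ^ E n i : Equiv.Perm X) (x i))

/-- Expanding the square gives finitely many products of functions of single coordinates, trivial at
i₀. Their limits factor into correlations, which are Fourier coefficients of the ρ i. -/
theorem AsymptoticallyFaceIndependent.tendsto_integral_norm_sq [IsFiniteMeasure μ]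
    [∀ j, IsFiniteMeasure (ν j)] (hT : MeasurePreserving T μ μ)
    (h : AsymptoticallyFaceIndependent μ ν 𝓕) {f : ι → X → ℂ} (hm : ∀ i, Measurable (f i))
    (hf : ∀ i, (Set.range (f i)).Finite) (i₀ : ι) (h₀ : f i₀ = 1) {ρ : ι → Measure Circle}
    (hρ : ∀ i, IsSpectralMeasure T μ (f i) (ρ i)) {N : Type*} (E : N → ι → ℤ) (φ : N →₀ ℂ) :
    Tendsto (fun j => ∫ x, ‖translateSum T f E φ x‖ ^ 2 ∂ν j) 𝓕
      (𝓝 (∫ z, ‖trigPoly E φ z‖ ^ 2 ∂Measure.pi ρ)) := by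
  have hfin : ∀ i, IsFiniteMeasure (ρ i) := fun i => (hρ i).1
  -- the factors of the terms of the expanded square
  let F : N → N → ι → X → ℂ := fun n m i x =>
    f i (((T.toEquiv : Equiv.Perm X) ^ E n i : Equiv.Perm X) x) *
      (starRingEnd ℂ) (f i (((T.toEquiv : Equiv.Perm X) ^ E m i : Equiv.Perm X) x))
  have hFm : ∀ n m i, Measurable (F n m i) := fun n m i =>
    ((hm i).comp (measurable_zpow T _)).mul
      (Complex.continuous_conj.measurable.comp ((hm i).comp (measurable_zpow T _)))
  have hFf : ∀ n m i, (Set.range (F n m i)).Finite := fun n m i =>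
    ((hf i).image2 (fun a b => a * (starRingEnd ℂ) b) (hf i)).subset (by
      rintro _ ⟨x, rfl⟩
      exact ⟨_, Set.mem_range_self _, _, Set.mem_range_self _, rfl⟩)
  have hF0 : ∀ n m, F n m i₀ = 1 := by
    intro n m
    ext x
    simp [F, h₀]
  have hexp : ∀ x : ι → X, ((‖translateSum T f E φ x‖ ^ 2 : ℝ) : ℂ) =
      ∑ n ∈ φ.support, ∑ m ∈ φ.support, φ n * (starRingEnd ℂ) (φ m) * ∏ i, F n m i (x i) := by
    intro x
    rw [Complex.ofReal_pow, ← Complex.mul_conj', translateSum, Finsupp.sum, map_sum,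
      Finset.sum_mul_sum]
    refine Finset.sum_congr rfl fun n _ => Finset.sum_congr rfl fun m _ => ?_
    rw [map_mul, map_prod, mul_mul_mul_comm, ← Finset.prod_mul_distrib]
  have hexpz : ∀ z : ι → Circle, ((‖trigPoly E φ z‖ ^ 2 : ℝ) : ℂ) =
      ∑ n ∈ φ.support, ∑ m ∈ φ.support, φ n * (starRingEnd ℂ) (φ m) *
        ∏ i, ((z i : ℂ) ^ E n i * (starRingEnd ℂ) ((z i : ℂ) ^ E m i)) := by
    intro z
    rw [Complex.ofReal_pow, ← Complex.mul_conj', trigPoly, Finsupp.sum, map_sum,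
      Finset.sum_mul_sum]
    refine Finset.sum_congr rfl fun n _ => Finset.sum_congr rfl fun m _ => ?_
    rw [map_mul, map_prod, mul_mul_mul_comm, ← Finset.prod_mul_distrib]
  have hintF : ∀ j n m, Integrable (fun x : ι → X => ∏ i, F n m i (x i)) (ν j) := by
    intro j n m
    choose C hC using fun i => (hFf n m i).isBounded.exists_norm_le
    refine Integrable.of_bound (Measurable.aestronglyMeasurable ?_) (∏ i, C i)
      (Eventually.of_forall fun x => ?_)
    · exact Finset.measurable_prod _ fun i _ => (hFm n m i).comp (measurable_pi_apply i)
    · rw [norm_prod]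
      exact Finset.prod_le_prod (fun i _ => norm_nonneg _)
        fun i _ => hC i _ (Set.mem_range_self _)
  have hintz : ∀ n m, Integrable (fun z : ι → Circle =>
      ∏ i, ((z i : ℂ) ^ E n i * (starRingEnd ℂ) ((z i : ℂ) ^ E m i))) (Measure.pi ρ) := by
    intro n m
    refine Continuous.integrable_of_hasCompactSupport ?_ (HasCompactSupport.of_compactSpace _)
    refine continuous_finsetProd _ fun i _ => ?_
    exact ((circleChar (E n i)).continuous.comp (continuous_apply i)).mul
      (Complex.continuous_conj.comp ((circleChar (E m i)).continuous.comp (continuous_apply i)))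
  have hlim : Tendsto (fun j => ∑ n ∈ φ.support, ∑ m ∈ φ.support,
      φ n * (starRingEnd ℂ) (φ m) * ∫ x, ∏ i, F n m i (x i) ∂ν j) 𝓕
      (𝓝 (∑ n ∈ φ.support, ∑ m ∈ φ.support,
        φ n * (starRingEnd ℂ) (φ m) * ∏ i, ∫ x, F n m i x ∂μ)) :=
    tendsto_finsetSum _ fun n _ => tendsto_finsetSum _ fun m _ => Tendsto.const_mul _
      (h.tendsto_integral_prod (hFm n m) (hFf n m) i₀ (hF0 n m))
  have e1 : ∀ j, ((∫ x, ‖translateSum T f E φ x‖ ^ 2 ∂ν j : ℝ) : ℂ) =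
      ∑ n ∈ φ.support, ∑ m ∈ φ.support,
      φ n * (starRingEnd ℂ) (φ m) * ∫ x, ∏ i, F n m i (x i) ∂ν j := by
    intro j
    rw [← integral_complex_ofReal]
    simp_rw [hexp]
    rw [integral_finsetSum _ fun n _ => integrable_finsetSum _ fun m _ =>
      (hintF j n m).const_mul _]
    refine Finset.sum_congr rfl fun n _ => ?_
    rw [integral_finsetSum _ fun m _ => (hintF j n m).const_mul _]
    exact Finset.sum_congr rfl fun m _ => integral_const_mul _ _
  have e2 : ((∫ z, ‖trigPoly E φ z‖ ^ 2 ∂Measure.pi ρ : ℝ) : ℂ) =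
      ∑ n ∈ φ.support, ∑ m ∈ φ.support,
        φ n * (starRingEnd ℂ) (φ m) * ∏ i, ∫ x, F n m i x ∂μ := by
    rw [← integral_complex_ofReal]
    simp_rw [hexpz]
    rw [integral_finsetSum _ fun n _ => integrable_finsetSum _ fun m _ =>
      (hintz n m).const_mul _]
    refine Finset.sum_congr rfl fun n _ => ?_
    rw [integral_finsetSum _ fun m _ => (hintz n m).const_mul _]
    refine Finset.sum_congr rfl fun m _ => ?_
    rw [integral_const_mul, integral_fintype_prod_eq_prod
      (f := fun i (z : Circle) => (z : ℂ) ^ E n i * (starRingEnd ℂ) ((z : ℂ) ^ E m i))]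
    congr 1
    exact Finset.prod_congr rfl fun i _ => (hρ i).integral_char_mul_conj hT _ _
  simp_rw [← e1] at hlim
  rw [← e2] at hlim
  have := (Complex.continuous_re.tendsto _).comp hlim
  simpa [Function.comp_def] using this

end FaceIndependence

/-! ### Removing one factor from a correlation. -/

section Decoupling

variable {X : Type*} [MeasurableSpace X] {ι : Type*} {T : X ≃ᵐ X}
  {ν : Measure (ι → X)}

lemma measurePreserving_diagonal_zpow (hinv : ν.map (fun x i => T (x i)) = ν) (k : ℤ) :
    MeasurePreserving
      (fun (x : ι → X) i => ((T.toEquiv : Equiv.Perm X) ^ k : Equiv.Perm X) (x i)) ν ν := by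
  let D : (ι → X) ≃ᵐ (ι → X) := MeasurableEquiv.piCongrRight fun _ => T
  have hD : MeasurePreserving D ν ν := ⟨D.measurable, hinv⟩
  convert measurePreserving_zpow hD k using 1
  induction k with
  | zero => rfl
  | succ n ih =>
    ext x i
    rw [add_comm, zpow_add_apply, zpow_add_apply, ← ih]
    rfl
  | pred n ih =>
    ext x i
    rw [sub_eq_add_neg, add_comm, zpow_add_apply, zpow_add_apply, ← ih]
    rfl

/-- Cauchy-Schwarz with one factor bounded by 1, obtained from nonnegativity of the variance of ‖g‖.
-/
lemma sq_norm_integral_mul_le {Y : Type*} [MeasurableSpace Y] {m : Measure Y}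
    [IsProbabilityMeasure m] {f g : Y → ℂ} (hf : ∀ y, ‖f y‖ ≤ 1) (hg : AEStronglyMeasurable g m)
    {C : ℝ} (hC : ∀ y, ‖g y‖ ≤ C) : ‖∫ y, f y * g y ∂m‖ ^ 2 ≤ ∫ y, ‖g y‖ ^ 2 ∂m := by
  have hi : Integrable (fun y => ‖g y‖) m := (Integrable.of_bound hg C (Eventually.of_forall hC)).norm
  have hi2 : Integrable (fun y => ‖g y‖ ^ 2) m :=
    Integrable.of_bound (hg.norm.pow 2) (C ^ 2) (Eventually.of_forall fun y => by
      rw [norm_pow, norm_norm]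
      exact pow_le_pow_left₀ (norm_nonneg _) (hC y) 2)
  set c := ∫ y, ‖g y‖ ∂m with hc
  have h1 : ‖∫ y, f y * g y ∂m‖ ≤ c := by
    refine (norm_integral_le_integral_norm _).trans (integral_mono_of_nonneg
      (Eventually.of_forall fun _ => norm_nonneg _) hi (Eventually.of_forall fun y => ?_))
    simp only [norm_mul]
    exact mul_le_of_le_one_left (norm_nonneg _) (hf y)
  have h2 : 0 ≤ ∫ y, (‖g y‖ - c) ^ 2 ∂m := integral_nonneg fun y => sq_nonneg _
  have h3 : ∫ y, (‖g y‖ - c) ^ 2 ∂m = ∫ y, ‖g y‖ ^ 2 ∂m - c ^ 2 := by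
    have : ∀ y, (‖g y‖ - c) ^ 2 = ‖g y‖ ^ 2 - 2 * c * ‖g y‖ + c ^ 2 := fun y => by ring
    simp_rw [this]
    have hi3 : Integrable (fun y => ‖g y‖ ^ 2 - 2 * c * ‖g y‖) m := hi2.sub (hi.const_mul _)
    rw [integral_add hi3 (integrable_const _), integral_sub hi2 (hi.const_mul _),
      integral_const_mul, ← hc]
    simp
    ring
  calc ‖∫ y, f y * g y ∂m‖ ^ 2 ≤ c ^ 2 := pow_le_pow_left₀ (norm_nonneg _) h1 2
    _ ≤ _ := by linarith

variable [Fintype ι]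

lemma measurable_translateSum {N : Type*} {f : ι → X → ℂ} (hm : ∀ i, Measurable (f i))
    (E : N → ι → ℤ) (φ : N →₀ ℂ) : Measurable (translateSum T f E φ) := by
  unfold translateSum Finsupp.sum
  refine Finset.measurable_fun_sum _ fun n _ => Measurable.const_mul ?_ _
  exact Finset.measurable_fun_prod _ fun i _ =>
    (hm i).comp ((measurable_zpow T _).comp (measurable_pi_apply i))

/-- Correlations of a joining are bounded by second moments of products of which one factor is
dropped. -/
theorem sq_norm_sum_integral_le [DecidableEq ι] [IsProbabilityMeasure ν]
    (hinv : ν.map (fun x i => T (x i)) = ν) {f : ι → X → ℂ} (hm : ∀ i, Measurable (f i))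
    (hf : ∀ i x, ‖f i x‖ ≤ 1) {N : Type*} {E E' : N → ι → ℤ} {i₀ : ι} {c : N → ℤ}
    (hE : ∀ n i, i ≠ i₀ → E' n i = E n i + c n) (hE₀ : ∀ n, E n i₀ + c n = 0) (φ : N →₀ ℂ) :
    ‖φ.sum fun n a => a * ∫ x, ∏ i, f i (((T.toEquiv : Equiv.Perm X) ^ E n i : Equiv.Perm X)
      (x i)) ∂ν‖ ^ 2 ≤ ∫ x, ‖translateSum T (Function.update f i₀ 1) E' φ x‖ ^ 2 ∂ν := by
  set g := Function.update f i₀ 1 with hg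
  have hgm : ∀ i, Measurable (g i) := by
    intro i
    by_cases hi : i = i₀
    · subst hi; simp only [hg, Function.update_self]; exact measurable_one
    · simpa only [hg, Function.update_of_ne hi] using hm i
  have hg1 : ∀ i x, ‖g i x‖ ≤ 1 := by
    intro i x
    by_cases hi : i = i₀
    · subst hi; simp [hg]
    · simpa only [hg, Function.update_of_ne hi] using hf i x
  have hGm : ∀ n, Measurable fun x : ι → X =>
      ∏ i, g i (((T.toEquiv : Equiv.Perm X) ^ E' n i : Equiv.Perm X) (x i)) := fun n =>
    Finset.measurable_fun_prod _ fun i _ =>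
      (hgm i).comp ((measurable_zpow T _).comp (measurable_pi_apply i))
  have hG1 : ∀ n (x : ι → X),
      ‖∏ i, g i (((T.toEquiv : Equiv.Perm X) ^ E' n i : Equiv.Perm X) (x i))‖ ≤ 1 := by
    intro n x
    rw [norm_prod]
    exact Finset.prod_le_one (fun i _ => norm_nonneg _) fun i _ => hg1 i _
  have hfG : ∀ n, Integrable (fun x : ι → X => f i₀ (x i₀) *
      ∏ i, g i (((T.toEquiv : Equiv.Perm X) ^ E' n i : Equiv.Perm X) (x i))) ν := by
    intro n
    refine Integrable.of_bound (((hm i₀).comp (measurable_pi_apply i₀)).mul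
      (hGm n)).aestronglyMeasurable 1 (Eventually.of_forall fun x => ?_)
    rw [norm_mul]
    exact mul_le_one₀ (hf _ _) (norm_nonneg _) (hG1 n x)
  -- Applying T^{c n} diagonally makes the exponent at i₀ vanish in every term, so f i₀ (x i₀)
  -- becomes a common factor of the whole sum.
  have hshift : ∀ n, ∫ x, ∏ i, f i (((T.toEquiv : Equiv.Perm X) ^ E n i : Equiv.Perm X)
      (x i)) ∂ν = ∫ x, f i₀ (x i₀) *
        ∏ i, g i (((T.toEquiv : Equiv.Perm X) ^ E' n i : Equiv.Perm X) (x i)) ∂ν := by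
    intro n
    have hpres := measurePreserving_diagonal_zpow hinv (c n)
    have hmeas : AEStronglyMeasurable (fun x : ι → X =>
        ∏ i, f i (((T.toEquiv : Equiv.Perm X) ^ E n i : Equiv.Perm X) (x i)))
        (ν.map fun (x : ι → X) i => ((T.toEquiv : Equiv.Perm X) ^ c n : Equiv.Perm X) (x i)) :=
      (Finset.measurable_fun_prod _ fun i _ =>
        (hm i).comp ((measurable_zpow T _).comp (measurable_pi_apply i))).aestronglyMeasurable
    conv_lhs => rw [← hpres.map_eq, integral_map hpres.measurable.aemeasurable hmeas]
    refine integral_congr_ae (Eventually.of_forall fun x => ?_)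
    simp only [← zpow_add_apply]
    rw [← Finset.mul_prod_erase _ _ (Finset.mem_univ i₀),
      ← Finset.mul_prod_erase Finset.univ (fun i => g i _) (Finset.mem_univ i₀), hE₀ n]
    have : g i₀ (((T.toEquiv : Equiv.Perm X) ^ E' n i₀ : Equiv.Perm X) (x i₀)) = 1 := by
      simp [hg]
    rw [this, one_mul]
    congr 1
    refine Finset.prod_congr rfl fun i hi => ?_
    have hne := Finset.ne_of_mem_erase hi
    rw [hE n i hne, hg, Function.update_of_ne hne]
  have hsum : (φ.sum fun n a => a * ∫ x, ∏ i, f i (((T.toEquiv : Equiv.Perm X) ^ E n i :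
      Equiv.Perm X) (x i)) ∂ν) = ∫ x, f i₀ (x i₀) * translateSum T g E' φ x ∂ν := by
    simp_rw [hshift]
    simp only [translateSum, Finsupp.sum, Finset.mul_sum]
    rw [integral_finsetSum]
    · refine Finset.sum_congr rfl fun n _ => ?_
      rw [← integral_const_mul]
      congr 1
      ext x
      ring
    · intro n _
      refine ((hfG n).const_mul (φ n)).congr (Eventually.of_forall fun x => ?_)
      simp only
      ring
  rw [hsum]
  refine sq_norm_integral_mul_le (fun x => hf _ _)
    (measurable_translateSum hgm E' φ).aestronglyMeasurable
    (C := φ.sum fun _ a => ‖a‖) (fun x => ?_)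
  refine (norm_sum_le _ _).trans (Finset.sum_le_sum fun n _ => ?_)
  rw [norm_mul]
  exact mul_le_of_le_one_right (norm_nonneg _) (hG1 n x)

end Decoupling

/-! ### Approximation by trigonometric polynomials on the torus. -/

section TorusPolynomials

/-- The character `(u, v) ↦ u ^ n₁ v ^ n₂` of the torus. -/
noncomputable def torusChar (n : ℤ × ℤ) : C(Circle × Circle, ℂ) :=
  (circleChar n.1).comp ContinuousMap.fst * (circleChar n.2).comp ContinuousMap.snd

lemma torusChar_apply (n : ℤ × ℤ) (p : Circle × Circle) :
    torusChar n p = (p.1 : ℂ) ^ n.1 * (p.2 : ℂ) ^ n.2 := rfl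

/-- The trigonometric polynomials on the torus. -/
noncomputable def torusSubalgebra : StarSubalgebra ℂ C(Circle × Circle, ℂ) where
  toSubalgebra := Algebra.adjoin ℂ (Set.range torusChar)
  star_mem' := by
    change Algebra.adjoin ℂ (Set.range torusChar) ≤ star (Algebra.adjoin ℂ (Set.range torusChar))
    refine Algebra.adjoin_le ?_
    rintro - ⟨n, rfl⟩
    refine Algebra.subset_adjoin ⟨-n, ?_⟩
    ext p
    simp only [torusChar_apply, ContinuousMap.star_apply, Prod.fst_neg, Prod.snd_neg, star_mul',
      Complex.star_def, map_zpow₀, ← Circle.coe_inv_eq_conj, Circle.coe_inv, inv_zpow, zpow_neg]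

lemma torusSubalgebra_coe : Subalgebra.toSubmodule torusSubalgebra.toSubalgebra =
    Submodule.span ℂ (Set.range torusChar) := by
  apply Algebra.adjoin_eq_span_of_subset
  refine Set.Subset.trans ?_ Submodule.subset_span
  intro x hx
  refine Submonoid.closure_induction (fun _ => id) ⟨0, ?_⟩ ?_ hx
  · ext p
    simp [torusChar_apply]
  · rintro - - - - ⟨m, rfl⟩ ⟨n, rfl⟩
    refine ⟨m + n, ?_⟩
    ext p
    simp only [torusChar_apply, ContinuousMap.mul_apply, Prod.fst_add, Prod.snd_add,
      zpow_add₀ (Circle.coe_ne_zero _)]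
    ring

lemma torusSubalgebra_separatesPoints : torusSubalgebra.SeparatesPoints := by
  intro x y hxy
  by_cases h : x.1 = y.1
  · refine ⟨_, ⟨torusChar (0, 1), Algebra.subset_adjoin ⟨_, rfl⟩, rfl⟩, ?_⟩
    simp only [torusChar_apply, zpow_zero, one_mul, zpow_one]
    exact fun h' => hxy (Prod.ext h (Subtype.ext h'))
  · refine ⟨_, ⟨torusChar (1, 0), Algebra.subset_adjoin ⟨_, rfl⟩, rfl⟩, ?_⟩
    simp only [torusChar_apply, zpow_zero, mul_one, zpow_one]
    exact fun h' => h (Subtype.ext h')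

/-- The trigonometric polynomial with given coefficients. -/
noncomputable def torusPoly : (ℤ × ℤ →₀ ℂ) →ₗ[ℂ] C(Circle × Circle, ℂ) :=
  Finsupp.linearCombination ℂ torusChar

/-- Trigonometric polynomials are uniformly dense on the torus. -/
lemma exists_norm_sub_linearCombination_lt (g : C(Circle × Circle, ℂ)) {δ : ℝ} (hδ : 0 < δ) :
    ∃ φ : ℤ × ℤ →₀ ℂ, ‖g - torusPoly φ‖ < δ := by
  have h1 := ContinuousMap.starSubalgebra_topologicalClosure_eq_top_of_separatesPoints
    torusSubalgebra torusSubalgebra_separatesPoints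
  have h2 : g ∈ closure (torusSubalgebra : Set C(Circle × Circle, ℂ)) := by
    have : g ∈ torusSubalgebra.topologicalClosure := h1 ▸ StarSubalgebra.mem_top
    exact this
  obtain ⟨f, hf, hfg⟩ := Metric.mem_closure_iff.1 h2 δ hδ
  have h3 : f ∈ Submodule.span ℂ (Set.range torusChar) := by
    rw [← torusSubalgebra_coe]; exact hf
  obtain ⟨φ, hφ⟩ := Finsupp.mem_span_range_iff_exists_finsupp.1 h3
  refine ⟨φ, ?_⟩
  rw [torusPoly, Finsupp.linearCombination_apply, hφ, ← dist_eq_norm]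
  exact hfg

open scoped ENNReal in
/-- Trigonometric polynomials are dense in `L²`. -/
lemma exists_eLpNorm_indicator_sub_le (M : Measure (Circle × Circle)) [IsFiniteMeasure M]
    {S : Set (Circle × Circle)} (hS : MeasurableSet S) {ε : ℝ≥0∞} (hε : ε ≠ 0) :
    ∃ φ : ℤ × ℤ →₀ ℂ, eLpNorm (S.indicator (1 : Circle × Circle → ℂ) -
      ⇑(torusPoly φ)) 2 M ≤ ε := by
  have hmem : MemLp (S.indicator (1 : Circle × Circle → ℂ)) 2 M :=
    (memLp_const (1 : ℂ)).indicator hS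
  obtain ⟨g, hg, -⟩ := hmem.exists_boundedContinuous_eLpNorm_sub_le (by finiteness)
    (ε := ε / 2) (by simpa using hε)
  have hC : ∃ δ : ℝ, 0 < δ ∧ M Set.univ ^ (2 : ℝ≥0∞).toReal⁻¹ * ENNReal.ofReal δ ≤ ε / 2 := by
    have hlim : Tendsto (fun δ : ℝ => M Set.univ ^ (2 : ℝ≥0∞).toReal⁻¹ * ENNReal.ofReal δ)
        (𝓝[>] 0) (𝓝 (M Set.univ ^ (2 : ℝ≥0∞).toReal⁻¹ * ENNReal.ofReal 0)) := by
      refine ENNReal.Tendsto.const_mul ?_ (Or.inr ?_)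
      · exact (ENNReal.continuous_ofReal.tendsto 0).mono_left nhdsWithin_le_nhds
      · exact ENNReal.rpow_ne_top_of_nonneg (by positivity) (measure_ne_top _ _)
    rw [ENNReal.ofReal_zero, mul_zero] at hlim
    have hε2 : (0 : ℝ≥0∞) < ε / 2 := by
      rw [pos_iff_ne_zero]; simpa using hε
    obtain ⟨δ, h1, h2⟩ := ((hlim.eventually (ge_mem_nhds hε2)).and self_mem_nhdsWithin).exists
    exact ⟨δ, h2, h1⟩
  obtain ⟨δ, hδ, hδε⟩ := hC
  obtain ⟨φ, hφ⟩ := exists_norm_sub_linearCombination_lt (g : C(Circle × Circle, ℂ)) hδ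
  refine ⟨φ, ?_⟩
  have hb : eLpNorm ((g : Circle × Circle → ℂ) -
      ⇑(torusPoly φ)) 2 M ≤ ε / 2 := by
    refine (eLpNorm_le_of_ae_bound (C := δ) (Eventually.of_forall fun p => ?_)).trans hδε
    exact (ContinuousMap.norm_coe_le_norm ((g : C(Circle × Circle, ℂ)) -
      torusPoly φ) p).trans hφ.le
  calc eLpNorm (S.indicator (1 : Circle × Circle → ℂ) -
        ⇑(torusPoly φ)) 2 M
      = eLpNorm ((S.indicator (1 : Circle × Circle → ℂ) - ⇑g) + ((g : Circle × Circle → ℂ) -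
        ⇑(torusPoly φ))) 2 M := by
        rw [sub_add_sub_cancel]
    _ ≤ ε / 2 + ε / 2 := by
        refine (eLpNorm_add_le ?_ ?_ (by norm_num)).trans (add_le_add hg hb)
        · exact hmem.1.sub g.continuous.aestronglyMeasurable
        · exact g.continuous.aestronglyMeasurable.sub
            (ContinuousMap.continuous _).aestronglyMeasurable
    _ = ε := ENNReal.add_halves ε

/-- Three finite measures without common part live on the complements of the members of a
partition. -/
lemma exists_partition_of_no_common_part {Y : Type*} [MeasurableSpace Y] (M : Fin 3 → Measure Y)
    [∀ k, IsFiniteMeasure (M k)]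
    (h : ∀ ρ : Measure Y, IsFiniteMeasure ρ → (∀ k, ρ ≪ M k) → ρ = 0) :
    ∃ S₀ S₁ : Set Y, MeasurableSet S₀ ∧ MeasurableSet S₁ ∧ Disjoint S₀ S₁ ∧ M 0 S₀ = 0 ∧
      M 1 S₁ = 0 ∧ M 2 (S₀ ∪ S₁)ᶜ = 0 := by
  set N := ∑ k, M k with hN
  have hle : ∀ k, M k ≤ N := fun k =>
    Finset.single_le_sum (f := M) (fun _ _ => bot_le) (Finset.mem_univ k)
  set r : Fin 3 → Y → ENNReal := fun k => (M k).rnDeriv N with hr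
  have hrm : ∀ k, Measurable (r k) := fun k => Measure.measurable_rnDeriv _ _
  have hMk : ∀ k B, M k B = 0 ↔ N ({y | r k y ≠ 0} ∩ B) = 0 := by
    intro k B
    rw [← withDensity_apply_eq_zero (hrm k),
      Measure.withDensity_rnDeriv_eq _ _ (Measure.absolutelyContinuous_of_le (hle k))]
  have hrs : ∀ k, MeasurableSet {y | r k y ≠ 0} := fun k =>
    hrm k (measurableSet_singleton 0).compl
  have hz : ∀ k, MeasurableSet {y | r k y = 0} := fun k => hrm k (measurableSet_singleton 0)
  set R : Set Y := ⋂ k, {y | r k y ≠ 0} with hR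
  have hRm : MeasurableSet R := MeasurableSet.iInter hrs
  -- Where all three densities are nonzero, `N` is dominated by each `M k`, so its restriction is a
  -- common part.
  have hR0 : N R = 0 := by
    have h0 := h (N.restrict R) inferInstance (fun k B hB => ?_)
    · exact Measure.restrict_eq_zero.1 h0
    · refine nonpos_iff_eq_zero.1 ?_
      have hB' := (hMk k B).1 hB
      rw [Measure.restrict_apply' hRm]
      calc N (B ∩ R) ≤ N ({y | r k y ≠ 0} ∩ B) :=
            measure_mono fun y hy => ⟨Set.mem_iInter.1 hy.2 k, hy.1⟩
        _ ≤ 0 := hB'.le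
  refine ⟨{y | r 0 y = 0}, {y | r 1 y = 0} \ {y | r 0 y = 0}, hz 0, (hz 1).diff (hz 0),
    Set.disjoint_sdiff_right, ?_, ?_, ?_⟩
  · rw [hMk]
    convert measure_empty (μ := N)
    ext y; simp
  · rw [hMk]
    convert measure_empty (μ := N)
    ext y
    simp only [Set.mem_inter_iff, Set.mem_sdiff, Set.mem_ofPred_eq, Set.mem_empty_iff_false, iff_false]
    tauto
  · rw [hMk]
    refine measure_mono_null (fun y hy => ?_) hR0
    simp only [Set.mem_inter_iff, Set.mem_compl_iff, Set.mem_union, Set.mem_sdiff,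
      Set.mem_ofPred_eq] at hy
    refine Set.mem_iInter.2 fun k => ?_
    fin_cases k <;> simp <;> tauto

open scoped ENNReal in
/-- For three finite measures on the torus without common part, the constant function is a sum of
three trigonometric polynomials which are small in the respective `L²`-spaces. -/
theorem exists_trigPoly_decomposition (M : Fin 3 → Measure (Circle × Circle))
    [∀ k, IsFiniteMeasure (M k)]
    (h : ∀ ρ : Measure (Circle × Circle), IsFiniteMeasure ρ → (∀ k, ρ ≪ M k) → ρ = 0)
    {ε : ℝ≥0∞} (hε : ε ≠ 0) :
    ∃ φ : Fin 3 → ℤ × ℤ →₀ ℂ, φ 0 + φ 1 + φ 2 = Finsupp.single 0 1 ∧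
      ∀ k, eLpNorm (torusPoly (φ k)) 2 (M k)
        ≤ ε := by
  obtain ⟨S₀, S₁, hS₀, hS₁, hd, h0, h1, h2⟩ := exists_partition_of_no_common_part M h
  set N := ∑ k, M k with hN
  have hle : ∀ k, M k ≤ N := fun k =>
    Finset.single_le_sum (f := M) (fun _ _ => bot_le) (Finset.mem_univ k)
  have hNfin : IsFiniteMeasure N := by rw [hN]; infer_instance
  -- Approximation in L² of the sum of the measures controls all three norms at once.
  obtain ⟨φ₀, hφ₀⟩ := exists_eLpNorm_indicator_sub_le N hS₀ (ε := ε / 2) (by simpa using hε)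
  obtain ⟨φ₁, hφ₁⟩ := exists_eLpNorm_indicator_sub_le N hS₁ (ε := ε / 2) (by simpa using hε)
  let P : (ℤ × ℤ →₀ ℂ) → C(Circle × Circle, ℂ) := torusPoly
  have hms : ∀ (S : Set (Circle × Circle)) (φ : ℤ × ℤ →₀ ℂ), MeasurableSet S → ∀ m : Measure _,
      AEStronglyMeasurable (S.indicator (1 : Circle × Circle → ℂ) - ⇑(P φ)) m :=
    fun S φ hS m => ((measurable_one.indicator hS).aestronglyMeasurable).sub
      (P φ).continuous.aestronglyMeasurable
  have hnull : ∀ (S : Set (Circle × Circle)) (φ : ℤ × ℤ →₀ ℂ) (m : Measure (Circle × Circle)),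
      m S = 0 → eLpNorm (P φ) 2 m =
        eLpNorm (S.indicator (1 : Circle × Circle → ℂ) - ⇑(P φ)) 2 m := by
    intro S φ m hS
    rw [← eLpNorm_neg]
    refine eLpNorm_congr_ae ?_
    have : ∀ᵐ p ∂m, p ∉ S := measure_eq_zero_iff_ae_notMem.1 hS
    filter_upwards [this] with p hp
    simp [Set.indicator_of_notMem hp]
  have hP2 : P (Finsupp.single 0 1 - φ₀ - φ₁) = 1 - P φ₀ - P φ₁ := by
    simp only [P, torusPoly, map_sub, Finsupp.linearCombination_single, one_smul]
    congr 2
    ext p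
    simp [torusChar_apply]
  -- The third polynomial is the remainder of 1. As `M 2` lives on S₀ ∪ S₁, there it is the sum of
  -- the two approximation errors.
  refine ⟨![φ₀, φ₁, Finsupp.single 0 1 - φ₀ - φ₁], by simp, fun k => ?_⟩
  fin_cases k
  · change eLpNorm (P φ₀) 2 (M 0) ≤ ε
    rw [hnull S₀ φ₀ _ h0]
    exact ((eLpNorm_mono_measure _ (hle 0)).trans hφ₀).trans ENNReal.half_le_self
  · change eLpNorm (P φ₁) 2 (M 1) ≤ ε
    rw [hnull S₁ φ₁ _ h1]
    exact ((eLpNorm_mono_measure _ (hle 1)).trans hφ₁).trans ENNReal.half_le_self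
  · change eLpNorm (P (Finsupp.single 0 1 - φ₀ - φ₁)) 2 (M 2) ≤ ε
    have he : (P (Finsupp.single 0 1 - φ₀ - φ₁) : Circle × Circle → ℂ) =ᵐ[M 2]
        (S₀.indicator (1 : Circle × Circle → ℂ) - ⇑(P φ₀)) +
          (S₁.indicator (1 : Circle × Circle → ℂ) - ⇑(P φ₁)) := by
      have : ∀ᵐ p ∂M 2, p ∉ (S₀ ∪ S₁)ᶜ := measure_eq_zero_iff_ae_notMem.1 h2
      filter_upwards [this] with p hp
      rw [Set.notMem_compl_iff, Set.mem_union] at hp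
      rw [hP2]
      rcases hp with hp | hp
      · have hp' : p ∉ S₁ := Set.disjoint_left.1 hd hp
        simp [hp, hp']; ring
      · have hp' : p ∉ S₀ := Set.disjoint_right.1 hd hp
        simp [hp, hp']; ring
    rw [eLpNorm_congr_ae he]
    calc _ ≤ ε / 2 + ε / 2 := (eLpNorm_add_le (hms _ _ hS₀ _) (hms _ _ hS₁ _) (by norm_num)).trans
          (add_le_add ((eLpNorm_mono_measure _ (hle 2)).trans hφ₀)
            ((eLpNorm_mono_measure _ (hle 2)).trans hφ₁))
      _ = ε := ENNReal.add_halves ε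

lemma integral_norm_sq_eq_eLpNorm {Y : Type*} [MeasurableSpace Y] {m : Measure Y} {f : Y → ℂ}
    (hf : AEStronglyMeasurable f m) : ∫ y, ‖f y‖ ^ 2 ∂m = (eLpNorm f 2 m).toReal ^ 2 := by
  rw [integral_eq_lintegral_of_nonneg_ae (Eventually.of_forall fun y => sq_nonneg _)
    (hf.norm.pow 2), ← ENNReal.toReal_pow]
  congr 1
  have h := eLpNorm_nnreal_pow_eq_lintegral (f := f) (μ := m) (p := 2) (by norm_num)
  simp only [NNReal.coe_ofNat, ENNReal.rpow_ofNat, ENNReal.coe_ofNat] at h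
  rw [h]
  refine lintegral_congr fun y => ?_
  rw [ENNReal.ofReal_pow (norm_nonneg _), ofReal_norm]

end TorusPolynomials

/-! ### Correlations bounded by L² norms on the torus. -/

section Decoupling

variable {X : Type*} [MeasurableSpace X] {T : X ≃ᵐ X} {μ : Measure X}

lemma isSpectralMeasure_one [IsProbabilityMeasure μ] :
    IsSpectralMeasure T μ (1 : X → ℂ) (Measure.dirac 1) :=
  ⟨inferInstance, fun n => by simp [integral_dirac]⟩

lemma finite_range_centredIndicator (A : Set X) : (Set.range (centredIndicator μ A)).Finite := by
  refine (Set.toFinite {1 - (μ.real A : ℂ), 0 - (μ.real A : ℂ)}).subset ?_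
  rintro _ ⟨x, rfl⟩
  by_cases hx : x ∈ A <;> simp [centredIndicator, hx]

/-- Splitting off one coordinate of a product measure. -/
lemma pi_map_coordinate_prod {n : ℕ} (ρ : Fin (n + 1) → Measure Circle) [∀ i, IsFiniteMeasure (ρ i)]
    (a : Fin (n + 1)) {F : (Fin n → Circle) → Circle} (hF : Measurable F) :
    (Measure.pi ρ).map (fun z => (z a, F fun j => z (a.succAbove j))) =
      (ρ a).prod ((Measure.pi fun j => ρ (a.succAbove j)).map F) := by
  have h1 := (measurePreserving_piFinSuccAbove ρ a).map_eq
  have h2 : (fun z : Fin (n + 1) → Circle => (z a, F fun j => z (a.succAbove j))) =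
      Prod.map id F ∘ MeasurableEquiv.piFinSuccAbove (fun _ => Circle) a := rfl
  rw [h2, ← Measure.map_map (measurable_id.prodMap hF) (MeasurableEquiv.measurable _), h1,
    ← Measure.map_prod_map _ _ measurable_id hF, Measure.map_id]

variable {ι J : Type*} [Fintype ι] [DecidableEq ι] {ν : J → Measure (ι → X)} {𝓕 : Filter J}

/-- A combination of correlations is asymptotically bounded by the `L²`-norm of the trigonometric
polynomial with the same coefficients. -/
lemma AsymptoticallyFaceIndependent.eventually_norm_sum_integral_lt [IsFiniteMeasure μ]
    [∀ j, IsProbabilityMeasure (ν j)] (hT : MeasurePreserving T μ μ)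
    (hinv : ∀ j, (ν j).map (fun x i => T (x i)) = ν j)
    (h : AsymptoticallyFaceIndependent μ ν 𝓕) {f : ι → X → ℂ} (hm : ∀ i, Measurable (f i))
    (hr : ∀ i, (Set.range (f i)).Finite) (hf : ∀ i x, ‖f i x‖ ≤ 1) {i₀ : ι}
    {ρ : ι → Measure Circle}
    (hρ : ∀ i, IsSpectralMeasure T μ (Function.update f i₀ 1 i) (ρ i))
    {E E' : ℤ × ℤ → ι → ℤ} {c : ℤ × ℤ → ℤ}
    (hE : ∀ n i, i ≠ i₀ → E' n i = E n i + c n) (hE₀ : ∀ n, E n i₀ + c n = 0)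
    {π : (ι → Circle) → Circle × Circle} (hπm : Measurable π)
    (hπ : ∀ n z, ∏ i, (z i : ℂ) ^ E' n i = torusChar n (π z)) (φ : ℤ × ℤ →₀ ℂ) {ε : ℝ}
    (hε : 0 < ε)
    (hφ : eLpNorm (torusPoly φ) 2 ((Measure.pi ρ).map π) ≤ ENNReal.ofReal ε) :
    ∀ᶠ j in 𝓕, ‖φ.sum fun n a => a * ∫ x, ∏ i,
      f i (((T.toEquiv : Equiv.Perm X) ^ E n i : Equiv.Perm X) (x i)) ∂ν j‖ < 2 * ε := by
  have hgm : ∀ i, Measurable (Function.update f i₀ 1 i) := by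
    intro i
    by_cases hi : i = i₀
    · subst hi; simp only [Function.update_self]; exact measurable_one
    · simpa only [Function.update_of_ne hi] using hm i
  have hgr : ∀ i, (Set.range (Function.update f i₀ 1 i)).Finite := by
    intro i
    by_cases hi : i = i₀
    · subst hi; simp only [Function.update_self]; exact Set.finite_range_const
    · simpa only [Function.update_of_ne hi] using hr i
  have hlim := h.tendsto_integral_norm_sq hT hgm hgr i₀ (Function.update_self _ _ _) hρ E' φ
  have htrig : ∀ z, trigPoly E' φ z = torusPoly φ (π z) := by
    intro z
    simp only [trigPoly, hπ, torusPoly, Finsupp.linearCombination_apply, Finsupp.sum]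
    rw [ContinuousMap.coe_sum, Finset.sum_apply]
    rfl
  -- The norm is only known to be at most ε; the factor 2 gives the strict inequality that persists
  -- near the limit.
  have hint : ∫ z, ‖trigPoly E' φ z‖ ^ 2 ∂Measure.pi ρ < (2 * ε) ^ 2 := by
    simp_rw [htrig]
    rw [← integral_map (f := fun p => ‖torusPoly φ p‖ ^ 2) hπm.aemeasurable
      (Continuous.aestronglyMeasurable (by fun_prop)),
      integral_norm_sq_eq_eLpNorm (torusPoly φ).continuous.aestronglyMeasurable]
    have h1 := ENNReal.toReal_le_of_le_ofReal hε.le hφ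
    exact pow_lt_pow_left₀ (h1.trans_lt (by linarith)) ENNReal.toReal_nonneg two_ne_zero
  filter_upwards [hlim.eventually (gt_mem_nhds hint)] with j hj
  have h2 := sq_norm_sum_integral_le (hinv j) hm hf hE hE₀ φ
  exact lt_of_pow_lt_pow_left₀ 2 (by positivity) (h2.trans_lt hj)

end Decoupling

/-! ### Vanishing of correlations. -/

section SingularPowers

variable {X : Type*} [MeasurableSpace X] {T : X ≃ᵐ X} {μ : Measure X} [IsProbabilityMeasure μ]
  {J : Type*} {q : ℕ} {ν : J → Measure (Fin (q + 3) → X)} [∀ j, IsProbabilityMeasure (ν j)]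
  {𝓕 : Filter J} {σ : Measure Circle}

/-- Correlations of centred indicators along asymptotically face independent joinings vanish in the
limit. -/
theorem AsymptoticallyFaceIndependent.tendsto_integral_centredIndicator
    (hT : MeasurePreserving T μ μ) (hmix : IsMixing T μ) (hσ : IsMaximalSpectralMeasure T μ σ)
    {m n : ℕ} (hm : 1 ≤ m) (hn : 1 ≤ n) (hsing : convPow σ m ⟂ₘ convPow σ n)
    (hinv : ∀ j, (ν j).map (fun x i => T (x i)) = ν j)
    (h : AsymptoticallyFaceIndependent μ ν 𝓕) {A : Fin (q + 3) → Set X}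
    (hA : ∀ i, MeasurableSet (A i)) :
    Tendsto (fun j => ∫ x, ∏ i, centredIndicator μ (A i) (x i) ∂ν j) 𝓕 (𝓝 0) := by
  have := hσ.isFinite
  set f : Fin (q + 3) → X → ℂ := fun i => centredIndicator μ (A i) with hf
  choose ρ hρ using fun i => exists_isSpectralMeasure hT (memLp_centredIndicator (μ := μ) (hA i))
  have hρfin : ∀ i, IsFiniteMeasure (ρ i) := fun i => (hρ i).1
  set ρ' : Fin (q + 3) → Fin (q + 3) → Measure Circle :=
    fun i₀ => Function.update ρ i₀ (Measure.dirac 1) with hρ'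
  have hspec : ∀ i₀ i, IsSpectralMeasure T μ (Function.update f i₀ 1 i) (ρ' i₀ i) := by
    intro i₀ i
    by_cases hi : i = i₀
    · subst hi
      simp only [hρ', Function.update_self]
      exact isSpectralMeasure_one
    · simpa only [hρ', Function.update_of_ne hi] using hρ i
  have hρ'fin : ∀ i₀ i, IsFiniteMeasure (ρ' i₀ i) := fun i₀ i => (hspec i₀ i).1
  have h01 : (0 : Fin (q + 3)) ≠ 1 := by simp
  have h02 : (0 : Fin (q + 3)) ≠ 2 := by
    simp [Fin.ext_iff, Nat.mod_eq_of_lt (show 2 < q + 3 by omega)]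
  have h12 : (1 : Fin (q + 3)) ≠ 2 := by
    simp [Fin.ext_iff, Nat.mod_eq_of_lt (show 2 < q + 3 by omega)]
  let π₀ : (Fin (q + 3) → Circle) → Circle × Circle := fun z => (z 0, z 1)
  let π₁ : (Fin (q + 3) → Circle) → Circle × Circle := fun z => (z 0, (∏ i, z i)⁻¹)
  let π₂ : (Fin (q + 3) → Circle) → Circle × Circle := fun z => ((∏ i, z i)⁻¹, z 1)
  have hprod : Measurable fun z : Fin (q + 3) → Circle => ∏ i, z i := by fun_prop
  have hprod' : Measurable fun z : Fin (q + 2) → Circle => ∏ i, z i := by fun_prop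
  have hπ₀ : Measurable π₀ := by fun_prop
  have hπ₁ : Measurable π₁ := by fun_prop
  have hπ₂ : Measurable π₂ := by fun_prop
  -- `M k` belongs to the removal of coordinate 2 - k, whose spectral measure is replaced by the
  -- unit mass at 1.
  let M : Fin 3 → Measure (Circle × Circle) :=
    ![(Measure.pi (ρ' 2)).map π₀, (Measure.pi (ρ' 1)).map π₁, (Measure.pi (ρ' 0)).map π₂]
  have hMfin : ∀ k, IsFiniteMeasure (M k) := by
    intro k
    fin_cases k
    · exact inferInstanceAs (IsFiniteMeasure ((Measure.pi (ρ' 2)).map π₀))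
    · exact inferInstanceAs (IsFiniteMeasure ((Measure.pi (ρ' 1)).map π₁))
    · exact inferInstanceAs (IsFiniteMeasure ((Measure.pi (ρ' 0)).map π₂))
  have hcommon : ∀ κ : Measure (Circle × Circle), IsFiniteMeasure κ → (∀ k, κ ≪ M k) → κ = 0 := by
    intro κ hκ hκM
    by_contra hκ0
    have hcancel : ∀ a b : Circle, (a * (a * b)⁻¹)⁻¹ = b := fun a b => by
      rw [mul_inv a b, mul_inv_cancel_left, inv_inv]
    -- A tie requires the same measure for (xy)⁻¹ in both pairs; W₁ + W₂ dominates the two laws that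
    -- occur.
    set W₁ := (Measure.pi fun j => ρ' 1 ((0 : Fin (q + 3)).succAbove j)).map
      fun z : Fin (q + 2) → Circle => ∏ i, z i with hW₁
    set W₂ := (Measure.pi fun j => ρ' 0 ((1 : Fin (q + 3)).succAbove j)).map
      fun z : Fin (q + 2) → Circle => ∏ i, z i with hW₂
    have k₀ : κ ≪ (ρ 0).prod (ρ 1) := by
      refine (hκM 0).trans ?_
      have h1 := pi_map_coordinate_prod (ρ' 2) 0 (F := fun w : Fin (q + 2) → Circle => w 0)
        (by fun_prop)
      have h2 : (fun z : Fin (q + 3) → Circle => (z 0, z ((0 : Fin (q + 3)).succAbove 0))) = π₀ := rfl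
      rw [h2] at h1
      change (Measure.pi (ρ' 2)).map π₀ ≪ _
      rw [h1]
      refine Measure.AbsolutelyContinuous.prod ?_ ?_
      · simp only [hρ', Function.update_of_ne h02]
        exact Measure.AbsolutelyContinuous.rfl
      · refine (Measure.quasiMeasurePreserving_eval _ 0).absolutelyContinuous.trans ?_
        change ρ' 2 1 ≪ ρ 1
        simp only [hρ', Function.update_of_ne h12]
        exact Measure.AbsolutelyContinuous.rfl
    have k₁ : κ.map (fun p => (p.1, (p.1 * p.2)⁻¹)) ≪ (ρ 0).prod (W₁ + W₂) := by
      refine ((hκM 1).map (by fun_prop)).trans ?_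
      change ((Measure.pi (ρ' 1)).map π₁).map (fun p => (p.1, (p.1 * p.2)⁻¹)) ≪ _
      have h1 := pi_map_coordinate_prod (ρ' 1) 0 hprod'
      have h2 : (fun p : Circle × Circle => (p.1, (p.1 * p.2)⁻¹)) ∘ π₁ =
          fun z => (z 0, ∏ j, z ((0 : Fin (q + 3)).succAbove j)) := by
        funext z
        simp only [Function.comp_apply, π₁]
        rw [Fin.prod_univ_succAbove _ 0, hcancel]
      rw [Measure.map_map (by fun_prop) hπ₁, h2, h1]
      refine Measure.AbsolutelyContinuous.prod ?_
        (Measure.absolutelyContinuous_of_le (Measure.le_add_right le_rfl))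
      simp only [hρ', Function.update_of_ne h01]
      exact Measure.AbsolutelyContinuous.rfl
    have k₂ : κ.map (fun p => (p.2, (p.1 * p.2)⁻¹)) ≪ (ρ 1).prod (W₁ + W₂) := by
      refine ((hκM 2).map (by fun_prop)).trans ?_
      change ((Measure.pi (ρ' 0)).map π₂).map (fun p => (p.2, (p.1 * p.2)⁻¹)) ≪ _
      have h1 := pi_map_coordinate_prod (ρ' 0) 1 hprod'
      have h2 : (fun p : Circle × Circle => (p.2, (p.1 * p.2)⁻¹)) ∘ π₂ =
          fun z => (z 1, ∏ j, z ((1 : Fin (q + 3)).succAbove j)) := by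
        funext z
        simp only [Function.comp_apply, π₂]
        rw [Fin.prod_univ_succAbove _ 1, mul_comm _ (z 1), hcancel]
      rw [Measure.map_map (by fun_prop) hπ₂, h2, h1]
      refine Measure.AbsolutelyContinuous.prod ?_
        (Measure.absolutelyContinuous_of_le (Measure.le_add_left le_rfl))
      simp only [hρ', Function.update_of_ne h01.symm]
      exact Measure.AbsolutelyContinuous.rfl
    have hhaar : ¬ ρ 0 ⟂ₘ Measure.haar := not_mutuallySingular_haar_of_tie
      (fun x => hmix.measure_singleton_eq_zero hT (hA 0) (hρ 0) x) hκ0 k₀ k₁ k₂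
    have hρσ : ρ 0 ≪ σ := hσ.dominates _ _ (isCentredL2_centredIndicator (hA 0)) (hρ 0)
    have hσhaar : ¬ σ ⟂ₘ Measure.haar := fun hs =>
      hhaar (hs.mono_ac hρσ Measure.AbsolutelyContinuous.rfl)
    -- If `A 0` had measure 0 or 1, its spectral measure would be zero and hence singular. So `A 0`
    -- is the nontrivial set needed for σ to charge neighbourhoods of 1.
    have hmass : 0 < μ.real (A 0) - μ.real (A 0) ^ 2 := by
      rw [← (hρ 0).real_univ hT (hA 0)]
      refine measureReal_nonneg.lt_of_ne' fun h0 => hhaar ?_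
      rw [Measure.measure_univ_eq_zero.1 ((measureReal_eq_zero_iff).1 h0)]
      exact Measure.MutuallySingular.zero_left
    have ha0 : 0 < μ.real (A 0) := by nlinarith [sq_nonneg (μ.real (A 0))]
    have ha1 : μ.real (A 0) < 1 := by nlinarith
    exact not_mutuallySingular_convPow hσhaar
      (hσ.ne_zero_of_mem_nhds hT hmix (hA 0) ha0 ha1) hm hn hsing
  have hfm : ∀ i, Measurable (f i) := fun i => measurable_centredIndicator (hA i)
  have hfr : ∀ i, (Set.range (f i)).Finite := fun i => finite_range_centredIndicator (A i)
  have hf1 : ∀ i x, ‖f i x‖ ≤ 1 := fun i => norm_centredIndicator_le (A i)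
  let E : ℤ × ℤ → Fin (q + 3) → ℤ := fun n i => (if i = 0 then n.1 else 0) + if i = 1 then n.2 else 0
  have hzpow : ∀ (a b : ℤ) (z : Fin (q + 3) → Circle) (i₁ : Fin (q + 3)),
      ∏ i, (z i : ℂ) ^ ((if i = i₁ then a else 0) + b) =
        (z i₁ : ℂ) ^ a * ((∏ i, z i : Circle) : ℂ) ^ b := by
    intro a b z i₁
    simp_rw [zpow_add₀ (Circle.coe_ne_zero _), Finset.prod_mul_distrib]
    congr 1
    · rw [Finset.prod_eq_single i₁ (fun i _ hi => by simp [hi]) (by simp)]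
      simp
    · have : ((∏ i, z i : Circle) : ℂ) = ∏ i, (z i : ℂ) := map_prod Circle.coeHom _ _
      rw [Finset.prod_zpow, this]
  rw [Metric.tendsto_nhds]
  intro ε hε
  -- Each of the three pieces contributes less than 2 · ε/6.
  obtain ⟨φ, hφ1, hφM⟩ := exists_trigPoly_decomposition M hcommon
    (ε := ENNReal.ofReal (ε / 6)) (by simpa using by positivity)
  have e₀ := h.eventually_norm_sum_integral_lt hT hinv hfm hfr hf1 (hspec 2) (E := E) (E' := E)
    (c := fun _ => 0) (by simp) (by simp [E, h02.symm, h12.symm]) hπ₀ (by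
      intro n z
      simp only [E, torusChar_apply, π₀]
      simp_rw [zpow_add₀ (Circle.coe_ne_zero _), Finset.prod_mul_distrib]
      congr 1
      · rw [Finset.prod_eq_single 0 (fun i _ hi => by simp [hi]) (by simp)]; simp
      · rw [Finset.prod_eq_single 1 (fun i _ hi => by simp [hi]) (by simp)]; simp)
    (φ 0) (show 0 < ε / 6 by positivity) (hφM 0)
  -- Shifting by -n.2 cancels the exponent at coordinate 1 and adds -n.2 to all others. This is why
  -- (∏ z i)⁻¹ is the second variable.
  have e₁ := h.eventually_norm_sum_integral_lt hT hinv hfm hfr hf1 (hspec 1) (E := E)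
    (E' := fun n i => (if i = 0 then n.1 else 0) + -n.2)
    (c := fun n => -n.2) (by intro n i hi; simp [E, hi]) (by simp [E, h01.symm]) hπ₁ (by
      intro n z
      rw [hzpow]
      simp only [torusChar_apply, π₁, Circle.coe_inv, inv_zpow, zpow_neg])
    (φ 1) (show 0 < ε / 6 by positivity) (hφM 1)
  have e₂ := h.eventually_norm_sum_integral_lt hT hinv hfm hfr hf1 (hspec 0) (E := E)
    (E' := fun n i => (if i = 1 then n.2 else 0) + -n.1)
    (c := fun n => -n.1) (by intro n i hi; simp [E, hi]) (by simp [E, h01]) hπ₂ (by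
      intro n z
      rw [hzpow]
      simp only [torusChar_apply, π₂, Circle.coe_inv, inv_zpow, zpow_neg]
      rw [mul_comm])
    (φ 2) (show 0 < ε / 6 by positivity) (hφM 2)
  filter_upwards [e₀, e₁, e₂] with j h₀ h₁ h₂
  set L : (ℤ × ℤ →₀ ℂ) → ℂ := fun φ => φ.sum fun n a => a * ∫ x, ∏ i,
      f i (((T.toEquiv : Equiv.Perm X) ^ E n i : Equiv.Perm X) (x i)) ∂ν j with hL
  have hLadd : ∀ φ ψ, L (φ + ψ) = L φ + L ψ := fun φ ψ =>
    Finsupp.sum_add_index' (by simp) (by intros; ring)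
  have hL1 : L (Finsupp.single 0 1) = ∫ x, ∏ i, f i (x i) ∂ν j := by
    rw [hL]
    simp only
    rw [Finsupp.sum_single_index (by simp), one_mul]
    simp [E]
  rw [dist_zero_right]
  change ‖∫ x, ∏ i, f i (x i) ∂ν j‖ < ε
  rw [← hL1, ← hφ1, hLadd, hLadd]
  calc ‖L (φ 0) + L (φ 1) + L (φ 2)‖ ≤ ‖L (φ 0)‖ + ‖L (φ 1)‖ + ‖L (φ 2)‖ := norm_add₃_le
    _ < ε := by linarith

/-- Asymptotically face independent joinings are asymptotically independent if two convolution
powers of the maximal spectral measure are mutually singular. -/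
theorem AsymptoticallyFaceIndependent.tendsto_measure_pi
    (hT : MeasurePreserving T μ μ) (hmix : IsMixing T μ) (hσ : IsMaximalSpectralMeasure T μ σ)
    {m n : ℕ} (hm : 1 ≤ m) (hn : 1 ≤ n) (hsing : convPow σ m ⟂ₘ convPow σ n)
    (hinv : ∀ j, (ν j).map (fun x i => T (x i)) = ν j)
    (h : AsymptoticallyFaceIndependent μ ν 𝓕) {A : Fin (q + 3) → Set X}
    (hA : ∀ i, MeasurableSet (A i)) :
    Tendsto (fun j => (ν j).real (Set.univ.pi A)) 𝓕 (𝓝 (∏ i, μ.real (A i))) := by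
  classical
  let a : Fin (q + 3) → ℂ := fun i => (μ.real (A i) : ℂ)
  let B : Finset (Fin (q + 3)) → Fin (q + 3) → Set X := fun t i => if i ∈ t then A i else Set.univ
  have hB : ∀ t i, MeasurableSet (B t i) := by
    intro t i
    by_cases hi : i ∈ t <;> simp [B, hi, hA i]
  have hBpi : ∀ t, MeasurableSet (Set.univ.pi (B t)) := fun t => MeasurableSet.univ_pi (hB t)
  have hBuniv : B Finset.univ = A := by
    funext i; simp [B]
  have hexp : ∀ x : Fin (q + 3) → X, ∏ i, centredIndicator μ (A i) (x i) =
      ∑ t ∈ Finset.univ.powerset,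
        (Set.univ.pi (B t)).indicator (1 : (Fin (q + 3) → X) → ℂ) x *
          ∏ i ∈ Finset.univ \ t, -a i := by
    intro x
    simp only [centredIndicator, sub_eq_add_neg]
    rw [Finset.prod_add]
    refine Finset.sum_congr rfl fun t _ => ?_
    congr 1
    by_cases hx : x ∈ Set.univ.pi (B t)
    · rw [Set.indicator_of_mem hx]
      refine Finset.prod_eq_one fun i hi => Set.indicator_of_mem ?_ _
      have := hx i (Set.mem_univ i)
      simpa [B, hi] using this
    · rw [Set.indicator_of_notMem hx]
      simp only [Set.mem_univ_pi, not_forall] at hx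
      obtain ⟨i, hi⟩ := hx
      by_cases hit : i ∈ t
      · simp only [B, hit, if_true] at hi
        exact Finset.prod_eq_zero hit (Set.indicator_of_notMem hi _)
      · simp [B, hit] at hi
  let R : J → ℂ := fun j => ∑ t ∈ Finset.univ.powerset.erase Finset.univ,
    (((ν j).real (Set.univ.pi (B t)) : ℝ) : ℂ) * ∏ i ∈ Finset.univ \ t, -a i
  have hL : ∀ j, ∫ x, ∏ i, centredIndicator μ (A i) (x i) ∂ν j =
      (((ν j).real (Set.univ.pi A) : ℝ) : ℂ) + R j := by
    intro j
    simp_rw [hexp]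
    rw [integral_finsetSum _ fun t _ => (integrable_indicator_one_complex (hBpi t)).mul_const _,
      ← Finset.add_sum_erase _ _ (Finset.mem_powerset_self Finset.univ)]
    congr 1
    · rw [integral_mul_const, integral_indicator_one_complex (hBpi _), hBuniv]
      simp
    · refine Finset.sum_congr rfl fun t _ => ?_
      rw [integral_mul_const, integral_indicator_one_complex (hBpi t)]
  have hR : Tendsto R 𝓕 (𝓝 (-∏ i, a i)) := by
    -- This is the expansion of ∏ (a i - a i) = 0 without its leading term; each remaining term
    -- omits a coordinate, so face independence gives its limit.
    have h0 : ∑ t ∈ Finset.univ.powerset.erase Finset.univ,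
        ((∏ i, μ.real (B t i) : ℝ) : ℂ) * ∏ i ∈ Finset.univ \ t, -a i = -∏ i, a i := by
      rw [eq_neg_iff_add_eq_zero, add_comm]
      have h1 : ∏ i, (a i + -a i) = 0 := by
        rw [Finset.prod_eq_zero (Finset.mem_univ 0)]
        exact add_neg_cancel _
      rw [Finset.prod_add, ← Finset.add_sum_erase _ _ (Finset.mem_powerset_self Finset.univ)] at h1
      rw [Finset.sdiff_self, Finset.prod_empty, mul_one] at h1
      rw [← h1]
      congr 1
      refine Finset.sum_congr rfl fun t _ => ?_
      congr 1
      rw [Complex.ofReal_prod, ← Finset.prod_subset (Finset.subset_univ t)]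
      · refine Finset.prod_congr rfl fun i hi => ?_
        simp [B, hi, a]
      · intro i _ hi
        simp [B, hi]
    rw [← h0]
    refine tendsto_finsetSum _ fun t ht => Tendsto.mul_const _ ?_
    refine (Complex.continuous_ofReal.tendsto _).comp ?_
    obtain ⟨i₀, hi₀⟩ : ∃ i₀, i₀ ∉ t := by
      by_contra! hall
      exact (Finset.ne_of_mem_erase ht) (Finset.eq_univ_iff_forall.2 hall)
    exact h i₀ (B t) (hB t) (by simp [B, hi₀])
  have hlim := (h.tendsto_integral_centredIndicator hT hmix hσ hm hn hsing hinv hA).sub hR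
  simp_rw [hL, add_sub_cancel_right] at hlim
  rw [zero_sub, neg_neg] at hlim
  have := (Complex.continuous_re.tendsto _).comp hlim
  simpa only [Function.comp_def, Complex.ofReal_re, a, ← Complex.ofReal_prod] using this

end SingularPowers

/-! ### Times of orbit segments and removal of one of them. -/

section PartialSums

/-- The partial sums `m₀ + ⋯ + m_{i-1}`. -/
def partialSum {k : ℕ} (m : Fin k → ℕ) (i : Fin (k + 1)) : ℕ :=
  ∑ j ∈ Finset.univ.filter (fun j : Fin k => (j : ℕ) < (i : ℕ)), m j

lemma partialSum_zero {k : ℕ} (m : Fin k → ℕ) : partialSum m 0 = 0 := by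
  simp [partialSum]

lemma partialSum_succ {k : ℕ} (m : Fin k → ℕ) (l : Fin k) :
    partialSum m l.succ = partialSum m l.castSucc + m l := by
  have : Finset.univ.filter (fun j : Fin k => (j : ℕ) < (l.succ : ℕ)) =
      insert l (Finset.univ.filter (fun j : Fin k => (j : ℕ) < (l.castSucc : ℕ))) := by
    ext j
    simp only [Finset.mem_filter, Finset.mem_univ, true_and, Finset.mem_insert, Fin.val_succ,
      Fin.val_castSucc, Fin.ext_iff]
    omega
  rw [partialSum, this, Finset.sum_insert (by simp), add_comm]
  rfl

lemma partialSum_mono {k : ℕ} (m : Fin k → ℕ) : Monotone (partialSum m) := by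
  intro i i' h
  refine Finset.sum_le_sum_of_subset fun j hj => ?_
  simp only [Finset.mem_filter, Finset.mem_univ, true_and] at hj ⊢
  exact hj.trans_le h

/-- The gaps of the sequence of partial sums from which one member is removed. -/
def mergedGaps {k : ℕ} (i₀ : Fin (k + 2)) (m : Fin (k + 1) → ℕ) (j : Fin k) : ℕ :=
  partialSum m (i₀.succAbove j.succ) - partialSum m (i₀.succAbove j.castSucc)

/-- The offset is nonzero only when the initial time is removed; diagonal invariance absorbs it
later. -/
lemma partialSum_mergedGaps {k : ℕ} (i₀ : Fin (k + 2)) (m : Fin (k + 1) → ℕ) (i : Fin (k + 1)) :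
    partialSum (mergedGaps i₀ m) i + partialSum m (i₀.succAbove 0) =
      partialSum m (i₀.succAbove i) := by
  induction i using Fin.induction with
  | zero => rw [partialSum_zero, zero_add]
  | succ j ih =>
    have h := partialSum_mono m (i₀.strictMono_succAbove.monotone (Fin.castSucc_lt_succ (i := j)).le)
    rw [partialSum_succ, mergedGaps]
    omega

lemma tendsto_mergedGaps {k : ℕ} (i₀ : Fin (k + 2)) :
    Tendsto (mergedGaps (k := k) i₀) atTop atTop := by
  -- Every merged gap contains some original gap `m l`, with l different from j in general, so all
  -- gaps are required to exceed the sum of the bounds.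
  refine tendsto_atTop_atTop.2 fun b => ⟨fun _ => ∑ j, b j, fun m hm j => ?_⟩
  have hlt : i₀.succAbove j.castSucc < i₀.succAbove j.succ :=
    i₀.strictMono_succAbove Fin.castSucc_lt_succ
  set l : Fin (k + 1) := ⟨i₀.succAbove j.castSucc, by
    have := (i₀.succAbove j.succ).isLt
    have := Fin.lt_def.1 hlt
    omega⟩ with hl
  have h1 : l.castSucc = i₀.succAbove j.castSucc := rfl
  have h2 : l.succ ≤ i₀.succAbove j.succ := by
    rw [Fin.le_def, Fin.val_succ]
    exact hlt
  have h3 := partialSum_mono m h2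
  rw [partialSum_succ, h1] at h3
  have h4 : b j ≤ m l := (Finset.single_le_sum (f := b) (fun _ _ => Nat.zero_le _)
    (Finset.mem_univ j)).trans (hm l)
  have h5 : b j ≤ partialSum m (i₀.succAbove j.succ) - partialSum m (i₀.succAbove j.castSucc) := by
    omega
  exact h5

end PartialSums

/-! ### Orbit joinings and conclusion. -/

section Main

variable {X : Type*} [MeasurableSpace X] {T : X ≃ᵐ X} {μ : Measure X} [IsProbabilityMeasure μ]
  {σ : Measure Circle}

lemma measurable_orbit (T : X ≃ᵐ X) {k : ℕ} (m : Fin k → ℕ) :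
    Measurable fun (x : X) (i : Fin (k + 1)) =>
      ((T.toEquiv : Equiv.Perm X) ^ (-(partialSum m i : ℤ)) : Equiv.Perm X) x :=
  measurable_pi_lambda _ fun _ => measurable_zpow T _

/-- The joining given by the orbit segments at the times `-(m₀ + ⋯ + m_{i-1})`. -/
noncomputable def orbitJoining (T : X ≃ᵐ X) (μ : Measure X) {k : ℕ} (m : Fin k → ℕ) :
    Measure (Fin (k + 1) → X) :=
  μ.map fun x i => ((T.toEquiv : Equiv.Perm X) ^ (-(partialSum m i : ℤ)) : Equiv.Perm X) x

instance (k : ℕ) (m : Fin k → ℕ) : IsProbabilityMeasure (orbitJoining T μ m) :=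
  Measure.isProbabilityMeasure_map (measurable_orbit T m).aemeasurable

omit [IsProbabilityMeasure μ] in
lemma orbitJoining_map_prod (hT : MeasurePreserving T μ μ) {k : ℕ} (m : Fin k → ℕ) :
    (orbitJoining T μ m).map (fun x i => T (x i)) = orbitJoining T μ m := by
  have hcomm : (fun (x : Fin (k + 1) → X) i => T (x i)) ∘ (fun x i =>
      ((T.toEquiv : Equiv.Perm X) ^ (-(partialSum m i : ℤ)) : Equiv.Perm X) x) =
      (fun x i => ((T.toEquiv : Equiv.Perm X) ^ (-(partialSum m i : ℤ)) : Equiv.Perm X) x) ∘ T := by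
    funext x i
    have h1 := zpow_add_apply (T := T) 1 (-(partialSum m i : ℤ)) x
    have h2 := zpow_add_apply (T := T) (-(partialSum m i : ℤ)) 1 x
    rw [zpow_one] at h1 h2
    rw [add_comm, h2] at h1
    exact h1.symm
  have hmeas : Measurable fun (x : Fin (k + 1) → X) i => T (x i) :=
    measurable_pi_lambda _ fun i => T.measurable.comp (measurable_pi_apply i)
  rw [orbitJoining, Measure.map_map hmeas (measurable_orbit T m), hcomm,
    ← Measure.map_map (measurable_orbit T m) T.measurable, hT.map_eq]

omit [IsProbabilityMeasure μ] in
lemma orbitJoining_pi {k : ℕ} (m : Fin k → ℕ) {A : Fin (k + 1) → Set X}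
    (hA : ∀ i, MeasurableSet (A i)) :
    orbitJoining T μ m (Set.univ.pi A) =
      μ (⋂ i : Fin (k + 1), (⇑T)^[∑ j ∈ Finset.univ.filter
        (fun j : Fin k => (j : ℕ) < (i : ℕ)), m j] '' A i) := by
  rw [orbitJoining, Measure.map_apply (measurable_orbit T m) (MeasurableSet.univ_pi hA)]
  congr 1
  ext x
  simp only [Set.mem_preimage, Set.mem_univ_pi, Set.mem_iInter, iterate_image_eq]
  rfl

lemma isMixingOfMultiplicity_iff {k : ℕ} :
    IsMixingOfMultiplicity T μ k ↔ ∀ A : Fin (k + 1) → Set X, (∀ i, MeasurableSet (A i)) →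
      Tendsto (fun m : Fin k → ℕ => (orbitJoining T μ m).real (Set.univ.pi A)) atTop
        (𝓝 (∏ i, μ.real (A i))) := by
  refine forall₂_congr fun A hA => ?_
  simp only [measureReal_def, ← ENNReal.toReal_prod]
  rw [ENNReal.tendsto_toReal_iff (fun m => measure_ne_top _ _)
    (ENNReal.prod_ne_top fun i _ => measure_ne_top _ _)]
  simp_rw [orbitJoining_pi _ hA]

omit [IsProbabilityMeasure μ] in
/-- Removing one member of an orbit joining. -/
lemma orbitJoining_pi_of_eq_univ (hT : MeasurePreserving T μ μ) {k : ℕ} (i₀ : Fin (k + 2))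
    (m : Fin (k + 1) → ℕ) {A : Fin (k + 2) → Set X} (hA : ∀ i, MeasurableSet (A i))
    (h₀ : A i₀ = Set.univ) :
    orbitJoining T μ m (Set.univ.pi A) =
      orbitJoining T μ (mergedGaps i₀ m) (Set.univ.pi fun j => A (i₀.succAbove j)) := by
  have hA' : MeasurableSet (Set.univ.pi fun j => A (i₀.succAbove j)) :=
    MeasurableSet.univ_pi fun j => hA _
  have hpres := measurePreserving_zpow hT (-(partialSum m (i₀.succAbove 0) : ℤ))
  rw [orbitJoining, orbitJoining, Measure.map_apply (measurable_orbit T m) (MeasurableSet.univ_pi hA),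
    Measure.map_apply (measurable_orbit T _) hA',
    ← hpres.measure_preimage ((measurable_orbit T _) hA').nullMeasurableSet]
  congr 1
  ext x
  simp only [Set.mem_preimage, Set.mem_univ_pi]
  rw [Fin.forall_iff_succAbove i₀, h₀]
  simp only [Set.mem_univ, true_and]
  refine forall_congr' fun j => ?_
  rw [← zpow_add_apply, ← partialSum_mergedGaps i₀ m j]
  push_cast
  rw [neg_add]

/-- Forgetting one time leaves, up to a power of T, an orbit joining with one coordinate fewer whose
gaps still tend to infinity. -/
lemma IsMixingOfMultiplicity.asymptoticallyFaceIndependent (hT : MeasurePreserving T μ μ) {k : ℕ}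
    (h : IsMixingOfMultiplicity T μ k) :
    AsymptoticallyFaceIndependent μ (fun m : Fin (k + 1) → ℕ => orbitJoining T μ m) atTop := by
  intro i₀ A hA h₀
  have h1 := (isMixingOfMultiplicity_iff.1 h (fun j => A (i₀.succAbove j)) fun j => hA _).comp
    (tendsto_mergedGaps i₀)
  rw [Fin.prod_univ_succAbove _ i₀, h₀, probReal_univ, one_mul]
  refine h1.congr fun m => ?_
  simp only [Function.comp_apply, measureReal_def]
  rw [orbitJoining_pi_of_eq_univ hT i₀ m hA h₀]

/-- Induction on the multiplicity: mixing of multiplicity k is face independence of the joinings for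
k + 1. These have k + 2 ≥ 3 coordinates, as the correlation argument needs. -/
theorem isMixingOfAllMultiplicities_of_mutuallySingular (hT : MeasurePreserving T μ μ)
    (hmix : IsMixing T μ) (hσ : IsMaximalSpectralMeasure T μ σ) {m n : ℕ} (hm : 1 ≤ m)
    (hn : 1 ≤ n) (hsing : convPow σ m ⟂ₘ convPow σ n) : IsMixingOfAllMultiplicities T μ := by
  intro k hk
  induction k, hk using Nat.le_induction with
  | base => exact hmix
  | succ k hk ih =>
    obtain ⟨q, rfl⟩ := Nat.exists_eq_add_of_le' hk
    refine isMixingOfMultiplicity_iff.2 fun A hA => ?_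
    exact (ih.asymptoticallyFaceIndependent hT).tendsto_measure_pi hT hmix hσ hm hn hsing
      (fun m => orbitJoining_map_prod hT m) hA

theorem propertyS_of_mutuallySingular (hT : MeasurePreserving T μ μ)
    (hmix : IsMixing T μ) (hσ : IsMaximalSpectralMeasure T μ σ) {m n : ℕ} (hm : 1 ≤ m)
    (hn : 1 ≤ n) (hsing : convPow σ m ⟂ₘ convPow σ n) {p : ℕ} (hp : 3 ≤ p) :
    PropertyS T μ (p - 1) p := by
  obtain ⟨q, rfl⟩ := Nat.exists_eq_add_of_le' hp
  intro ν hν hface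
  have hprob : IsProbabilityMeasure ν := by
    constructor
    have h1 := hν.map_eval 0
    rw [← measure_univ (μ := μ), ← h1, Measure.map_apply (measurable_pi_apply 0) MeasurableSet.univ,
      Set.preimage_univ]
  -- A single joining is a family over one point, where convergence is equality.
  have hindep : AsymptoticallyFaceIndependent μ (fun _ : Unit => ν) (pure ()) := by
    intro i₀ A hA h₀
    refine tendsto_const_nhds.congr fun _ => ?_
    have h1 := hface (Finset.univ.erase i₀) (by
      rw [Finset.card_erase_of_mem (Finset.mem_univ _), Finset.card_univ, Fintype.card_fin])
    set s := Finset.univ.erase i₀ with hs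
    have h2 : Set.univ.pi A = (fun (x : Fin (q + 3) → X) (i : s) => x i) ⁻¹'
        Set.univ.pi fun i : s => A i := by
      ext x
      simp only [Set.mem_univ_pi, Set.mem_preimage]
      refine ⟨fun h i => h i, fun h i => ?_⟩
      by_cases hi : i = i₀
      · rw [hi, h₀]; exact Set.mem_univ _
      · exact h ⟨i, Finset.mem_erase.2 ⟨hi, Finset.mem_univ i⟩⟩
    have h3 : ν (Set.univ.pi A) = ∏ i : s, μ (A i) := by
      have hmeas : Measurable fun (x : Fin (q + 3) → X) (i : s) => x i :=
        measurable_pi_lambda _ fun i => measurable_pi_apply _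
      rw [h2, ← Measure.map_apply hmeas (MeasurableSet.univ_pi fun i : s => hA i), h1,
        Measure.pi_pi]
    rw [measureReal_def, h3, ENNReal.toReal_prod, Finset.prod_coe_sort s fun i => (μ (A i)).toReal,
      hs, ← Finset.mul_prod_erase Finset.univ (fun i => μ.real (A i)) (Finset.mem_univ i₀), h₀,
      probReal_univ, one_mul]
    rfl
  refine (Measure.pi_eq fun A hA => ?_).symm
  have h1 := hindep.tendsto_measure_pi hT hmix hσ hm hn hsing (fun _ => hν.map_prod) hA
  have h2 := tendsto_nhds_unique tendsto_const_nhds h1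
  simp only [measureReal_def, ← ENNReal.toReal_prod] at h2
  exact (ENNReal.toReal_eq_toReal_iff' (measure_ne_top _ _)
    (ENNReal.prod_ne_top fun i _ => measure_ne_top _ _)).1 h2

end Main
end MultipleMixing

theorem mainTheorem2 {X : Type*} [MeasurableSpace X] (μ : Measure X) [IsProbabilityMeasure μ]
    (T : X ≃ᵐ X) (hT : MeasurePreserving T μ μ) (hmix : MultipleMixing.IsMixing T μ)
    (σ : Measure Circle) (hσ : MultipleMixing.IsMaximalSpectralMeasure T μ σ) :
    (σ ⟂ₘ MultipleMixing.convPow σ 5 →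
      (∀ p : ℕ, 3 ≤ p → MultipleMixing.PropertyS T μ (p - 1) p) ∧
        MultipleMixing.IsMixingOfAllMultiplicities T μ) ∧
    (∀ m n : ℕ, 1 ≤ m → 1 ≤ n →
      MultipleMixing.convPow σ m ⟂ₘ MultipleMixing.convPow σ n →
        MultipleMixing.IsMixingOfAllMultiplicities T μ) := by
  have := hσ.isFinite
  refine ⟨fun h => ?_, fun m n hm hn h =>
    MultipleMixing.isMixingOfAllMultiplicities_of_mutuallySingular hT hmix hσ hm hn h⟩
  -- The first part is the pair of exponents 1 and 5 in the general statement.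
  have h1 : MultipleMixing.convPow σ 1 ⟂ₘ MultipleMixing.convPow σ 5 := by
    have : MultipleMixing.convPow σ 1 = σ := by
      rw [MultipleMixing.convPow, MultipleMixing.convPow, Measure.dirac_one_mconv]
    rwa [this]
  exact ⟨fun p hp => MultipleMixing.propertyS_of_mutuallySingular hT hmix hσ le_rfl
    (by norm_num) h1 hp, MultipleMixing.isMixingOfAllMultiplicities_of_mutuallySingular hT hmix hσ
    le_rfl (by norm_num) h1⟩
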